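/- **Setting.** Let $\Omega=(0,1)$, let $\langle\cdot,\cdot\rangle$ and $\|\cdot\|$ be the inner product and norm of $L_2(\Omega)$, and let $p\ge 3$ be an integer, $\sigma\ge p+1$, $\lambda\ge 3$, $M$ real numbers. Let $0<\varepsilon\le 1$, let $N$ be a positive integer divisible by $4$, and assume $\sigma\varepsilon\ln N\le \tfrac14$. *Problem.* Let $f\in L_2(\Omega)$ and let $u\in H^4(\Omega)\cap H^2_0(\Omega)$ be the solution of $$\varepsilon^4u^{(4)}+4u=f\ \text{ in }\Omega,\qquad u(\xi)=u'(\xi)=0,\quad \xi\in\{0,1\}.$$ Assume that $u=u_{\mathrm{bl},0}+u_{\mathrm{reg}}+u_{\mathrm{bl},1}$ on $[0,1]$, where the three components are $p+3$ times differentiable on $[0,1]$, satisfy $\varepsilon^4u_{\mathrm{reg}}^{(4)}+4u_{\mathrm{reg}}=f$ and $\varepsilon^4u_{\mathrm{bl},i}^{(4)}+4u_{\mathrm{bl},i}=0$ in $\Omega$ ($i=0,1$), and, for all $x\in[0,1]$ and $\kappa=0,1,\dots,p+3$, $$|u_{\mathrm{reg}}^{(\kappa)}(x)|\le M,\qquad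 |u_{\mathrm{bl},0}^{(\kappa)}(x)|\le M\varepsilon^{-\kappa}e^{-x/\varepsilon},\qquad |u_{\mathrm{bl},1}^{(\kappa)}(x)|\le M\varepsilon^{-\kappa}e^{-(1-x)/\varepsilon}.$$ Put $v=\varepsilon^{3/2}u''$, $u_{\mathrm{bl}}=u_{\mathrm{bl},0}+u_{\mathrm{bl},1}$, $v_{\mathrm{reg}}=\varepsilon^{3/2}u_{\mathrm{reg}}''$, $v_{\mathrm{bl}}=\varepsilon^{3/2}u_{\mathrm{bl}}''$. *Finite element method.* Let $\tau=\min\{\tfrac14,\sigma\varepsilon\ln N\}$ $(=\sigma\varepsilon\ln N)$, and let $0=x_0<\dots<x_N=1$ be the Shishkin mesh that divides $[0,\tau]$ and $[1-\tau,1]$ uniformly into $N/4$ cells each and $[\tau,1-\tau]$ uniformly into $N/2$ cells. Let $V_h$ be the set of pairs $(s,t)\in H^2_0(\Omega)\times H^2(\Omega)$ of $C^1[0,1]$ functions that are polynomials of degree at most $p$ on each cell, and let $$\mathcal B\bigl((u,v),(u_*,v_*)\bigr)=\lambda\langle v-\varepsilon^{3/2}u'',v_*-\varepsilon^{3/2}u_*''\rangle+\langle\varepsilon^{5/2}v''+4u,\varepsilon^{3/2}v_*''+4u_*\rangle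 .$$ Let $(u_h,v_h)\in V_h$ be the solution of $$\mathcal B\bigl((u_h,v_h),(u_*,v_*)\bigr)=\langle f,\varepsilon^{3/2}v_*''+4u_*\rangle\qquad\forall (u_*,v_*)\in V_h .$$ *Special interpolants.* For a cell $J=(a,b)$ let $I_Jw$ be the polynomial of degree at most $p$ with $(I_Jw-w)(a)=(I_Jw-w)'(a)=0$ and $\int_a^b(I_Jw-w)''q\,dx=0$ for all polynomials $q$ of degree at most $p-2$, and let $Iw$ be the function with $Iw=I_Jw$ on each cell $J$. Let $\chi_0,\chi_1$ be the cubic polynomials with $\chi_0(0)=\chi_0'(0)=\chi_0(\tau)=0$, $\chi_0'(\tau)=1$ and $\chi_1(0)=\chi_1'(0)=\chi_1'(\tau)=0$, $\chi_1(\tau)=1$. For $(w,w_{\mathrm{reg}},w_{\mathrm{bl}})=(u,u_{\mathrm{reg}},u_{\mathrm{bl}})$ and $(v,v_{\mathrm{reg}},v_{\mathrm{bl}})$ define $\tilde w=\tilde u$ and $\tilde w=\tilde v$, respectively, by $$\tilde w(x)=\begin{cases}(Iw)(x)-\chi_0(x)w_{\mathrm{bl}}'(\tau)-\chi_1(x)w_{\mathrm{bl}}(\tau),&x\in[0,\tau],\\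 (Iw_{\mathrm{reg}})(x),&x\in[\tau,1-\tau],\\ (Iw)(x)+\chi_0(1-x)w_{\mathrm{bl}}'(1-\tau)-\chi_1(1-x)w_{\mathrm{bl}}(1-\tau),&x\in[1-\tau,1].\end{cases}$$ *Balanced norm.* Let $|||(u,v)|||^2=\|u\|^2+\varepsilon^3\|u''\|^2+\|v\|^2+\varepsilon^4\|v''\|^2$. **Proposition.** There is a constant $C>0$, depending only on $p,\sigma,\lambda,M$ (in particular not on $\varepsilon$ or $N$), such that in the above setting $$|||(\tilde u-u_h,\tilde v-v_h)|||\le C\Bigl\{(\ln N)^{p+1}+|\lambda-4|\min\bigl\{\varepsilon^{3/2}N^2,\varepsilon^{-1/2}\bigr\}\Bigr\}N^{-(p+1)} .$$ -/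

import Mathlib

open Set MeasureTheory Polynomial

namespace ThinShell

noncomputable section

/-! Functions on the closed unit interval are represented by total functions `ℝ → ℝ`; every
notion below depends only on their values on `[0,1]`. -/

/-- The `k`-th derivative on `[0,1]` (one-sided at the two end points). -/
abbrev D (k : ℕ) (w : ℝ → ℝ) : ℝ → ℝ := iteratedDerivWithin k w (Icc 0 1)

/-- `w` possesses derivatives up to order `K` at every point of `[0,1]`. -/
def DiffUpTo (K : ℕ) (w : ℝ → ℝ) : Prop :=
  ∀ k < K, DifferentiableOn ℝ (D k w) (Icc 0 1)

/-! ### Sobolev spaces and the boundary value problem -/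

/-- The space `L_2(0,1)`. -/
def MemL2 (w : ℝ → ℝ) : Prop := MemLp w 2 (volume.restrict (Ioo 0 1))

/-- The Sobolev space `H^2(0,1)`, by means of the continuously differentiable representatives:
`w'` is absolutely continuous on `[0,1]` and `w''`, which exists almost everywhere, is
in `L_2(0,1)`. -/
structure MemH2 (w : ℝ → ℝ) : Prop where
  diff : DifferentiableOn ℝ w (Icc 0 1)
  ac : AbsolutelyContinuousOnInterval (D 1 w) 0 1
  memL2 : MemL2 (D 2 w)

/-- Homogeneous boundary conditions `w(ξ) = w'(ξ) = 0`, `ξ ∈ {0,1}`. -/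
structure Clamped (w : ℝ → ℝ) : Prop where
  value_zero : w 0 = 0
  slope_zero : D 1 w 0 = 0
  value_one : w 1 = 0
  slope_one : D 1 w 1 = 0

/-- The Sobolev space `H^2_0(0,1)`. -/
structure MemH20 (w : ℝ → ℝ) : Prop extends MemH2 w, Clamped w

/-- `u ∈ H^4(0,1) ∩ H^2_0(0,1)` solves `ε^4 u'''' + 4 u = f` in `(0,1)`,
`u(ξ) = u'(ξ) = 0` for `ξ ∈ {0,1}`. -/
structure IsSolution (ε : ℝ) (f u : ℝ → ℝ) : Prop where
  diff : DiffUpTo 3 u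
  ac : AbsolutelyContinuousOnInterval (D 3 u) 0 1
  memL2 : MemL2 (D 4 u)
  ode : ∀ᵐ x ∂(volume.restrict (Ioo (0 : ℝ) 1)), ε ^ 4 * D 4 u x + 4 * u x = f x
  clamped : Clamped u

/-- The decomposition `u = u_bl,0 + u_reg + u_bl,1` on `[0,1]` into a regular component and two
boundary layer components, with derivative bounds up to the order `K` and with the constant `M`. -/
structure IsDecomp (K : ℕ) (M ε : ℝ) (f u ureg ubl₀ ubl₁ : ℝ → ℝ) : Prop where
  sum : ∀ x ∈ Icc (0 : ℝ) 1, u x = ubl₀ x + ureg x + ubl₁ x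
  diff_reg : DiffUpTo K ureg
  diff_bl₀ : DiffUpTo K ubl₀
  diff_bl₁ : DiffUpTo K ubl₁
  bound_reg : ∀ k ≤ K, ∀ x ∈ Icc (0 : ℝ) 1, |D k ureg x| ≤ M
  bound_bl₀ : ∀ k ≤ K, ∀ x ∈ Icc (0 : ℝ) 1,
    |D k ubl₀ x| ≤ M * ((ε ^ k)⁻¹ * Real.exp (-x / ε))
  bound_bl₁ : ∀ k ≤ K, ∀ x ∈ Icc (0 : ℝ) 1,
    |D k ubl₁ x| ≤ M * ((ε ^ k)⁻¹ * Real.exp (-(1 - x) / ε))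
  ode_reg : ∀ᵐ x ∂(volume.restrict (Ioo (0 : ℝ) 1)), ε ^ 4 * D 4 ureg x + 4 * ureg x = f x
  ode_bl₀ : ∀ x ∈ Ioo (0 : ℝ) 1, ε ^ 4 * D 4 ubl₀ x + 4 * ubl₀ x = 0
  ode_bl₁ : ∀ x ∈ Ioo (0 : ℝ) 1, ε ^ 4 * D 4 ubl₁ x + 4 * ubl₁ x = 0

/-! ### Bilinear form, linear functional and balanced norm -/

/-- `B((u,v),(u_*,v_*)) = λ ⟨v - ε^{3/2} u'', v_* - ε^{3/2} u_*''⟩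
  + ⟨ε^{5/2} v'' + 4 u, ε^{3/2} v_*'' + 4 u_*⟩`. -/
def bilin (lam ε : ℝ) (U W : (ℝ → ℝ) × (ℝ → ℝ)) : ℝ :=
  lam * (∫ x in (0 : ℝ)..1, (U.2 x - ε ^ (3 / 2 : ℝ) * D 2 U.1 x) *
      (W.2 x - ε ^ (3 / 2 : ℝ) * D 2 W.1 x)) +
    ∫ x in (0 : ℝ)..1, (ε ^ (5 / 2 : ℝ) * D 2 U.2 x + 4 * U.1 x) *
      (ε ^ (3 / 2 : ℝ) * D 2 W.2 x + 4 * W.1 x)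

/-- `F((u_*,v_*)) = ⟨f, ε^{3/2} v_*'' + 4 u_*⟩`. -/
def load (ε : ℝ) (f : ℝ → ℝ) (W : (ℝ → ℝ) × (ℝ → ℝ)) : ℝ :=
  ∫ x in (0 : ℝ)..1, f x * (ε ^ (3 / 2 : ℝ) * D 2 W.2 x + 4 * W.1 x)

/-- The squared norm of `L_2(0,1)`. -/
def normSq (w : ℝ → ℝ) : ℝ := ∫ x in (0 : ℝ)..1, w x ^ 2

/-- The balanced norm: the square root of
`‖u‖^2 + ε^3 ‖u''‖^2 + ‖v‖^2 + ε^4 ‖v''‖^2`. -/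
def balancedNorm (ε : ℝ) (U : (ℝ → ℝ) × (ℝ → ℝ)) : ℝ :=
  Real.sqrt (normSq U.1 + ε ^ 3 * normSq (D 2 U.1) + normSq U.2 + ε ^ 4 * normSq (D 2 U.2))

/-! ### Shishkin mesh, splines and the finite element method -/

/-- The mesh transition point `τ = min {1/4, σ ε ln N}`. -/
def transition (σ ε : ℝ) (N : ℕ) : ℝ := min (1 / 4) (σ * ε * Real.log N)

/-- The nodes `x_0 < x_1 < ⋯ < x_N` of the mesh with transition point `τ`, for `4 ∣ N`: each of
`[0,τ]` and `[1-τ,1]` is uniformly divided into `N/4` cells and `[τ,1-τ]` into `N/2` cells. -/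
def node (τ : ℝ) (N i : ℕ) : ℝ :=
  if 4 * i ≤ N then i * (4 * τ / N)
  else if 4 * i ≤ 3 * N then τ + (i - N / 4 : ℝ) * (2 * (1 - 2 * τ) / N)
  else 1 - (N - i : ℝ) * (4 * τ / N)

/-- The spline space `S_p^k` for the nodes `x 0 < ⋯ < x N`. -/
structure IsSpline (p k : ℕ) (x : ℕ → ℝ) (N : ℕ) (s : ℝ → ℝ) : Prop where
  contDiff : ContDiffOn ℝ k s (Icc 0 1)
  piecewise : ∀ i < N, ∃ P : ℝ[X], P.natDegree ≤ p ∧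
    ∀ t ∈ Ioo (x i) (x (i + 1)), s t = P.eval t

/-- The finite element space `V_h = (S_p^1)^2 ∩ (H^2_0 × H^2)`. -/
def feSpace (p : ℕ) (x : ℕ → ℝ) (N : ℕ) : Set ((ℝ → ℝ) × (ℝ → ℝ)) :=
  {W | IsSpline p 1 x N W.1 ∧ IsSpline p 1 x N W.2 ∧ MemH20 W.1 ∧ MemH2 W.2}

/-- `U = (u_h, v_h)` is the finite element solution: `U ∈ V_h` and `B(U,W) = F(W)` for
all `W ∈ V_h`. -/
def IsFEMSolution (p : ℕ) (x : ℕ → ℝ) (N : ℕ) (lam ε : ℝ) (f : ℝ → ℝ)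
    (U : (ℝ → ℝ) × (ℝ → ℝ)) : Prop :=
  U ∈ feSpace p x N ∧ ∀ W ∈ feSpace p x N, bilin lam ε U W = load ε f W

/-! ### Local interpolation -/

/-- `P` is the local interpolant of `w` on `(a,b)`: a polynomial of degree at most `p` with
`(P-w)(a) = (P-w)'(a) = 0` and `(P-w)''` orthogonal to all polynomials of degree at
most `p-2`. -/
structure IsLocalInterp (p : ℕ) (a b : ℝ) (w : ℝ → ℝ) (P : ℝ[X]) : Prop where
  degree : P.natDegree ≤ p
  value : P.eval a = w a
  slope : P.derivative.eval a = D 1 w a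
  orth : ∀ q : ℝ[X], q.natDegree + 2 ≤ p →
    ∫ x in a..b, (P.derivative.derivative.eval x - D 2 w x) * q.eval x = 0

lemma intg (w : ℝ → ℝ) {a b : ℝ} (hw : IntervalIntegrable (D 2 w) volume a b) (q : ℝ[X]) :
    IntervalIntegrable (fun x => D 2 w x * q.eval x) volume a b :=
  hw.mul_continuousOn q.continuous.continuousOn

lemma eq_zero_of_integral_sq {a b : ℝ} (hab : a < b) (q : ℝ[X])
    (h : ∫ x in a..b, q.eval x * q.eval x = 0) : q = 0 := by
  have h2 : ∀ x ∈ Icc a b, q.eval x = 0 := by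
    intro x hx
    by_contra hne
    have := intervalIntegral.integral_pos (f := fun x => q.eval x * q.eval x) hab
      (q.continuous.mul q.continuous).continuousOn (fun y _ => mul_self_nonneg _)
      ⟨x, hx, mul_self_pos.2 hne⟩
    linarith
  exact Polynomial.eq_zero_of_infinite_isRoot q
    ((Icc_infinite hab).mono fun x hx => h2 x hx)

lemma exists_antideriv (q : ℝ[X]) : ∃ r : ℝ[X], r.derivative = q := by
  induction q using Polynomial.induction_on' with
  | add p q hp hq =>
    obtain ⟨r, rfl⟩ := hp
    obtain ⟨s, rfl⟩ := hq
    exact ⟨r + s, by simp⟩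
  | monomial n c =>
    refine ⟨monomial (n + 1) (c / (n + 1)), ?_⟩
    rw [derivative_monomial]
    have : (n : ℝ) + 1 ≠ 0 := by positivity
    simp [this]

lemma exists_proj (w : ℝ → ℝ) {a b : ℝ} (hab : a < b)
    (hw : IntervalIntegrable (D 2 w) volume a b) (n : ℕ) :
    ∃ Q ∈ degreeLE ℝ n, ∀ q ∈ degreeLE ℝ n,
      ∫ x in a..b, (Q.eval x - D 2 w x) * q.eval x = 0 := by
  have hc : ∀ r s : ℝ[X], IntervalIntegrable (fun x => r.eval x * s.eval x) volume a b :=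
    fun r s => (r.continuous.mul s.continuous).intervalIntegrable _ _
  let S := degreeLE ℝ n
  have : FiniteDimensional ℝ S := by
    have : S = degreeLT ℝ (n + 1) := by
      ext f; simp only [S, mem_degreeLE, mem_degreeLT]
      rw [Polynomial.degree_lt_iff_coeff_zero, Polynomial.degree_le_iff_coeff_zero]
      refine forall_congr' fun m => ?_
      rw [Nat.cast_lt, Nat.succ_le_iff]
    rw [this]
    exact Module.Finite.equiv (degreeLTEquiv ℝ (n + 1)).symm
  let T : S →ₗ[ℝ] Module.Dual ℝ S := LinearMap.mk₂ ℝ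
    (fun r s => ∫ x in a..b, (r : ℝ[X]).eval x * (s : ℝ[X]).eval x)
    (fun r s t => by
      simp only [Submodule.coe_add, eval_add, add_mul]
      exact intervalIntegral.integral_add (hc _ _) (hc _ _))
    (fun c r s => by
      simp only [Submodule.coe_smul, eval_smul, smul_eq_mul, mul_assoc]
      exact intervalIntegral.integral_const_mul _ _)
    (fun r s t => by
      simp only [Submodule.coe_add, eval_add, mul_add]
      exact intervalIntegral.integral_add (hc _ _) (hc _ _))
    (fun c r s => by
      simp only [Submodule.coe_smul, eval_smul, smul_eq_mul, mul_left_comm _ c]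
      exact intervalIntegral.integral_const_mul _ _)
  have hT : Function.Injective T := by
    rw [injective_iff_map_eq_zero]
    intro r hr
    have : T r r = 0 := by rw [hr]; rfl
    exact Subtype.ext (eq_zero_of_integral_sq hab _ this)
  have hsurj : Function.Surjective T :=
    (LinearMap.injective_iff_surjective_of_finrank_eq_finrank
      (Subspace.dual_finrank_eq).symm).1 hT
  let L : Module.Dual ℝ S :=
    { toFun := fun s => ∫ x in a..b, D 2 w x * (s : ℝ[X]).eval x
      map_add' := fun r s => by
        simp only [Submodule.coe_add, eval_add, mul_add]
        exact intervalIntegral.integral_add (intg w hw _) (intg w hw _)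
      map_smul' := fun c r => by
        simp only [Submodule.coe_smul, eval_smul, smul_eq_mul, mul_left_comm _ c,
          RingHom.id_apply]
        exact intervalIntegral.integral_const_mul _ _ }
  obtain ⟨Q, hQ⟩ := hsurj L
  refine ⟨Q, Q.2, fun q hq => ?_⟩
  have h1 : T Q ⟨q, hq⟩ = L ⟨q, hq⟩ := by rw [hQ]
  simp only [sub_mul]
  rw [intervalIntegral.integral_sub (hc _ _) (intg w hw _)]
  exact sub_eq_zero.2 h1

/-- The local interpolant exists and is unique. -/
theorem existsUnique_localInterp {p : ℕ} (hp : 2 ≤ p) {a b : ℝ} (hab : a < b) (w : ℝ → ℝ)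
    (hw : IntervalIntegrable (D 2 w) volume a b) : ∃! P, IsLocalInterp p a b w P := by
  obtain ⟨n, rfl⟩ := Nat.exists_eq_add_of_le' hp
  have hdeg : ∀ q : ℝ[X], q.natDegree ≤ n ↔ q ∈ degreeLE ℝ n := fun q => by
    rw [mem_degreeLE, natDegree_le_iff_degree_le]
  obtain ⟨Q, hQ, hQo⟩ := exists_proj w hab hw n
  obtain ⟨R, hR⟩ := exists_antideriv Q
  obtain ⟨R', hR'⟩ := exists_antideriv (R + C (D 1 w a - R.eval a))
  have hd2 : ∀ P : ℝ[X], P.natDegree ≤ n + 2 → P.derivative.derivative.natDegree ≤ n :=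
    fun P hP => by
      have h1 := natDegree_derivative_le P
      have h2 := natDegree_derivative_le P.derivative
      omega
  have hR'd : R'.derivative.derivative = Q := by rw [hR']; simp [hR]
  refine ⟨R' + C (w a - R'.eval a), ⟨?_, by simp, by simp [hR'], fun q hq => ?_⟩, ?_⟩
  · rw [natDegree_add_C]
    have h1 : R'.derivative.natDegree = R'.natDegree - 1 := natDegree_derivative R'
    have h2 : R'.derivative.derivative.natDegree = R'.derivative.natDegree - 1 :=
      natDegree_derivative R'.derivative
    rw [hR'd] at h2
    have := (hdeg Q).2 hQ
    omega
  · simp only [derivative_add, derivative_C, add_zero, hR'd]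
    exact hQo q ((hdeg q).1 (by omega))
  · intro P hP
    set P₀ := R' + C (w a - R'.eval a) with hP₀
    have hP₀d : P₀.derivative.derivative = Q := by simp [hP₀, hR'd]
    have h2 : P.derivative.derivative = Q := by
      rw [← sub_eq_zero]
      set E := P.derivative.derivative - Q with hE
      have hEd : E ∈ degreeLE ℝ n :=
        Submodule.sub_mem _ ((hdeg _).1 (hd2 P hP.degree)) hQ
      apply eq_zero_of_integral_sq hab
      have e1 := hP.orth E (by have := (hdeg E).2 hEd; omega)
      have e2 := hQo E hEd
      have i : ∀ r : ℝ[X], IntervalIntegrable (fun x => (r.eval x - D 2 w x) * E.eval x)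
          volume a b := fun r => by
        simp only [sub_mul]
        exact ((r.continuous.mul E.continuous).intervalIntegrable _ _).sub (intg w hw _)
      have e3 := intervalIntegral.integral_sub (i P.derivative.derivative) (i Q)
      rw [e1, e2, sub_zero] at e3
      rw [← e3]
      refine intervalIntegral.integral_congr fun x _ => ?_
      simp only [hE, eval_sub]; ring
    have key : ∀ A B : ℝ[X], A.derivative = B.derivative → A.eval a = B.eval a → A = B := by
      intro A B h1 h2
      have h3 : (A - B).natDegree = 0 := derivative_eq_zero.1 (by simp [h1])
      rw [natDegree_eq_zero] at h3
      obtain ⟨c, hc⟩ := h3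
      have h4 : (A - B).eval a = 0 := by simp [h2]
      rw [← hc, eval_C] at h4
      rw [← sub_eq_zero, ← hc, h4, C_0]
    refine key _ _ (key _ _ (h2.trans hP₀d.symm) ?_) ?_
    · rw [hP.slope]; simp [hP₀, hR']
    · rw [hP.value]; simp [hP₀]

/-- The local interpolant `I_J w`, `J = (a,b)`. -/
def localInterp (p : ℕ) (a b : ℝ) (w : ℝ → ℝ) : ℝ[X] :=
  Classical.epsilon (IsLocalInterp p a b w)

theorem isLocalInterp_localInterp {p : ℕ} (hp : 2 ≤ p) {a b : ℝ} (hab : a < b) (w : ℝ → ℝ)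
    (hw : IntervalIntegrable (D 2 w) volume a b) :
    IsLocalInterp p a b w (localInterp p a b w) :=
  Classical.epsilon_spec (existsUnique_localInterp hp hab w hw).exists

open Classical in
/-- The global interpolant `I w`, which equals `I_J w` on each cell `J` of the mesh: on
`[x_i, x_{i+1})`, and for `i + 1 = N` also at `x_N`, it is the local interpolant
on `(x_i, x_{i+1})`. -/
def interp (p : ℕ) (x : ℕ → ℝ) (N : ℕ) (w : ℝ → ℝ) (t : ℝ) : ℝ :=
  let i := Nat.findGreatest (fun j => x j ≤ t) (N - 1)
  (localInterp p (x i) (x (i + 1)) w).eval t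

/-! ### The special representatives -/

/-- The cubic with `χ₀(0) = χ₀'(0) = χ₀(τ) = 0` and `χ₀'(τ) = 1`. -/
def chi₀ (τ : ℝ) : ℝ[X] := C (1 / τ ^ 2) * X ^ 2 * (X - C τ)

/-- The cubic with `χ₁(0) = χ₁'(0) = χ₁'(τ) = 0` and `χ₁(τ) = 1`. -/
def chi₁ (τ : ℝ) : ℝ[X] := C (1 / τ ^ 3) * X ^ 2 * (C (3 * τ) - C 2 * X)

theorem chi₀_spec {τ : ℝ} (hτ : τ ≠ 0) : (chi₀ τ).natDegree ≤ 3 ∧ (chi₀ τ).eval 0 = 0 ∧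
    (chi₀ τ).derivative.eval 0 = 0 ∧ (chi₀ τ).eval τ = 0 ∧ (chi₀ τ).derivative.eval τ = 1 := by
  refine ⟨?_, ?_, ?_, ?_, ?_⟩
  · unfold chi₀; compute_degree
  all_goals simp [chi₀]
  field_simp

theorem chi₁_spec {τ : ℝ} (hτ : τ ≠ 0) : (chi₁ τ).natDegree ≤ 3 ∧ (chi₁ τ).eval 0 = 0 ∧
    (chi₁ τ).derivative.eval 0 = 0 ∧ (chi₁ τ).derivative.eval τ = 0 ∧ (chi₁ τ).eval τ = 1 := by
  refine ⟨?_, ?_, ?_, ?_, ?_⟩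
  · unfold chi₁; compute_degree
  all_goals simp [chi₁]
  · field_simp; ring
  · field_simp; ring

/-- The common construction of the special representatives of a function
`w = w_reg + w_bl` on the mesh `x` with transition point `τ`: on `[0,τ]`
and `[1-τ,1]` the interpolant of `w`, corrected by cubics, and on `[τ,1-τ]` the interpolant
of `w_reg`. -/
def special (p : ℕ) (x : ℕ → ℝ) (N : ℕ) (τ : ℝ) (w wreg wbl : ℝ → ℝ) (t : ℝ) : ℝ :=
  if t < τ then
    interp p x N w t - (chi₀ τ).eval t * D 1 wbl τ - (chi₁ τ).eval t * wbl τ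
  else if t < 1 - τ then
    interp p x N wreg t
  else
    interp p x N w t + (chi₀ τ).eval (1 - t) * D 1 wbl (1 - τ)
      - (chi₁ τ).eval (1 - t) * wbl (1 - τ)

/-- The function `ε^{3/2} w''`. -/
def scaledSecond (ε : ℝ) (w : ℝ → ℝ) (t : ℝ) : ℝ := ε ^ (3 / 2 : ℝ) * D 2 w t

/-- The special representative `ũ` of `u`, with `u_bl = u_bl,0 + u_bl,1`. -/
def uTilde (p : ℕ) (x : ℕ → ℝ) (N : ℕ) (τ : ℝ) (u ureg ubl₀ ubl₁ : ℝ → ℝ) : ℝ → ℝ :=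
  special p x N τ u ureg (ubl₀ + ubl₁)

/-- The special representative `ṽ` of `v = ε^{3/2} u''`, with `v_reg = ε^{3/2} u_reg''` and
`v_bl = ε^{3/2} (u_bl,0 + u_bl,1)''`. -/
def vTilde (p : ℕ) (x : ℕ → ℝ) (N : ℕ) (τ ε : ℝ) (u ureg ubl₀ ubl₁ : ℝ → ℝ) : ℝ → ℝ :=
  special p x N τ (scaledSecond ε u) (scaledSecond ε ureg) (scaledSecond ε (ubl₀ + ubl₁))

end

end ThinShell

open ThinShell

/-! Put E = ũ - u_h and F = ṽ - v_h; the pair lies in V_h. The form is coercive in the balanced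
norm: since E is clamped, Green's identity turns the mixed term ⟨F'',E⟩ into ⟨F,E''⟩, and for λ ≥ 3,
ε ≤ 1 the rest is a pointwise inequality between quadratic forms (`sum_energyDensity_le`). The exact
pair (u,v) has zero residual, so B((E,F),(E,F)) is the residual of (ũ,ṽ) tested with (E,F)
(`galerkin_orthogonality`).

On each cell ũ - u = a_u + c_u, and likewise for v. Here a is an interpolation error (of the regular
part on coarse cells, of the whole function on fine ones), and c is the cubic correction on fine
cells and minus the layer on coarse ones. The interpolant makes a'' orthogonal to degree p - 2,
while a and a' vanish at both ends of the cell. Hence ⟨a_u'',E''⟩ = ⟨a_v'',F''⟩ = 0, ⟨a_u'',F⟩ =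
⟨a_u,F''⟩ and ⟨a_v'',E⟩ = ⟨a_v,E''⟩: no derivative of a survives, which is the source of the
supercloseness. Young's inequality handles everything except (4-λ)ε^{3/2}⟨a_u,F''⟩, because the norm
controls only ε²‖F''‖. This term costs a factor ε^{-1/2} or, by an inverse inequality on coarse
cells, ε^{3/2}N² (`consistency_cell`, `inverse_le_of_coarse`).

It remains to measure a and c. Fine cells have length of order ε ln N / N, so a is (ln N / N)^{p+1}
times √ε plus the layer, with one more ε^{-1/2} for v; a weight ε^{-1/2} is harmless because layers
have L₂ norm O(√ε). On coarse cells only regular parts are interpolated, with error O(N^{-(p+1)}).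
All c carry e^{-τ/ε} = N^{-σ} ≤ N^{-(p+1)}, in L₂ on the coarse part (`sum_cellError_le_const`). -/

namespace ThinShell

/-! ### Derivatives on the unit interval -/

theorem D_zero (w : ℝ → ℝ) : D 0 w = w := iteratedDerivWithin_zero

theorem D_succ (k : ℕ) (w : ℝ → ℝ) : D (k + 1) w = derivWithin (D k w) (Icc 0 1) :=
  iteratedDerivWithin_succ

theorem uniqueDiffWithinAt_Icc_zero_one {t : ℝ} (ht : t ∈ Icc (0 : ℝ) 1) :
    UniqueDiffWithinAt ℝ (Icc (0 : ℝ) 1) t :=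
  uniqueDiffOn_Icc zero_lt_one t ht

theorem DiffUpTo.hasDerivWithinAt {K : ℕ} {w : ℝ → ℝ} (h : DiffUpTo K w) {k : ℕ} (hk : k < K)
    {t : ℝ} (ht : t ∈ Icc (0 : ℝ) 1) :
    HasDerivWithinAt (D k w) (D (k + 1) w t) (Icc 0 1) t := by
  rw [D_succ]
  exact (h k hk t ht).hasDerivWithinAt

theorem DiffUpTo.continuousOn {K : ℕ} {w : ℝ → ℝ} (h : DiffUpTo K w) {k : ℕ} (hk : k < K) :
    ContinuousOn (D k w) (Icc 0 1) :=
  (h k hk).continuousOn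

theorem DiffUpTo.mono {K K' : ℕ} {w : ℝ → ℝ} (h : DiffUpTo K w) (hK : K' ≤ K) : DiffUpTo K' w :=
  fun k hk => h k (hk.trans_le hK)

/-- A tower of derivatives on `[0,1]` consists of the iterated derivatives. -/
theorem D_eq_of_hasDerivWithinAt {K : ℕ} {w : ℝ → ℝ} (d : ℕ → ℝ → ℝ)
    (h0 : ∀ t ∈ Icc (0 : ℝ) 1, w t = d 0 t)
    (h : ∀ k < K, ∀ t ∈ Icc (0 : ℝ) 1, HasDerivWithinAt (d k) (d (k + 1) t) (Icc 0 1) t) :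
    ∀ k ≤ K, ∀ t ∈ Icc (0 : ℝ) 1, D k w t = d k t := by
  intro k
  induction k with
  | zero => intro _ t ht; rw [D_zero]; exact h0 t ht
  | succ k ih =>
    intro hk t ht
    rw [D_succ]
    have e : ∀ t ∈ Icc (0 : ℝ) 1, D k w t = d k t := ih (by omega)
    exact ((h k hk t ht).congr e (e t ht)).derivWithin (uniqueDiffWithinAt_Icc_zero_one ht)

/-- Closure properties of `DiffUpTo` are proved by exhibiting a candidate tower `d`. The top
derivative need not be continuous, which rules out `ContDiffOn`. -/
theorem diffUpTo_of_hasDerivWithinAt {K : ℕ} {w : ℝ → ℝ} (d : ℕ → ℝ → ℝ)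
    (h0 : ∀ t ∈ Icc (0 : ℝ) 1, w t = d 0 t)
    (h : ∀ k < K, ∀ t ∈ Icc (0 : ℝ) 1, HasDerivWithinAt (d k) (d (k + 1) t) (Icc 0 1) t) :
    DiffUpTo K w := fun k hk t ht =>
  have e := D_eq_of_hasDerivWithinAt d h0 h k hk.le
  ((h k hk t ht).congr e (e t ht)).differentiableWithinAt

theorem DiffUpTo.add {K : ℕ} {v w : ℝ → ℝ} (hv : DiffUpTo K v) (hw : DiffUpTo K w) :
    DiffUpTo K (v + w) :=
  diffUpTo_of_hasDerivWithinAt (fun k => D k v + D k w)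
    (fun t _ => by simp)
    (fun _ hk _ ht => (hv.hasDerivWithinAt hk ht).add (hw.hasDerivWithinAt hk ht))

theorem D_add {K : ℕ} {v w : ℝ → ℝ} (hv : DiffUpTo K v) (hw : DiffUpTo K w) {k : ℕ} (hk : k ≤ K)
    {t : ℝ} (ht : t ∈ Icc (0 : ℝ) 1) : D k (v + w) t = D k v t + D k w t :=
  D_eq_of_hasDerivWithinAt (w := v + w) (fun k => D k v + D k w)
    (fun t _ => by simp)
    (fun _ hk _ ht => (hv.hasDerivWithinAt hk ht).add (hw.hasDerivWithinAt hk ht)) k hk t ht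

theorem DiffUpTo.congr {K : ℕ} {v w : ℝ → ℝ} (hv : DiffUpTo K v)
    (h : ∀ t ∈ Icc (0 : ℝ) 1, w t = v t) : DiffUpTo K w :=
  diffUpTo_of_hasDerivWithinAt (fun k => D k v) (fun t ht => by simp [h t ht])
    (fun _ hk _ ht => hv.hasDerivWithinAt hk ht)

theorem D_congr {v w : ℝ → ℝ} (h : ∀ t ∈ Icc (0 : ℝ) 1, w t = v t) (k : ℕ)
    {t : ℝ} (ht : t ∈ Icc (0 : ℝ) 1) : D k w t = D k v t :=
  iteratedDerivWithin_congr (fun t ht => h t ht) ht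

theorem DiffUpTo.scaledSecond {K : ℕ} {w : ℝ → ℝ} (hw : DiffUpTo (K + 2) w) (ε : ℝ) :
    DiffUpTo K (scaledSecond ε w) :=
  diffUpTo_of_hasDerivWithinAt (fun k t => ε ^ (3 / 2 : ℝ) * D (k + 2) w t) (fun _ _ => rfl)
    (fun k hk _ ht => by
      have := (hw.hasDerivWithinAt (k := k + 2) (by omega) ht).const_mul (ε ^ (3 / 2 : ℝ))
      rwa [show k + 2 + 1 = k + 1 + 2 by ring] at this)

theorem D_scaledSecond {K : ℕ} {w : ℝ → ℝ} (hw : DiffUpTo (K + 2) w) (ε : ℝ) {k : ℕ} (hk : k ≤ K)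
    {t : ℝ} (ht : t ∈ Icc (0 : ℝ) 1) :
    D k (ThinShell.scaledSecond ε w) t = ε ^ (3 / 2 : ℝ) * D (k + 2) w t :=
  D_eq_of_hasDerivWithinAt (fun k t => ε ^ (3 / 2 : ℝ) * D (k + 2) w t) (fun _ _ => rfl)
    (fun k hk _ ht => by
      have := (hw.hasDerivWithinAt (k := k + 2) (by omega) ht).const_mul (ε ^ (3 / 2 : ℝ))
      rwa [show k + 2 + 1 = k + 1 + 2 by ring] at this) k hk t ht

/-- A function that is a polynomial on an open subinterval of `[0,1]` has the derivatives of
that polynomial there. -/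
theorem D_eq_eval_derivative {a b : ℝ} (hab : Ioo a b ⊆ Icc 0 1) {s : ℝ → ℝ} {P : ℝ[X]}
    (h : ∀ t ∈ Ioo a b, s t = P.eval t) (k : ℕ) :
    ∀ t ∈ Ioo a b, D k s t = (derivative^[k] P).eval t := by
  induction k with
  | zero => intro t ht; rw [D_zero]; exact h t ht
  | succ k ih =>
    intro t ht
    have hn : Ioo a b ∈ nhds t := isOpen_Ioo.mem_nhds ht
    rw [D_succ, derivWithin_of_mem_nhds (Filter.mem_of_superset hn hab),
      Filter.EventuallyEq.deriv_eq (Filter.eventuallyEq_of_mem hn ih), Polynomial.deriv,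
      Function.iterate_succ_apply']

/-! ### Meshes -/

/-- A mesh of the unit interval with `N` cells. -/
structure IsMesh (x : ℕ → ℝ) (N : ℕ) : Prop where
  first : x 0 = 0
  last : x N = 1
  lt : ∀ i < N, x i < x (i + 1)

namespace IsMesh

variable {x : ℕ → ℝ} {N : ℕ}

theorem mono (hx : IsMesh x N) {i j : ℕ} (hij : i ≤ j) (hj : j ≤ N) : x i ≤ x j := by
  induction j, hij using Nat.le_induction with
  | base => exact le_rfl
  | succ j hij ih => exact (ih (by omega)).trans (hx.lt j hj).le

theorem nonneg (hx : IsMesh x N) {i : ℕ} (hi : i ≤ N) : 0 ≤ x i :=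
  hx.first ▸ hx.mono (Nat.zero_le i) hi

theorem le_one (hx : IsMesh x N) {i : ℕ} (hi : i ≤ N) : x i ≤ 1 :=
  hx.last ▸ hx.mono hi le_rfl

theorem cell_subset (hx : IsMesh x N) {i : ℕ} (hi : i < N) :
    Icc (x i) (x (i + 1)) ⊆ Icc 0 1 :=
  Icc_subset_Icc (hx.nonneg hi.le) (hx.le_one hi)

theorem openCell_subset (hx : IsMesh x N) {i : ℕ} (hi : i < N) :
    Ioo (x i) (x (i + 1)) ⊆ Icc 0 1 :=
  Ioo_subset_Icc_self.trans (hx.cell_subset hi)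

theorem cell_subset_closure (hx : IsMesh x N) {i : ℕ} (hi : i < N) :
    Icc (x i) (x (i + 1)) ⊆ closure (Ioo (x i) (x (i + 1))) := by
  rw [closure_Ioo (hx.lt i hi).ne]

theorem exists_cell (hx : IsMesh x N) {t : ℝ} (ht : t ∈ Ico (0 : ℝ) 1) :
    ∃ i < N, t ∈ Ico (x i) (x (i + 1)) := by
  have h1 : ∃ k, t < x k := ⟨N, hx.last ▸ ht.2⟩
  classical
  have hs := Nat.find_spec h1
  have hle : Nat.find h1 ≤ N := Nat.find_min' h1 (hx.last ▸ ht.2)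
  rcases Nat.exists_eq_succ_of_ne_zero (n := Nat.find h1) (by
    intro h0
    rw [h0, hx.first] at hs
    exact absurd ht.1 (not_le.2 hs)) with ⟨j, hj⟩
  refine ⟨j, by omega, ?_, by rw [hj] at hs; exact hs⟩
  exact not_lt.1 (Nat.find_min h1 (m := j) (by omega))

/-- Integrals over the unit interval are sums of integrals over the cells. -/
theorem integral_eq_sum (hx : IsMesh x N) {g : ℝ → ℝ} {G : ℕ → ℝ → ℝ}
    (hG : ∀ i < N, ContinuousOn (G i) (Icc (x i) (x (i + 1))))
    (h : ∀ i < N, ∀ t ∈ Ioo (x i) (x (i + 1)), g t = G i t) :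
    IntervalIntegrable g volume 0 1 ∧
      ∫ t in (0 : ℝ)..1, g t = ∑ i ∈ Finset.range N, ∫ t in x i..x (i + 1), G i t := by
  have hI : ∀ i < N, IntervalIntegrable g volume (x i) (x (i + 1)) := fun i hi => by
    have h1 : IntervalIntegrable (G i) volume (x i) (x (i + 1)) :=
      ContinuousOn.intervalIntegrable (by rw [uIcc_of_le (hx.lt i hi).le]; exact hG i hi)
    refine h1.congr_uIoo fun t ht => ?_
    rw [uIoo_of_le (hx.lt i hi).le] at ht
    exact (h i hi t ht).symm
  constructor
  · have := IntervalIntegrable.trans_iterate hI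
    rwa [hx.first, hx.last] at this
  · have := intervalIntegral.sum_integral_adjacent_intervals hI
    rw [hx.first, hx.last] at this
    rw [← this]
    refine Finset.sum_congr rfl fun i hi => intervalIntegral.integral_congr_uIoo fun t ht => ?_
    have hi := Finset.mem_range.1 hi
    rw [uIoo_of_le (hx.lt i hi).le] at ht
    exact h i hi t ht

end IsMesh

/-! ### Splines -/

/-- `s` and its first two derivatives are given by the polynomials `P i` on the cells. -/
structure IsPiecewise (x : ℕ → ℝ) (N : ℕ) (s : ℝ → ℝ) (P : ℕ → ℝ[X]) : Prop where
  value : ∀ i < N, ∀ t ∈ Icc (x i) (x (i + 1)), s t = (P i).eval t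
  slope : ∀ i < N, ∀ t ∈ Icc (x i) (x (i + 1)), D 1 s t = (P i).derivative.eval t
  second : ∀ i < N, ∀ t ∈ Ioo (x i) (x (i + 1)), D 2 s t = (P i).derivative.derivative.eval t

/-- Value and slope extend from an open cell to its closure by continuity. The second derivative may
jump at the nodes, so it is identified on open cells only, which suffices for integrals. -/
theorem IsSpline.isPiecewise {p N : ℕ} {x : ℕ → ℝ} (hx : IsMesh x N) {s : ℝ → ℝ}
    (hs : IsSpline p 1 x N s) {P : ℕ → ℝ[X]}
    (hP : ∀ i < N, ∀ t ∈ Ioo (x i) (x (i + 1)), s t = (P i).eval t) : IsPiecewise x N s P := by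
  refine ⟨fun i hi => ?_, fun i hi => ?_, fun i hi t ht => ?_⟩
  · exact EqOn.of_subset_closure (f := s) (g := fun t => (P i).eval t) (fun t ht => hP i hi t ht)
      (hs.contDiff.continuousOn.mono (hx.cell_subset hi)) (P i).continuous.continuousOn
      Ioo_subset_Icc_self (hx.cell_subset_closure hi)
  · have hc : ContinuousOn (D 1 s) (Icc 0 1) :=
      hs.contDiff.continuousOn_iteratedDerivWithin le_rfl (uniqueDiffOn_Icc zero_lt_one)
    exact EqOn.of_subset_closure (f := D 1 s) (g := fun t => (P i).derivative.eval t)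
      (fun t ht => D_eq_eval_derivative (hx.openCell_subset hi) (hP i hi) 1 t ht)
      (hc.mono (hx.cell_subset hi)) (P i).derivative.continuous.continuousOn
      Ioo_subset_Icc_self (hx.cell_subset_closure hi)
  · exact D_eq_eval_derivative (hx.openCell_subset hi) (hP i hi) 2 t ht

theorem IsSpline.exists_isPiecewise {p N : ℕ} {x : ℕ → ℝ} (hx : IsMesh x N) {s : ℝ → ℝ}
    (hs : IsSpline p 1 x N s) :
    ∃ P : ℕ → ℝ[X], (∀ i, (P i).natDegree ≤ p) ∧ IsPiecewise x N s P := by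
  have hpw : ∀ i, ∃ P : ℝ[X], P.natDegree ≤ p ∧
      (i < N → ∀ t ∈ Ioo (x i) (x (i + 1)), s t = P.eval t) := fun i => by
    by_cases hi : i < N
    · obtain ⟨P, h1, h2⟩ := hs.piecewise i hi
      exact ⟨P, h1, fun _ => h2⟩
    · exact ⟨0, by simp, fun h => absurd h hi⟩
  choose P hdeg hP using hpw
  exact ⟨P, hdeg, hs.isPiecewise hx hP⟩

theorem IsSpline.memH2 {p N : ℕ} {x : ℕ → ℝ} (hx : IsMesh x N) {s : ℝ → ℝ}
    (hs : IsSpline p 1 x N s) : MemH2 s := by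
  obtain ⟨P, -, hP⟩ := hs.exists_isPiecewise hx
  have hc : ContinuousOn (D 1 s) (Icc 0 1) :=
    hs.contDiff.continuousOn_iteratedDerivWithin le_rfl (uniqueDiffOn_Icc zero_lt_one)
  have hI := (hx.integral_eq_sum (g := D 2 s)
    (fun i _ => (P i).derivative.derivative.continuous.continuousOn) hP.second).1
  refine ⟨hs.contDiff.differentiableOn (by simp), ?_, ?_⟩
  · have h1 : AbsolutelyContinuousOnInterval (fun t => ∫ v in (0 : ℝ)..t, D 2 s v) 0 1 :=
      hI.absolutelyContinuousOnInterval_intervalIntegral left_mem_uIcc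
    have h2 : ∀ t ∈ Icc (0 : ℝ) 1, ∫ v in (0 : ℝ)..t, D 2 s v = D 1 s t - D 1 s 0 := by
      intro t ht
      refine integral_eq_of_hasDerivAt_off_countable_of_le (D 1 s) (D 2 s) ht.1
        ((finite_Iic N).image x).countable
        (hc.mono (Icc_subset_Icc_right ht.2)) (fun v hv => ?_)
        (hI.mono_set (by rw [uIcc_of_le ht.1, uIcc_of_le zero_le_one]
                         exact Icc_subset_Icc_right ht.2))
      obtain ⟨i, hi, hv1, hv2⟩ := hx.exists_cell ⟨hv.1.1.le, hv.1.2.trans_le ht.2⟩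
      have hv' : v ∈ Ioo (x i) (x (i + 1)) :=
        ⟨lt_of_le_of_ne hv1 fun h => hv.2 ⟨i, hi.le, h⟩, hv2⟩
      rw [hP.second i hi v hv']
      exact ((P i).derivative.hasDerivAt v).congr_of_eventuallyEq
        (Filter.eventuallyEq_of_mem (isOpen_Ioo.mem_nhds hv')
          fun t ht => hP.slope i hi t (Ioo_subset_Icc_self ht))
    rw [absolutelyContinuousOnInterval_iff] at h1 ⊢
    intro ε hε
    obtain ⟨δ, hδ, h⟩ := h1 ε hε
    refine ⟨δ, hδ, fun E hE hEd => ?_⟩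
    convert h E hE hEd using 1
    refine Finset.sum_congr rfl fun i hi => ?_
    have hm := hE.1 i hi
    rw [uIcc_of_le zero_le_one] at hm
    rw [h2 _ hm.1, h2 _ hm.2, dist_sub_right]
  · have h1 : AEStronglyMeasurable (D 2 s) (volume.restrict (Ioo 0 1)) :=
      ((intervalIntegrable_iff_integrableOn_Ioo_of_le zero_le_one).1 hI).aestronglyMeasurable
    refine (memLp_two_iff_integrable_sq h1).2 ?_
    refine (intervalIntegrable_iff_integrableOn_Ioo_of_le zero_le_one).1
      (hx.integral_eq_sum (g := fun t => D 2 s t ^ 2)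
        (G := fun i t => (P i).derivative.derivative.eval t ^ 2)
        (fun i _ => ((P i).derivative.derivative.continuous.pow 2).continuousOn)
        (fun i hi t ht => by rw [hP.second i hi t ht])).1

/-- Polynomials on the cells which agree together with their slopes at the nodes form a spline. -/
theorem isSpline_of_glue {p N : ℕ} {x : ℕ → ℝ} (hx : IsMesh x N) {s : ℝ → ℝ} {P : ℕ → ℝ[X]}
    (hdeg : ∀ i < N, (P i).natDegree ≤ p)
    (hs : ∀ i < N, ∀ t ∈ Icc (x i) (x (i + 1)), s t = (P i).eval t)
    (hd : ∀ i, i + 1 < N →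
      (P i).derivative.eval (x (i + 1)) = (P (i + 1)).derivative.eval (x (i + 1))) :
    IsSpline p 1 x N s := by
  have compat : ∀ i j, i < j → j < N → ∀ t ∈ Icc (x i) (x (i + 1)), t ∈ Icc (x j) (x (j + 1)) →
      (P i).derivative.eval t = (P j).derivative.eval t := by
    intro i j hij hj t h1 h2
    -- Cells that are not neighbours are disjoint.
    have h3 : j = i + 1 := by
      by_contra hne
      have := hx.mono (show i + 1 ≤ j - 1 by omega) (by omega)
      have h4 := hx.lt (j - 1) (by omega)
      rw [show j - 1 + 1 = j by omega] at h4
      linarith [h1.2, h2.1]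
    subst h3
    have : t = x (i + 1) := le_antisymm h1.2 h2.1
    rw [this]; exact hd i hj
  have compat' : ∀ i < N, ∀ j < N, ∀ t ∈ Icc (x i) (x (i + 1)), t ∈ Icc (x j) (x (j + 1)) →
      (P i).derivative.eval t = (P j).derivative.eval t := by
    intro i hi j hj t h1 h2
    rcases lt_trichotomy i j with h | h | h
    · exact compat i j h hj t h1 h2
    · rw [h]
    · exact (compat j i h hi t h2 h1).symm
  have hder : ∀ i < N, ∀ t ∈ Icc (x i) (x (i + 1)),
      HasDerivWithinAt s ((P i).derivative.eval t) (Icc 0 1) t := by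
    intro i hi t ht
    -- The interval grows cell by cell. Within a singleton, and within a cell that does not contain
    -- `t`, every number is a derivative at `t`; so only cells containing `t` impose a condition,
    -- and there `compat'` gives the same slope.
    have key : ∀ k ≤ N, HasDerivWithinAt s ((P i).derivative.eval t) (Icc (x 0) (x k)) t := by
      intro k
      induction k with
      | zero =>
        intro _
        rw [Icc_self]
        exact HasFDerivWithinAt.of_finite (finite_singleton _)
      | succ k ih =>
        intro hk
        rw [← Icc_union_Icc_eq_Icc (hx.mono (Nat.zero_le k) (by omega)) (hx.lt k hk).le]
        refine (ih (by omega)).union ?_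
        by_cases htk : t ∈ Icc (x k) (x (k + 1))
        · rw [compat' i hi k hk t ht htk]
          exact ((P k).hasDerivAt t).hasDerivWithinAt.congr (hs k hk) (hs k hk t htk)
        · exact HasFDerivWithinAt.of_notMem_closure (by rwa [isClosed_Icc.closure_eq])
    have := key N le_rfl
    rwa [hx.first, hx.last] at this
  have hcov : ∀ t ∈ Icc (0 : ℝ) 1, ∃ i < N, t ∈ Icc (x i) (x (i + 1)) := by
    intro t ht
    rcases ht.2.lt_or_eq with h | h
    · obtain ⟨i, hi, h'⟩ := hx.exists_cell ⟨ht.1, h⟩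
      exact ⟨i, hi, Ico_subset_Icc_self h'⟩
    · have hN : N ≠ 0 := by
        rintro rfl
        have := hx.first.symm.trans hx.last
        norm_num at this
      refine ⟨N - 1, by omega, ?_⟩
      rw [show N - 1 + 1 = N by omega, hx.last, h]
      exact ⟨hx.le_one (by omega), le_rfl⟩
  have hdw : ∀ i < N, ∀ t ∈ Icc (x i) (x (i + 1)),
      derivWithin s (Icc 0 1) t = (P i).derivative.eval t := fun i hi t ht =>
    (hder i hi t ht).derivWithin (uniqueDiffWithinAt_Icc_zero_one (hx.cell_subset hi ht))
  have hcont : ContinuousOn (derivWithin s (Icc 0 1)) (Icc 0 1) := by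
    have key : ∀ k ≤ N, ContinuousOn (derivWithin s (Icc 0 1)) (Icc (x 0) (x k)) := by
      intro k
      induction k with
      | zero => intro _; rw [Icc_self]; exact continuousOn_singleton _ _
      | succ k ih =>
        intro hk
        rw [← Icc_union_Icc_eq_Icc (hx.mono (Nat.zero_le k) (by omega)) (hx.lt k hk).le]
        exact (ih (by omega)).union_of_isClosed
          ((P k).derivative.continuous.continuousOn.congr (hdw k hk)) isClosed_Icc isClosed_Icc
    have := key N le_rfl
    rwa [hx.first, hx.last] at this
  refine ⟨?_, fun i hi => ⟨P i, hdeg i hi, fun t ht => hs i hi t (Ioo_subset_Icc_self ht)⟩⟩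
  have := (contDiffOn_succ_iff_derivWithin (n := 0) (f := s)
    (uniqueDiffOn_Icc (zero_lt_one (α := ℝ)))).2 ⟨fun t ht => ?_, by simp, ?_⟩
  · simpa using this
  · obtain ⟨i, hi, h⟩ := hcov t ht
    exact (hder i hi t h).differentiableWithinAt
  · exact contDiffOn_zero.2 hcont

theorem IsSpline.sub {p k N : ℕ} {x : ℕ → ℝ} {s t : ℝ → ℝ} (hs : IsSpline p k x N s)
    (ht : IsSpline p k x N t) : IsSpline p k x N (s - t) := by
  refine ⟨hs.contDiff.sub ht.contDiff, fun i hi => ?_⟩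
  obtain ⟨P, hP, h1⟩ := hs.piecewise i hi
  obtain ⟨Q, hQ, h2⟩ := ht.piecewise i hi
  exact ⟨P - Q, (natDegree_sub_le _ _).trans (max_le hP hQ), fun v hv => by
    simp [h1 v hv, h2 v hv]⟩

/-! ### Local interpolation -/

theorem DiffUpTo.hasDerivWithinAt_of_subset {K : ℕ} {w : ℝ → ℝ} (h : DiffUpTo K w) {k : ℕ}
    (hk : k < K) {a b : ℝ} (hab : Icc a b ⊆ Icc 0 1) {t : ℝ} (ht : t ∈ Icc a b) :
    HasDerivWithinAt (D k w) (D (k + 1) w t) (Icc a b) t :=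
  (h.hasDerivWithinAt hk (hab ht)).mono hab

/-- Polynomial approximation by Taylor expansion of the derivatives of a function. -/
theorem DiffUpTo.exists_polynomial_near {K : ℕ} {w : ℝ → ℝ} (hw : DiffUpTo K w) {a b S : ℝ}
    (hab : a ≤ b) (hsub : Icc a b ⊆ Icc 0 1) (n : ℕ) :
    ∀ j, j + n + 1 ≤ K → (∀ t ∈ Icc a b, |D (j + n + 1) w t| ≤ S) →
      ∃ T : ℝ[X], T.natDegree ≤ n ∧ ∀ t ∈ Icc a b, |D j w t - T.eval t| ≤ S * (b - a) ^ (n + 1) := by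
  have hle : ∀ {C t : ℝ}, 0 ≤ C → t ∈ Icc a b → C * ‖t - a‖ ≤ C * (b - a) := fun hC ht => by
    rw [Real.norm_eq_abs, abs_of_nonneg (by linarith [ht.1])]
    exact mul_le_mul_of_nonneg_left (by linarith [ht.2]) hC
  have ha : a ∈ Icc a b := left_mem_Icc.2 hab
  -- The order `j` stays general. The derivative of order `j + 1` is approximated by `T`, an
  -- antiderivative of `T` is matched to `D j w` at `a`, and the mean value inequality supplies one
  -- more factor `b - a`. The highest derivative only has to be bounded, not integrable.
  induction n with
  | zero =>
    intro j hj hS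
    refine ⟨C (D j w a), by simp, fun t ht => ?_⟩
    have := (convex_Icc a b).norm_image_sub_le_of_norm_hasDerivWithin_le
      (fun t ht => hw.hasDerivWithinAt_of_subset (k := j) (by omega) hsub ht) hS ha ht
    simpa using this.trans (hle ((abs_nonneg _).trans (hS a ha)) ht)
  | succ n ih =>
    intro j hj hS
    obtain ⟨T, hT, hb⟩ := ih (j + 1) (by omega) (by
      intro t ht
      rw [show j + 1 + n + 1 = j + (n + 1) + 1 by ring]
      exact hS t ht)
    obtain ⟨R, rfl⟩ := exists_antideriv T
    refine ⟨R + C (D j w a - R.eval a), ?_, fun t ht => ?_⟩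
    · rw [natDegree_add_C]
      have := natDegree_derivative R
      omega
    · have := (convex_Icc a b).norm_image_sub_le_of_norm_hasDerivWithin_le
        (f := fun t => D j w t - R.eval t)
        (fun t ht => (hw.hasDerivWithinAt_of_subset (k := j) (by omega) hsub ht).sub
          (R.hasDerivAt t).hasDerivWithinAt) hb ha ht
      have h2 := this.trans (hle ((abs_nonneg _).trans (hb a ha)) ht)
      rw [Real.norm_eq_abs] at h2
      rw [pow_succ, ← mul_assoc]
      refine le_of_eq_of_le ?_ h2
      congr 1
      simp
      ring

/-- Twofold integration by parts against a polynomial. -/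
theorem integral_second_mul_eval {a b : ℝ} (hab : a ≤ b) {g g₁ g₂ : ℝ → ℝ}
    (h₁ : ∀ t ∈ Icc a b, HasDerivWithinAt g (g₁ t) (Icc a b) t)
    (h₂ : ∀ t ∈ Icc a b, HasDerivWithinAt g₁ (g₂ t) (Icc a b) t)
    (hc : ContinuousOn g₂ (Icc a b)) (F : ℝ[X]) :
    ∫ t in a..b, g₂ t * F.eval t =
      (g₁ b * F.eval b - g b * F.derivative.eval b) - (g₁ a * F.eval a - g a * F.derivative.eval a)
        + ∫ t in a..b, g t * F.derivative.derivative.eval t := by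
  have cg : ContinuousOn g (Icc a b) := fun t ht => (h₁ t ht).continuousWithinAt
  have cg₁ : ContinuousOn g₁ (Icc a b) := fun t ht => (h₂ t ht).continuousWithinAt
  have i₁ : IntervalIntegrable (fun t => g₂ t * F.eval t) volume a b :=
    ContinuousOn.intervalIntegrable (by
      rw [uIcc_of_le hab]; exact hc.mul F.continuous.continuousOn)
  have i₂ : IntervalIntegrable (fun t => g t * F.derivative.derivative.eval t) volume a b :=
    ContinuousOn.intervalIntegrable (by
      rw [uIcc_of_le hab]; exact cg.mul F.derivative.derivative.continuous.continuousOn)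
  have := intervalIntegral.integral_eq_sub_of_hasDerivAt_of_le hab
    (f := fun t => g₁ t * F.eval t - g t * F.derivative.eval t)
    (f' := fun t => g₂ t * F.eval t - g t * F.derivative.derivative.eval t)
    ((cg₁.mul F.continuous.continuousOn).sub (cg.mul F.derivative.continuous.continuousOn))
    (fun t ht => by
      have hn : Icc a b ∈ nhds t := Icc_mem_nhds ht.1 ht.2
      have d₁ := (h₁ t (Ioo_subset_Icc_self ht)).hasDerivAt hn
      have d₂ := (h₂ t (Ioo_subset_Icc_self ht)).hasDerivAt hn
      convert! (d₂.mul (F.hasDerivAt t)).sub (d₁.mul (F.derivative.hasDerivAt t)) using 1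
      ring) (i₁.sub i₂)
  rw [intervalIntegral.integral_sub i₁ i₂] at this
  linarith

section Interpolation

variable {p : ℕ} {a b : ℝ} {w : ℝ → ℝ} {P : ℝ[X]}

theorem interp_hasDeriv (hw : DiffUpTo 3 w) (hsub : Icc a b ⊆ Icc 0 1) (P : ℝ[X]) :
    (∀ t ∈ Icc a b, HasDerivWithinAt (fun t => P.eval t - w t)
      (P.derivative.eval t - D 1 w t) (Icc a b) t) ∧
    (∀ t ∈ Icc a b, HasDerivWithinAt (fun t => P.derivative.eval t - D 1 w t)
      (P.derivative.derivative.eval t - D 2 w t) (Icc a b) t) ∧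
    ContinuousOn (fun t => P.derivative.derivative.eval t - D 2 w t) (Icc a b) := by
  refine ⟨fun t ht => ?_, fun t ht => ?_, ?_⟩
  · have := hw.hasDerivWithinAt_of_subset (k := 0) (by omega) hsub ht
    rw [D_zero] at this
    exact (P.hasDerivAt t).hasDerivWithinAt.sub this
  · exact (P.derivative.hasDerivAt t).hasDerivWithinAt.sub
      (hw.hasDerivWithinAt_of_subset (k := 1) (by omega) hsub ht)
  · exact P.derivative.derivative.continuous.continuousOn.sub
      ((hw.continuousOn (k := 2) (by omega)).mono hsub)

theorem DiffUpTo.isLocalInterp (hw : DiffUpTo 3 w) (hp : 2 ≤ p) (hab : a < b)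
    (hsub : Icc a b ⊆ Icc 0 1) : IsLocalInterp p a b w (localInterp p a b w) :=
  isLocalInterp_localInterp hp hab w (ContinuousOn.intervalIntegrable (by
    rw [uIcc_of_le hab.le]
    exact (hw.continuousOn (k := 2) (by omega)).mono hsub))

/-- Twofold integration by parts against `1` and `X`, both admissible for `p ≥ 3`, leaves only
boundary terms at `b`. They force first the slope error and then the error to vanish there, so
neighbouring interpolants join with matching values and slopes. -/
theorem IsLocalInterp.right (hP : IsLocalInterp p a b w P) (hp : 3 ≤ p) (hw : DiffUpTo 3 w)
    (hab : a < b) (hsub : Icc a b ⊆ Icc 0 1) :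
    P.eval b = w b ∧ P.derivative.eval b = D 1 w b := by
  obtain ⟨h₁, h₂, hc⟩ := interp_hasDeriv hw hsub P
  have e1 := integral_second_mul_eval hab.le h₁ h₂ hc 1
  have e2 := integral_second_mul_eval hab.le h₁ h₂ hc X
  rw [hP.orth 1 (by simp; omega)] at e1
  rw [hP.orth X (by simp; omega)] at e2
  simp [hP.value, hP.slope, -iteratedDerivWithin_one] at e1 e2
  rw [← e1] at e2
  constructor <;> linarith

/-- No boundary terms remain, since error and slope error vanish at both ends. Together with `orth`
this removes every second derivative of an interpolation error from the residual. -/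
theorem IsLocalInterp.integral_second_mul (hP : IsLocalInterp p a b w P) (hp : 3 ≤ p)
    (hw : DiffUpTo 3 w) (hab : a < b) (hsub : Icc a b ⊆ Icc 0 1) (F : ℝ[X]) :
    ∫ t in a..b, (P.derivative.derivative.eval t - D 2 w t) * F.eval t =
      ∫ t in a..b, (P.eval t - w t) * F.derivative.derivative.eval t := by
  obtain ⟨h₁, h₂, hc⟩ := interp_hasDeriv hw hsub P
  obtain ⟨r1, r2⟩ := hP.right hp hw hab hsub
  rw [integral_second_mul_eval hab.le h₁ h₂ hc F]
  simp [hP.value, hP.slope, r1, r2]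

/-- The `L_2` best approximation property of the second derivative of the interpolant. -/
theorem IsLocalInterp.integral_sq_le (hP : IsLocalInterp p a b w P)
    (hw : DiffUpTo 3 w) (hab : a < b) (hsub : Icc a b ⊆ Icc 0 1) {T : ℝ[X]}
    (hT : T.natDegree + 2 ≤ p) :
    ∫ t in a..b, (P.derivative.derivative.eval t - D 2 w t) ^ 2 ≤
      ∫ t in a..b, (T.eval t - D 2 w t) ^ 2 := by
  have hp : 2 ≤ p := by omega
  obtain ⟨-, -, hc⟩ := interp_hasDeriv hw hsub P
  have hcw : ContinuousOn (D 2 w) (Icc a b) := (hw.continuousOn (k := 2) (by omega)).mono hsub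
  set Q := P.derivative.derivative with hQ
  have hQd : Q.natDegree + 2 ≤ p := by
    have h1 := natDegree_derivative_le P
    have h2 : Q.natDegree ≤ _ := natDegree_derivative_le P.derivative
    have := hP.degree
    omega
  have horth : ∫ t in a..b, (Q.eval t - D 2 w t) * (Q - T).eval t = 0 :=
    hP.orth _ (by have := natDegree_sub_le Q T; omega)
  have cI : ∀ g : ℝ → ℝ, ContinuousOn g (Icc a b) → IntervalIntegrable g volume a b :=
    fun g hg => ContinuousOn.intervalIntegrable (by rwa [uIcc_of_le hab.le])
  have hT2 : ContinuousOn (fun t => (T.eval t - D 2 w t) ^ 2) (Icc a b) :=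
    (T.continuous.continuousOn.sub hcw).pow 2
  have hQT : ContinuousOn (fun t => (Q.eval t - D 2 w t) * (Q - T).eval t) (Icc a b) :=
    hc.mul (Q - T).continuous.continuousOn
  -- The right integrand exceeds the left one by `(Q - T) ^ 2`, and its added product integrates to
  -- zero by `horth`.
  have h : ∫ t in a..b, (Q.eval t - D 2 w t) ^ 2 ≤
      ∫ t in a..b, ((T.eval t - D 2 w t) ^ 2 + 2 * ((Q.eval t - D 2 w t) * (Q - T).eval t)) := by
    refine intervalIntegral.integral_mono_on hab.le (cI _ (hc.pow 2))
      (cI _ (hT2.add (hQT.const_mul 2))) fun t _ => ?_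
    simp only [eval_sub]
    nlinarith [sq_nonneg (Q.eval t - T.eval t)]
  rwa [intervalIntegral.integral_add (cI _ hT2) (cI _ (hQT.const_mul 2)),
    intervalIntegral.integral_const_mul, horth, mul_zero, add_zero] at h

/-- The interpolation error. -/
theorem IsLocalInterp.abs_sub_le (hP : IsLocalInterp p a b w P) (hp : 3 ≤ p)
    (hw : DiffUpTo (p + 1) w) (hab : a < b) (hsub : Icc a b ⊆ Icc 0 1) {S : ℝ} (hS : 0 < S)
    (hb : ∀ t ∈ Icc a b, |D (p + 1) w t| ≤ S) :
    ∀ t ∈ Icc a b, |P.eval t - w t| ≤ S * (b - a) ^ (p + 1) := by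
  have hw3 : DiffUpTo 3 w := hw.mono (by omega)
  obtain ⟨h₁, h₂, hc⟩ := interp_hasDeriv hw3 hsub P
  have hcw : ContinuousOn (D 2 w) (Icc a b) := (hw3.continuousOn (k := 2) (by omega)).mono hsub
  obtain ⟨q, rfl⟩ : ∃ q, p = q + 2 := ⟨p - 2, by omega⟩
  -- `D 2 w` is approximated with degree `q = p - 2`, so best approximation bounds the second
  -- derivative of the error in L₂. Slope and value follow by integrating from `a`, where both
  -- errors vanish.
  obtain ⟨T, hTd, hT⟩ := hw.exists_polynomial_near hab.le hsub q 2 (by omega) (by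
    intro t ht; rw [show 2 + q + 1 = q + 2 + 1 by ring]; exact hb t ht)
  have cI : ∀ {c d : ℝ}, c ≤ d → Icc c d ⊆ Icc a b → ∀ g : ℝ → ℝ, ContinuousOn g (Icc a b) →
      IntervalIntegrable g volume c d :=
    fun hcd hs g hg => ContinuousOn.intervalIntegrable (by rw [uIcc_of_le hcd]; exact hg.mono hs)
  set h := b - a with hh
  have hpos : 0 < h := sub_pos.2 hab
  set k := S * h ^ (q + 1) with hk
  have hkpos : 0 < k := by positivity
  have hsq : ∫ t in a..b, (P.derivative.derivative.eval t - D 2 w t) ^ 2 ≤ h * k ^ 2 := by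
    refine (hP.integral_sq_le hw3 hab hsub (T := T) (by omega)).trans ?_
    have : ∫ t in a..b, (T.eval t - D 2 w t) ^ 2 ≤ ∫ _ in a..b, k ^ 2 := by
      refine intervalIntegral.integral_mono_on hab.le
        (cI hab.le le_rfl _ ((T.continuous.continuousOn.sub hcw).pow 2)) (by simp) fun t ht => ?_
      rw [← sq_abs, abs_sub_comm]
      exact pow_le_pow_left₀ (abs_nonneg _) (hT t ht) 2
    simpa [hh] using this
  have hslope : ∀ t ∈ Icc a b, ‖P.derivative.eval t - D 1 w t‖ ≤ k * h := by
    intro t ht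
    have hst : Icc a t ⊆ Icc a b := Icc_subset_Icc_right ht.2
    have hFTC := intervalIntegral.integral_eq_sub_of_hasDerivAt_of_le ht.1
      (f := fun t => P.derivative.eval t - D 1 w t)
      (f' := fun t => P.derivative.derivative.eval t - D 2 w t)
      (fun v hv => (h₂ v (hst hv)).continuousWithinAt.mono hst)
      (fun v hv => (h₂ v (hst (Ioo_subset_Icc_self hv))).hasDerivAt
        (Icc_mem_nhds hv.1 (hv.2.trans_le ht.2))) (cI ht.1 hst _ hc)
    simp only [hP.slope, sub_self, sub_zero] at hFTC
    rw [← hFTC]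
    have hcabs : ContinuousOn (fun t => |P.derivative.derivative.eval t - D 2 w t|) (Icc a b) :=
      hc.abs
    have hcsq : ContinuousOn
        (fun v => (2 * k)⁻¹ * (P.derivative.derivative.eval v - D 2 w v) ^ 2) (Icc a b) :=
      (hc.pow 2).const_mul _
    calc ‖∫ v in a..t, (P.derivative.derivative.eval v - D 2 w v)‖
        ≤ ∫ v in a..t, |P.derivative.derivative.eval v - D 2 w v| :=
          intervalIntegral.norm_integral_le_integral_norm ht.1
      _ ≤ ∫ v in a..b, |P.derivative.derivative.eval v - D 2 w v| :=
          intervalIntegral.integral_mono_interval le_rfl ht.1 ht.2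
            (Filter.Eventually.of_forall fun _ => abs_nonneg _) (cI hab.le le_rfl _ hcabs)
      -- Young's inequality with parameter `k` plays the role of Cauchy–Schwarz; each of its two
      -- halves contributes `k * h / 2`. The division by `k` is why `S` must be positive.
      _ ≤ ∫ v in a..b, ((2 * k)⁻¹ * (P.derivative.derivative.eval v - D 2 w v) ^ 2 + k / 2) := by
          refine intervalIntegral.integral_mono_on hab.le (cI hab.le le_rfl _ hcabs)
            (cI hab.le le_rfl _ (hcsq.add continuousOn_const)) fun v _ => ?_
          rw [← sq_abs (P.derivative.derivative.eval v - D 2 w v)]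
          generalize |P.derivative.derivative.eval v - D 2 w v| = y
          have : (2 * k)⁻¹ * y ^ 2 + k / 2 - y = (2 * k)⁻¹ * (y - k) ^ 2 := by
            field_simp; ring
          have h3 : 0 ≤ (2 * k)⁻¹ * (y - k) ^ 2 := by positivity
          linarith
      _ = (2 * k)⁻¹ * (∫ v in a..b, (P.derivative.derivative.eval v - D 2 w v) ^ 2)
            + h * (k / 2) := by
          rw [intervalIntegral.integral_add
            (cI hab.le le_rfl _ hcsq) (by simp),
            intervalIntegral.integral_const_mul]
          simp [hh, mul_div_assoc]
      _ ≤ (2 * k)⁻¹ * (h * k ^ 2) + h * (k / 2) := by gcongr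
      _ = k * h := by field_simp; ring
  intro t ht
  have := (convex_Icc a b).norm_image_sub_le_of_norm_hasDerivWithin_le h₁ hslope
    (left_mem_Icc.2 hab.le) ht
  simp only [hP.value, sub_self, sub_zero, Real.norm_eq_abs, abs_of_nonneg (sub_nonneg.2 ht.1)]
    at this
  calc _ ≤ k * h * (t - a) := this
    _ ≤ k * h * h := by gcongr; linarith [ht.2]
    _ = _ := by rw [hk]; ring

end Interpolation

/-! ### An inverse inequality -/

/-- In the coefficients both integrals are quadratic forms on a finite-dimensional space, the right
one positive definite. Their quotient is bounded on the compact unit sphere, and homogeneity extends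
the bound. -/
theorem exists_inverse_inequality_unit (p : ℕ) :
    ∃ K : ℝ, 0 < K ∧ ∀ F : ℝ[X], F.natDegree ≤ p →
      ∫ t in (0 : ℝ)..1, F.derivative.derivative.eval t ^ 2 ≤
        K * ∫ t in (0 : ℝ)..1, F.eval t ^ 2 := by
  let L : (Fin (p + 1) → ℝ) → ℝ[X] := fun c => ∑ i, C (c i) * X ^ (i : ℕ)
  have hL : ∀ F : ℝ[X], F.natDegree ≤ p → L (fun i => F.coeff i) = F := fun F hF => by
    simp only [L]
    rw [← Finset.sum_range (fun i => C (F.coeff i) * X ^ i), ← F.as_sum_range_C_mul_X_pow' (by omega)]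
  have hsmul : ∀ (r : ℝ) c, L (r • c) = C r * L c := fun r c => by
    simp [L, Finset.mul_sum, mul_assoc]
  have hcoeff : ∀ c (i : Fin (p + 1)), (L c).coeff i = c i := fun c i => by
    simp [L, coeff_X_pow, Fin.val_inj]
  let g : (Fin (p + 1) → ℝ) → ℝ := fun c => ∫ t in (0 : ℝ)..1, (L c).eval t ^ 2
  let h : (Fin (p + 1) → ℝ) → ℝ := fun c =>
    ∫ t in (0 : ℝ)..1, (L c).derivative.derivative.eval t ^ 2
  have hg : Continuous g := by
    apply intervalIntegral.continuous_parametric_intervalIntegral_of_continuous'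
    simp only [L, Function.uncurry_def, eval_finsetSum, eval_mul, eval_C, eval_pow, eval_X]
    fun_prop
  have hh : Continuous h := by
    apply intervalIntegral.continuous_parametric_intervalIntegral_of_continuous'
    simp only [L, Function.uncurry_def, derivative_sum, derivative_C_mul, derivative_X_pow,
      eval_finsetSum, eval_mul, eval_C, eval_pow, eval_X]
    fun_prop
  have hpos : ∀ c, c ≠ 0 → 0 < g c := fun c hc => by
    refine lt_of_le_of_ne (intervalIntegral.integral_nonneg zero_le_one fun _ _ => sq_nonneg _)
      fun h0 => hc ?_
    have := eq_zero_of_integral_sq zero_lt_one (L c) (by simpa only [g, sq] using h0.symm)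
    funext i
    rw [← hcoeff c i, this]
    simp
  have hsph : ∀ c ∈ Metric.sphere (0 : Fin (p + 1) → ℝ) 1, c ≠ 0 := fun c hc =>
    ne_zero_of_mem_unit_sphere (⟨c, hc⟩ : Metric.sphere (0 : Fin (p + 1) → ℝ) 1)
  obtain ⟨K, hK⟩ := (isCompact_sphere (0 : Fin (p + 1) → ℝ) 1).exists_bound_of_continuousOn
    (f := fun c => h c / g c)
    (hh.continuousOn.div hg.continuousOn fun c hc => (hpos c (hsph c hc)).ne')
  refine ⟨|K| + 1, by positivity, fun F hF => ?_⟩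
  have hgn : ∀ c, 0 ≤ g c := fun c =>
    intervalIntegral.integral_nonneg zero_le_one fun _ _ => sq_nonneg _
  rw [← hL F hF]
  generalize (fun i : Fin (p + 1) => F.coeff i) = c
  change h c ≤ (|K| + 1) * g c
  by_cases hc : c = 0
  · have : h c = 0 := by simp [h, L, hc]
    rw [this]
    exact mul_nonneg (by positivity) (hgn c)
  · have hn : ‖c‖ ≠ 0 := norm_ne_zero_iff.2 hc
    have hmem : ‖c‖⁻¹ • c ∈ Metric.sphere (0 : Fin (p + 1) → ℝ) 1 := by
      simp [norm_smul, hn]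
    have h1 := hK _ hmem
    have h2 := hpos _ (hsph _ hmem)
    rw [Real.norm_eq_abs] at h1
    have h3 := (div_le_iff₀ h2).1 ((le_abs_self _).trans h1)
    have e1 : g (‖c‖⁻¹ • c) = ‖c‖⁻¹ ^ 2 * g c := by
      simp only [g, hsmul, eval_mul, eval_C, mul_pow]
      exact intervalIntegral.integral_const_mul _ _
    have e2 : h (‖c‖⁻¹ • c) = ‖c‖⁻¹ ^ 2 * h c := by
      simp only [h, hsmul, derivative_C_mul, eval_mul, eval_C, mul_pow]
      exact intervalIntegral.integral_const_mul _ _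
    rw [e1, e2] at h3
    have h4 : 0 < ‖c‖⁻¹ ^ 2 := by positivity
    have h5 : h c ≤ K * g c := by
      refine le_of_mul_le_mul_left ?_ h4
      linarith
    nlinarith [hgn c, le_abs_self K]

/-- Affine scaling to the unit interval: two derivatives, squared, give the fourth power of the
length. -/
theorem exists_inverse_inequality (p : ℕ) :
    ∃ K : ℝ, 0 < K ∧ ∀ F : ℝ[X], F.natDegree ≤ p → ∀ a b : ℝ, a < b →
      (b - a) ^ 4 * ∫ t in a..b, F.derivative.derivative.eval t ^ 2 ≤
        K * ∫ t in a..b, F.eval t ^ 2 := by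
  obtain ⟨K, hK, h⟩ := exists_inverse_inequality_unit p
  refine ⟨K, hK, fun F hF a b hab => ?_⟩
  have hpos : 0 < b - a := sub_pos.2 hab
  have hlin : (C a + C (b - a) * X : ℝ[X]).natDegree ≤ 1 := by compute_degree
  have h1 := h (F.comp (C a + C (b - a) * X)) (natDegree_comp_le.trans (by nlinarith))
  have hint : ∀ G : ℝ[X], ∫ t in (0 : ℝ)..1, G.eval (a + (b - a) * t) ^ 2 =
      (b - a)⁻¹ * ∫ t in a..b, G.eval t ^ 2 := fun G => by
    rw [intervalIntegral.integral_comp_add_mul (fun t => G.eval t ^ 2) hpos.ne']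
    simp
  simp only [derivative_comp, derivative_add, derivative_C, derivative_mul, derivative_X, eval_mul,
    eval_comp, eval_add, eval_C, eval_X, zero_mul, zero_add, mul_one,
    mul_pow] at h1
  rw [hint] at h1
  simp only [intervalIntegral.integral_const_mul] at h1
  rw [hint] at h1
  refine le_of_mul_le_mul_left ?_ (inv_pos.2 hpos)
  nlinarith [h1]

/-! ### Energy estimates -/

/-- Half-integer powers of `ε` become natural powers of `r = √ε`, so that the pointwise estimates
are polynomial in `r`. -/
theorem rpow_eq_sqrt_pow {ε : ℝ} (hε : 0 ≤ ε) (n : ℕ) : ε ^ ((n : ℝ) / 2) = Real.sqrt ε ^ n := by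
  rw [Real.sqrt_eq_rpow, ← Real.rpow_natCast, ← Real.rpow_mul hε]
  congr 1; ring

theorem rpow_three_halves {ε : ℝ} (hε : 0 ≤ ε) : ε ^ (3 / 2 : ℝ) = Real.sqrt ε ^ 3 := by
  simpa using rpow_eq_sqrt_pow hε 3

theorem rpow_five_halves {ε : ℝ} (hε : 0 ≤ ε) : ε ^ (5 / 2 : ℝ) = Real.sqrt ε ^ 5 := by
  simpa using rpow_eq_sqrt_pow hε 5

theorem rpow_neg_half {ε : ℝ} (hε : 0 ≤ ε) : ε ^ (-(1 / 2) : ℝ) = (Real.sqrt ε)⁻¹ := by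
  rw [Real.rpow_neg hε, Real.sqrt_eq_rpow]

/-- The density of the squared balanced norm. -/
noncomputable def energyDensity (ε : ℝ) (E F : ℝ[X]) (t : ℝ) : ℝ :=
  E.eval t ^ 2 + ε ^ 3 * E.derivative.derivative.eval t ^ 2 + F.eval t ^ 2
    + ε ^ 4 * F.derivative.derivative.eval t ^ 2

/-- The density of the bilinear form. -/
noncomputable def bilinDensity (lam ε : ℝ) (P Q E F : ℝ[X]) (t : ℝ) : ℝ :=
  lam * ((Q.eval t - ε ^ (3 / 2 : ℝ) * P.derivative.derivative.eval t) *
      (F.eval t - ε ^ (3 / 2 : ℝ) * E.derivative.derivative.eval t)) +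
    (ε ^ (5 / 2 : ℝ) * Q.derivative.derivative.eval t + 4 * P.eval t) *
      (ε ^ (3 / 2 : ℝ) * F.derivative.derivative.eval t + 4 * E.eval t)

theorem continuous_energyDensity (ε : ℝ) (E F : ℝ[X]) : Continuous (energyDensity ε E F) := by
  unfold energyDensity; fun_prop

theorem continuous_bilinDensity (lam ε : ℝ) (P Q E F : ℝ[X]) :
    Continuous (bilinDensity lam ε P Q E F) := by
  unfold bilinDensity; fun_prop

section Piecewise

variable {x : ℕ → ℝ} {N : ℕ} {P Q E F : ℕ → ℝ[X]} {eu ev : ℝ → ℝ}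

theorem balancedNorm_eq (hx : IsMesh x N) (ε : ℝ) (hE : IsPiecewise x N eu E)
    (hF : IsPiecewise x N ev F) :
    balancedNorm ε (eu, ev) = Real.sqrt
      (∑ i ∈ Finset.range N, ∫ t in x i..x (i + 1), energyDensity ε (E i) (F i) t) := by
  have val : ∀ {s : ℝ → ℝ} {P : ℕ → ℝ[X]}, IsPiecewise x N s P →
      IntervalIntegrable (fun t => s t ^ 2) volume 0 1 := fun {s P} hP =>
    (hx.integral_eq_sum (g := fun t => s t ^ 2) (G := fun i t => (P i).eval t ^ 2)
      (fun i _ => ((P i).continuous.pow 2).continuousOn)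
      (fun i hi t ht => by rw [hP.value i hi t (Ioo_subset_Icc_self ht)])).1
  have sec : ∀ {s : ℝ → ℝ} {P : ℕ → ℝ[X]}, IsPiecewise x N s P →
      IntervalIntegrable (fun t => D 2 s t ^ 2) volume 0 1 := fun {s P} hP =>
    (hx.integral_eq_sum (g := fun t => D 2 s t ^ 2)
      (G := fun i t => (P i).derivative.derivative.eval t ^ 2)
      (fun i _ => ((P i).derivative.derivative.continuous.pow 2).continuousOn)
      (fun i hi t ht => by rw [hP.second i hi t ht])).1
  have key := (hx.integral_eq_sum
    (g := fun t => eu t ^ 2 + ε ^ 3 * D 2 eu t ^ 2 + ev t ^ 2 + ε ^ 4 * D 2 ev t ^ 2)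
    (G := fun i => energyDensity ε (E i) (F i))
    (fun i _ => (continuous_energyDensity _ _ _).continuousOn)
    (fun i hi t ht => by
      have ht' := Ioo_subset_Icc_self ht
      rw [hE.value i hi t ht', hE.second i hi t ht, hF.value i hi t ht', hF.second i hi t ht,
        energyDensity])).2
  rw [balancedNorm, ← key]
  unfold normSq
  rw [intervalIntegral.integral_add (((val hE).add ((sec hE).const_mul _)).add (val hF))
      ((sec hF).const_mul _),
    intervalIntegral.integral_add ((val hE).add ((sec hE).const_mul _)) (val hF),
    intervalIntegral.integral_add (val hE) ((sec hE).const_mul _),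
    intervalIntegral.integral_const_mul, intervalIntegral.integral_const_mul]

theorem bilin_eq_sum (hx : IsMesh x N) (lam ε : ℝ) (hP : IsPiecewise x N s P)
    (hQ : IsPiecewise x N t Q) (hE : IsPiecewise x N eu E) (hF : IsPiecewise x N ev F) :
    bilin lam ε (s, t) (eu, ev) = ∑ i ∈ Finset.range N,
      ∫ v in x i..x (i + 1), bilinDensity lam ε (P i) (Q i) (E i) (F i) v := by
  have h1 := (hx.integral_eq_sum
    (g := fun v => (t v - ε ^ (3 / 2 : ℝ) * D 2 s v) * (ev v - ε ^ (3 / 2 : ℝ) * D 2 eu v))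
    (G := fun i v => ((Q i).eval v - ε ^ (3 / 2 : ℝ) * (P i).derivative.derivative.eval v) *
      ((F i).eval v - ε ^ (3 / 2 : ℝ) * (E i).derivative.derivative.eval v))
    (fun i _ => by fun_prop)
    (fun i hi v hv => by
      have hv' := Ioo_subset_Icc_self hv
      rw [hP.second i hi v hv, hQ.value i hi v hv', hE.second i hi v hv, hF.value i hi v hv'])).1
  have h2 := (hx.integral_eq_sum
    (g := fun v => (ε ^ (5 / 2 : ℝ) * D 2 t v + 4 * s v) *
      (ε ^ (3 / 2 : ℝ) * D 2 ev v + 4 * eu v))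
    (G := fun i v => (ε ^ (5 / 2 : ℝ) * (Q i).derivative.derivative.eval v + 4 * (P i).eval v) *
      (ε ^ (3 / 2 : ℝ) * (F i).derivative.derivative.eval v + 4 * (E i).eval v))
    (fun i _ => by fun_prop)
    (fun i hi v hv => by
      have hv' := Ioo_subset_Icc_self hv
      rw [hP.value i hi v hv', hQ.second i hi v hv, hE.value i hi v hv', hF.second i hi v hv])).1
  have key := (hx.integral_eq_sum
    (g := fun v => lam * ((t v - ε ^ (3 / 2 : ℝ) * D 2 s v) *
      (ev v - ε ^ (3 / 2 : ℝ) * D 2 eu v)) + (ε ^ (5 / 2 : ℝ) * D 2 t v + 4 * s v) *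
      (ε ^ (3 / 2 : ℝ) * D 2 ev v + 4 * eu v))
    (G := fun i => bilinDensity lam ε (P i) (Q i) (E i) (F i))
    (fun i _ => (continuous_bilinDensity _ _ _ _ _ _).continuousOn)
    (fun i hi v hv => by
      have hv' := Ioo_subset_Icc_self hv
      rw [hP.value i hi v hv', hQ.value i hi v hv', hP.second i hi v hv, hQ.second i hi v hv,
        hE.value i hi v hv', hF.value i hi v hv', hE.second i hi v hv, hF.second i hi v hv,
        bilinDensity])).2
  rw [← key, intervalIntegral.integral_add (h1.const_mul _) h2,
    intervalIntegral.integral_const_mul]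
  rfl

/-- Green's identity. The cellwise boundary terms telescope because values and slopes are continuous
across nodes, and the terms left at 0 and 1 vanish because `eu` is clamped; `ev` satisfies no
boundary condition. -/
theorem sum_integral_second_mul_eq (hx : IsMesh x N) (hE : IsPiecewise x N eu E)
    (hF : IsPiecewise x N ev F) (hcl : Clamped eu) :
    ∑ i ∈ Finset.range N, ∫ t in x i..x (i + 1),
      ((F i).derivative.derivative.eval t * (E i).eval t
        - (E i).derivative.derivative.eval t * (F i).eval t) = 0 := by
  let G : ℝ → ℝ := fun t => D 1 ev t * eu t - ev t * D 1 eu t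
  have h : ∀ i ∈ Finset.range N, ∫ t in x i..x (i + 1),
      ((F i).derivative.derivative.eval t * (E i).eval t
        - (E i).derivative.derivative.eval t * (F i).eval t) = G (x (i + 1)) - G (x i) := by
    intro i hi
    rw [Finset.mem_range] at hi
    have hlt := hx.lt i hi
    rw [intervalIntegral.integral_sub (Continuous.intervalIntegrable (by fun_prop) _ _)
      (Continuous.intervalIntegrable (by fun_prop) _ _),
      integral_second_mul_eval hlt.le (g := fun t => (F i).eval t)
        (g₁ := fun t => (F i).derivative.eval t)
        (fun t _ => ((F i).hasDerivAt t).hasDerivWithinAt)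
        (fun t _ => ((F i).derivative.hasDerivAt t).hasDerivWithinAt)
        (F i).derivative.derivative.continuous.continuousOn (E i)]
    have hl := left_mem_Icc.2 hlt.le
    have hr := right_mem_Icc.2 hlt.le
    simp only [G]
    rw [hE.value i hi _ hl, hE.value i hi _ hr, hE.slope i hi _ hl, hE.slope i hi _ hr,
      hF.value i hi _ hl, hF.value i hi _ hr, hF.slope i hi _ hl, hF.slope i hi _ hr]
    simp only [mul_comm (eval _ (F i))]
    ring
  rw [Finset.sum_congr rfl h, Finset.sum_range_sub (fun i => G (x i)), hx.first, hx.last]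
  simp only [G]
  rw [hcl.value_zero, hcl.slope_zero, hcl.value_one, hcl.slope_one]
  ring

/-- Coercivity of the bilinear form. -/
theorem sum_energyDensity_le (hx : IsMesh x N) {lam ε : ℝ} (hlam : 3 ≤ lam) (hε : 0 < ε)
    (hε1 : ε ≤ 1) (hE : IsPiecewise x N eu E) (hF : IsPiecewise x N ev F) (hcl : Clamped eu) :
    ∑ i ∈ Finset.range N, ∫ t in x i..x (i + 1), energyDensity ε (E i) (F i) t ≤
      ∑ i ∈ Finset.range N, ∫ t in x i..x (i + 1),
        bilinDensity lam ε (E i) (F i) (E i) (F i) t := by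
  have h0 := sum_integral_second_mul_eq hx hE hF hcl
  -- This is the coefficient of F''E on the diagonal of the form. Subtracting `c` times Green's
  -- identity replaces that product by E''F, which can be estimated pointwise.
  set c := 4 * (ε ^ (5 / 2 : ℝ) + ε ^ (3 / 2 : ℝ)) with hc
  have h1 : ∑ i ∈ Finset.range N, ∫ t in x i..x (i + 1), energyDensity ε (E i) (F i) t ≤
      ∑ i ∈ Finset.range N, ((∫ t in x i..x (i + 1), bilinDensity lam ε (E i) (F i) (E i) (F i) t)
        - c * ∫ t in x i..x (i + 1), ((F i).derivative.derivative.eval t * (E i).eval t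
        - (E i).derivative.derivative.eval t * (F i).eval t)) := by
    refine Finset.sum_le_sum fun i hi => ?_
    have hlt := hx.lt i (Finset.mem_range.1 hi)
    have cb := continuous_bilinDensity lam ε (E i) (F i) (E i) (F i)
    rw [← intervalIntegral.integral_const_mul, ← intervalIntegral.integral_sub
      (cb.intervalIntegrable _ _) (Continuous.intervalIntegrable (by fun_prop) _ _)]
    refine intervalIntegral.integral_mono_on hlt.le
      ((continuous_energyDensity _ _ _).intervalIntegrable _ _)
      (Continuous.intervalIntegrable (cb.sub (by fun_prop)) _ _) fun t _ => ?_
    rw [hc, energyDensity, bilinDensity, rpow_three_halves hε.le, rpow_five_halves hε.le]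
    obtain ⟨r, hr0, hr1, rfl⟩ : ∃ r : ℝ, 0 < r ∧ r ≤ 1 ∧ ε = r ^ 2 :=
      ⟨Real.sqrt ε, Real.sqrt_pos.2 hε, Real.sqrt_le_one.2 hε1, (Real.sq_sqrt hε.le).symm⟩
    rw [Real.sqrt_sq hr0.le]
    generalize (E i).eval t = e
    generalize (F i).eval t = f
    generalize (E i).derivative.derivative.eval t = e2
    generalize (F i).derivative.derivative.eval t = f2
    have h3 : 0 ≤ (lam - 3) * (f - r ^ 3 * e2) ^ 2 := mul_nonneg (by linarith) (sq_nonneg _)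
    -- With g = r³ e2 this form is 3(f - g)² + 4(r² + 1)fg - f² - g²; it is nonnegative because 4r²
    -- - 2 lies in [-2, 2].
    have h4 : 0 ≤ 2 * f ^ 2 + 2 * (r ^ 3 * e2) ^ 2 + (4 * r ^ 2 - 2) * (f * (r ^ 3 * e2)) := by
      have h5 : 0 ≤ r ^ 2 * (f + r ^ 3 * e2) ^ 2 := by positivity
      have h6 : 0 ≤ (1 - r ^ 2) * (f - r ^ 3 * e2) ^ 2 :=
        mul_nonneg (by nlinarith) (sq_nonneg _)
      nlinarith [sq_nonneg f, sq_nonneg (r ^ 3 * e2)]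
    nlinarith [sq_nonneg e]
  rwa [Finset.sum_sub_distrib, ← Finset.mul_sum, h0, mul_zero, sub_zero] at h1

end Piecewise

/-- The density that controls the interpolation errors `a_u`, `a_v` and the corrections
`c_u`, `c_v`, with the weight `μ` for the consistency defect. -/
noncomputable def errorDensity (lam ε μ : ℝ) (au av cu cu2 cv cv2 : ℝ → ℝ) (t : ℝ) : ℝ :=
  av t ^ 2 + au t ^ 2 + (lam - 4) ^ 2 * μ ^ 2 * au t ^ 2 + cv t ^ 2 + ε ^ 3 * cu2 t ^ 2 +
    ε ^ 4 * cv2 t ^ 2 + ε⁻¹ * cu t ^ 2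

theorem continuousOn_errorDensity (lam ε μ : ℝ) {s : Set ℝ} {au av cu cu2 cv cv2 : ℝ → ℝ}
    (cau : ContinuousOn au s) (cav : ContinuousOn av s) (ccu : ContinuousOn cu s)
    (ccu2 : ContinuousOn cu2 s) (ccv : ContinuousOn cv s) (ccv2 : ContinuousOn cv2 s) :
    ContinuousOn (errorDensity lam ε μ au av cu cu2 cv cv2) s := by
  unfold errorDensity; fun_prop

theorem mul_le_young (a b : ℝ) : a * b ≤ 4 * a ^ 2 + b ^ 2 / 16 := by
  nlinarith [sq_nonneg (2 * a - b / 4)]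

/-- The norm dominates only `r ^ 4 * f2`, whereas `cu` and `au` meet `r ^ 3 * f2`. For `cu` the
missing factor is paid by the weight `(r ^ 2)⁻¹`. For `au` it is left open: the product is split
with the weight `μ`, and the resulting `r ^ 6 * f2 ^ 2` is handled cell by cell. -/
theorem consistency_pointwise {lam r μ K : ℝ} (hr : 0 < r) (hr1 : r ≤ 1) (hμ : 0 < μ) (hK : 0 < K)
    (au av cu cu2 cv cv2 e e2 f f2 : ℝ) :
    lam * (av * (f - r ^ 3 * e2)) + 16 * au * e + 4 * r ^ 5 * av * e2 +
        lam * ((cv - r ^ 3 * cu2) * (f - r ^ 3 * e2)) +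
        (r ^ 5 * cv2 + 4 * cu) * (r ^ 3 * f2 + 4 * e) + (4 - lam) * r ^ 3 * au * f2 ≤
      1 / 4 * (e ^ 2 + r ^ 6 * e2 ^ 2 + f ^ 2 + r ^ 8 * f2 ^ 2) +
        (8 * lam ^ 2 + 1200 + K) * (av ^ 2 + au ^ 2 + (lam - 4) ^ 2 * μ ^ 2 * au ^ 2 + cv ^ 2
          + r ^ 6 * cu2 ^ 2 + r ^ 8 * cv2 ^ 2 + (r ^ 2)⁻¹ * cu ^ 2) +
        (4 * K * μ ^ 2)⁻¹ * (r ^ 6 * f2 ^ 2) := by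
  obtain ⟨d, rfl⟩ : ∃ d, cu = r * d := ⟨cu / r, by field_simp⟩
  have e0 : (r ^ 2)⁻¹ * (r * d) ^ 2 = d ^ 2 := by field_simp
  rw [e0]
  have hr2 : r ^ 2 ≤ 1 := by nlinarith
  have hr4 : r ^ 4 ≤ 1 := by nlinarith
  -- Each of `e`, `r ^ 3 * e2`, `f` and `r ^ 4 * f2` occurs in at most four products, so the
  -- sixteenths sum to at most 1/4. The number 1200 covers the largest numerical sum, 4 · 16² + 4 ·
  -- 4².
  have a1 := mul_le_young (lam * av) f
  have a2 := mul_le_young (-lam * av) (r ^ 3 * e2)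
  have a3 := mul_le_young (16 * au) e
  have a4 := mul_le_young (4 * r ^ 2 * av) (r ^ 3 * e2)
  have a5 := mul_le_young (lam * cv) f
  have a6 := mul_le_young (-lam * (r ^ 3 * cu2)) f
  have a7 := mul_le_young (-lam * cv) (r ^ 3 * e2)
  have a8 := mul_le_young (lam * (r ^ 3 * cu2)) (r ^ 3 * e2)
  have a9 := mul_le_young (r ^ 4 * cv2) (r ^ 4 * f2)
  have a10 := mul_le_young (4 * r * (r ^ 4 * cv2)) e
  have a11 := mul_le_young (4 * d) (r ^ 4 * f2)
  have a12 := mul_le_young (16 * r * d) e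
  have a13 : (4 - lam) * r ^ 3 * au * f2 ≤
      K * ((lam - 4) ^ 2 * μ ^ 2 * au ^ 2) + (4 * K * μ ^ 2)⁻¹ * (r ^ 6 * f2 ^ 2) := by
    have h : K * ((lam - 4) ^ 2 * μ ^ 2 * au ^ 2) + (4 * K * μ ^ 2)⁻¹ * (r ^ 6 * f2 ^ 2)
        - (4 - lam) * r ^ 3 * au * f2 =
        (4 * K * μ ^ 2)⁻¹ * (r ^ 3 * f2 - 2 * K * μ ^ 2 * (4 - lam) * au) ^ 2 := by
      field_simp; ring
    have : 0 ≤ (4 * K * μ ^ 2)⁻¹ * (r ^ 3 * f2 - 2 * K * μ ^ 2 * (4 - lam) * au) ^ 2 := by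
      positivity
    linarith
  have b1 : r ^ 4 * av ^ 2 ≤ av ^ 2 := mul_le_of_le_one_left (sq_nonneg _) hr4
  have b2 : r ^ 2 * (r ^ 4 * cv2) ^ 2 ≤ (r ^ 4 * cv2) ^ 2 :=
    mul_le_of_le_one_left (sq_nonneg _) hr2
  have b3 : r ^ 2 * d ^ 2 ≤ d ^ 2 := mul_le_of_le_one_left (sq_nonneg _) hr2
  have n0 : 0 ≤ (lam - 4) ^ 2 * μ ^ 2 * au ^ 2 := by positivity
  have n1 := sq_nonneg au
  have n2 := sq_nonneg av
  have n3 := sq_nonneg cv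
  have n4 := sq_nonneg (r ^ 3 * cu2)
  have n5 := sq_nonneg (r ^ 4 * cv2)
  have n6 := sq_nonneg d
  have m1 : 0 ≤ lam ^ 2 * au ^ 2 := by positivity
  have m5 : 0 ≤ lam ^ 2 * (r ^ 4 * cv2) ^ 2 := by positivity
  have m6 : 0 ≤ lam ^ 2 * d ^ 2 := by positivity
  have m7 : 0 ≤ lam ^ 2 * ((lam - 4) ^ 2 * μ ^ 2 * au ^ 2) := by positivity
  have k1 := mul_nonneg hK.le n1
  have k2 := mul_nonneg hK.le n2
  have k3 := mul_nonneg hK.le n3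
  have k4 := mul_nonneg hK.le n4
  have k5 := mul_nonneg hK.le n5
  have k6 := mul_nonneg hK.le n6
  have q1 := sq_nonneg e
  have q2 := sq_nonneg f
  have q3 := sq_nonneg (r ^ 4 * f2)
  linarith

/-- The consistency error of one cell. -/
theorem consistency_cell {lam ε μ K a b : ℝ} (hε : 0 < ε) (hε1 : ε ≤ 1) (hμ : 0 < μ) (hK : 0 < K)
    (hab : a ≤ b) (E F : ℝ[X]) {au au2 av av2 cu cu2 cv cv2 : ℝ → ℝ}
    (cau : ContinuousOn au (Icc a b)) (cau2 : ContinuousOn au2 (Icc a b))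
    (cav : ContinuousOn av (Icc a b)) (cav2 : ContinuousOn av2 (Icc a b))
    (ccu : ContinuousOn cu (Icc a b)) (ccu2 : ContinuousOn cu2 (Icc a b))
    (ccv : ContinuousOn cv (Icc a b)) (ccv2 : ContinuousOn cv2 (Icc a b))
    (h1 : ∫ t in a..b, au2 t * E.derivative.derivative.eval t = 0)
    (h2 : ∫ t in a..b, av2 t * F.derivative.derivative.eval t = 0)
    (h3 : ∫ t in a..b, au2 t * F.eval t = ∫ t in a..b, au t * F.derivative.derivative.eval t)
    (h4 : ∫ t in a..b, av2 t * E.eval t = ∫ t in a..b, av t * E.derivative.derivative.eval t)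
    (hinv : ε ^ 3 * ∫ t in a..b, F.derivative.derivative.eval t ^ 2 ≤
      K * μ ^ 2 * ∫ t in a..b, energyDensity ε E F t) :
    ∫ t in a..b, (lam * ((av t + cv t - ε ^ (3 / 2 : ℝ) * (au2 t + cu2 t)) *
        (F.eval t - ε ^ (3 / 2 : ℝ) * E.derivative.derivative.eval t)) +
      (ε ^ (5 / 2 : ℝ) * (av2 t + cv2 t) + 4 * (au t + cu t)) *
        (ε ^ (3 / 2 : ℝ) * F.derivative.derivative.eval t + 4 * E.eval t)) ≤
      1 / 2 * (∫ t in a..b, energyDensity ε E F t) +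
        (8 * lam ^ 2 + 1200 + K) * ∫ t in a..b, errorDensity lam ε μ au av cu cu2 cv cv2 t := by
  rw [rpow_three_halves hε.le, rpow_five_halves hε.le]
  set r := Real.sqrt ε with hr
  have hr0 : 0 < r := Real.sqrt_pos.2 hε
  have hr1 : r ≤ 1 := Real.sqrt_le_one.2 hε1
  have hεr : ε = r ^ 2 := (Real.sq_sqrt hε.le).symm
  have cE : ContinuousOn (fun t => E.eval t) (Icc a b) := E.continuous.continuousOn
  have cF : ContinuousOn (fun t => F.eval t) (Icc a b) := F.continuous.continuousOn
  have cE2 : ContinuousOn (fun t => E.derivative.derivative.eval t) (Icc a b) :=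
    E.derivative.derivative.continuous.continuousOn
  have cF2 : ContinuousOn (fun t => F.derivative.derivative.eval t) (Icc a b) :=
    F.derivative.derivative.continuous.continuousOn
  have cI : ∀ {g : ℝ → ℝ}, ContinuousOn g (Icc a b) → IntervalIntegrable g volume a b :=
    fun hg => ContinuousOn.intervalIntegrable (by rwa [uIcc_of_le hab])
  have ceng := (continuous_energyDensity ε E F).continuousOn (s := Icc a b)
  have cerr : ContinuousOn (errorDensity lam ε μ au av cu cu2 cv cv2) (Icc a b) :=
    continuousOn_errorDensity _ _ _ cau cav ccu ccu2 ccv ccv2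
  have c1 : ContinuousOn (fun t => au2 t * E.derivative.derivative.eval t) (Icc a b) := cau2.mul cE2
  have c2 : ContinuousOn (fun t => av2 t * F.derivative.derivative.eval t) (Icc a b) := cav2.mul cF2
  have c3 : ContinuousOn (fun t => au2 t * F.eval t) (Icc a b) := cau2.mul cF
  have c3' : ContinuousOn (fun t => au t * F.derivative.derivative.eval t) (Icc a b) := cau.mul cF2
  have c4 : ContinuousOn (fun t => av2 t * E.eval t) (Icc a b) := cav2.mul cE
  have c4' : ContinuousOn (fun t => av t * E.derivative.derivative.eval t) (Icc a b) := cav.mul cE2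
  -- `G` is the integrand after the exchanges permitted by `h1`–`h4`; it differs from the original
  -- by multiples of `R₁`, …, `R₄`, whose integrals vanish. In the coefficient `4 - lam`, the 4
  -- comes from the second product of the form and `lam` from the first.
  let G : ℝ → ℝ := fun t => lam * (av t * (F.eval t - r ^ 3 * E.derivative.derivative.eval t)) +
    16 * au t * E.eval t + 4 * r ^ 5 * av t * E.derivative.derivative.eval t +
    lam * ((cv t - r ^ 3 * cu2 t) * (F.eval t - r ^ 3 * E.derivative.derivative.eval t)) +
    (r ^ 5 * cv2 t + 4 * cu t) * (r ^ 3 * F.derivative.derivative.eval t + 4 * E.eval t) +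
    (4 - lam) * r ^ 3 * au t * F.derivative.derivative.eval t
  have cG : ContinuousOn G (Icc a b) := by fun_prop
  let R₁ : ℝ → ℝ := fun t => au2 t * E.derivative.derivative.eval t
  let R₂ : ℝ → ℝ := fun t => av2 t * F.derivative.derivative.eval t
  let R₃ : ℝ → ℝ := fun t => au2 t * F.eval t - au t * F.derivative.derivative.eval t
  let R₄ : ℝ → ℝ := fun t => av2 t * E.eval t - av t * E.derivative.derivative.eval t
  have e3 : ∫ t in a..b, R₃ t = 0 := by
    rw [intervalIntegral.integral_sub (cI c3) (cI c3'), h3, sub_self]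
  have e4 : ∫ t in a..b, R₄ t = 0 := by
    rw [intervalIntegral.integral_sub (cI c4) (cI c4'), h4, sub_self]
  have cR₁ : ContinuousOn R₁ (Icc a b) := c1
  have cR₂ : ContinuousOn R₂ (Icc a b) := c2
  have cR₃ : ContinuousOn R₃ (Icc a b) := c3.sub c3'
  have cR₄ : ContinuousOn R₄ (Icc a b) := c4.sub c4'
  have i₁ := cI (cR₁.const_mul (lam * r ^ 6))
  have i₂ := cI (cR₂.const_mul (r ^ 8))
  have i₃ := cI (cR₃.const_mul (-(lam * r ^ 3)))
  have i₄ := cI (cR₄.const_mul (4 * r ^ 5))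
  have hsplit : ∫ t in a..b, (lam * ((av t + cv t - r ^ 3 * (au2 t + cu2 t)) *
        (F.eval t - r ^ 3 * E.derivative.derivative.eval t)) +
      (r ^ 5 * (av2 t + cv2 t) + 4 * (au t + cu t)) *
        (r ^ 3 * F.derivative.derivative.eval t + 4 * E.eval t)) = ∫ t in a..b, G t := by
    have : ∫ t in a..b, (G t + lam * r ^ 6 * R₁ t + r ^ 8 * R₂ t + -(lam * r ^ 3) * R₃ t
        + 4 * r ^ 5 * R₄ t) = ∫ t in a..b, G t := by
      rw [intervalIntegral.integral_add ((((cI cG).add i₁).add i₂).add i₃) i₄,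
        intervalIntegral.integral_add (((cI cG).add i₁).add i₂) i₃,
        intervalIntegral.integral_add ((cI cG).add i₁) i₂,
        intervalIntegral.integral_add (cI cG) i₁]
      simp only [intervalIntegral.integral_const_mul, e3, e4]
      rw [h1, h2]
      ring
    rw [← this]
    refine intervalIntegral.integral_congr fun t _ => ?_
    simp only [G, R₁, R₂, R₃, R₄]
    ring
  rw [hsplit]
  have cF2' : ContinuousOn (fun t => (4 * K * μ ^ 2)⁻¹ *
      (ε ^ 3 * F.derivative.derivative.eval t ^ 2)) (Icc a b) := by fun_prop
  have hmono : ∫ t in a..b, G t ≤ ∫ t in a..b, (1 / 4 * energyDensity ε E F t +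
      (8 * lam ^ 2 + 1200 + K) * errorDensity lam ε μ au av cu cu2 cv cv2 t +
      (4 * K * μ ^ 2)⁻¹ * (ε ^ 3 * F.derivative.derivative.eval t ^ 2)) := by
    refine intervalIntegral.integral_mono_on hab (cI cG)
      (cI (((ceng.const_mul _).add (cerr.const_mul _)).add cF2')) fun t _ => ?_
    have := consistency_pointwise (lam := lam) hr0 hr1 hμ hK (au t) (av t) (cu t) (cu2 t) (cv t)
      (cv2 t) (E.eval t) (E.derivative.derivative.eval t) (F.eval t)
      (F.derivative.derivative.eval t)
    simp only [energyDensity, errorDensity, G]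
    rw [hεr]
    convert this using 1
    ring
  refine hmono.trans ?_
  rw [intervalIntegral.integral_add ((cI (ceng.const_mul _)).add (cI (cerr.const_mul _)))
    (cI cF2'), intervalIntegral.integral_add (cI (ceng.const_mul _)) (cI (cerr.const_mul _))]
  simp only [intervalIntegral.integral_const_mul]
  -- The weight is chosen so that `hinv` yields exactly a quarter of the energy; with the quarter
  -- already present this makes a half, which coercivity absorbs.
  have hlast : (4 * K * μ ^ 2)⁻¹ * (ε ^ 3 * ∫ t in a..b, F.derivative.derivative.eval t ^ 2) ≤
      1 / 4 * ∫ t in a..b, energyDensity ε E F t := by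
    refine (mul_le_mul_of_nonneg_left hinv (by positivity)).trans_eq ?_
    field_simp
  linarith

/-! ### Galerkin orthogonality -/

theorem IsSolution.integral_load {ε : ℝ} {f u : ℝ → ℝ} (hu : IsSolution ε f u) (g : ℝ → ℝ) :
    ∫ t in (0 : ℝ)..1, f t * g t = ∫ t in (0 : ℝ)..1, (ε ^ 4 * D 4 u t + 4 * u t) * g t := by
  rw [intervalIntegral.integral_of_le zero_le_one, intervalIntegral.integral_of_le zero_le_one,
    integral_Ioc_eq_integral_Ioo, integral_Ioc_eq_integral_Ioo]
  refine integral_congr_ae ?_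
  filter_upwards [hu.ode] with t ht
  rw [ht]

/-- The residual of the pair of polynomials `P`, `Q`, tested with `E`, `F`. -/
noncomputable def residualDensity (lam ε : ℝ) (u : ℝ → ℝ) (P Q E F : ℝ[X]) (t : ℝ) : ℝ :=
  lam * ((Q.eval t - ε ^ (3 / 2 : ℝ) * P.derivative.derivative.eval t) *
      (F.eval t - ε ^ (3 / 2 : ℝ) * E.derivative.derivative.eval t)) +
    (ε ^ (5 / 2 : ℝ) * Q.derivative.derivative.eval t + 4 * P.eval t
      - (ε ^ 4 * D 4 u t + 4 * u t)) *
      (ε ^ (3 / 2 : ℝ) * F.derivative.derivative.eval t + 4 * E.eval t)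

/-- The discrete equation, tested with the error itself, removes `uh` and `vh` from the first
argument of the form. The load is rewritten through the differential equation, and five derivatives
of `u` make the new integrand continuous on cells. -/
theorem galerkin_orthogonality {x : ℕ → ℝ} {N p : ℕ} (hx : IsMesh x N) {lam ε : ℝ}
    {f u uh vh s t : ℝ → ℝ} {P Q Uh Vh : ℕ → ℝ[X]} (hu : IsSolution ε f u) (hu5 : DiffUpTo 5 u)
    (hfem : IsFEMSolution p x N lam ε f (uh, vh))
    (hmem : (s - uh, t - vh) ∈ feSpace p x N)
    (hU : IsPiecewise x N uh Uh) (hV : IsPiecewise x N vh Vh)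
    (hE : IsPiecewise x N (s - uh) (P - Uh)) (hF : IsPiecewise x N (t - vh) (Q - Vh)) :
    ∑ i ∈ Finset.range N, ∫ v in x i..x (i + 1),
        bilinDensity lam ε (P i - Uh i) (Q i - Vh i) (P i - Uh i) (Q i - Vh i) v =
      ∑ i ∈ Finset.range N, ∫ v in x i..x (i + 1),
        residualDensity lam ε u (P i) (Q i) (P i - Uh i) (Q i - Vh i) v := by
  have cu : ContinuousOn u (Icc 0 1) := by
    have := hu5.continuousOn (k := 0) (by omega)
    rwa [D_zero] at this
  have cu4 : ContinuousOn (D 4 u) (Icc 0 1) := hu5.continuousOn (by omega)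
  have hg := hfem.2 _ hmem
  have hload : load ε f (s - uh, t - vh) = ∑ i ∈ Finset.range N, ∫ v in x i..x (i + 1),
      (ε ^ 4 * D 4 u v + 4 * u v) * (ε ^ (3 / 2 : ℝ) *
        (Q i - Vh i).derivative.derivative.eval v + 4 * (P i - Uh i).eval v) := by
    rw [load, hu.integral_load]
    exact (hx.integral_eq_sum
      (fun i hi => by
        have := cu.mono (hx.cell_subset hi)
        have := cu4.mono (hx.cell_subset hi)
        fun_prop)
      (fun i hi v hv => by
        dsimp only
        rw [hE.value i hi v (Ioo_subset_Icc_self hv), hF.second i hi v hv]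
        rfl)).2
  rw [bilin_eq_sum hx lam ε hU hV hE hF, hload] at hg
  rw [← sub_eq_zero, ← Finset.sum_sub_distrib]
  rw [← sub_eq_zero, ← Finset.sum_sub_distrib, ← neg_eq_zero, ← Finset.sum_neg_distrib] at hg
  rw [← hg]
  refine Finset.sum_congr rfl fun i hi => ?_
  have hi := Finset.mem_range.1 hi
  have hlt := hx.lt i hi
  have := cu.mono (hx.cell_subset hi)
  have := cu4.mono (hx.cell_subset hi)
  have cI : ∀ {g : ℝ → ℝ}, ContinuousOn g (Icc (x i) (x (i + 1))) →
      IntervalIntegrable g volume (x i) (x (i + 1)) :=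
    fun hg => ContinuousOn.intervalIntegrable (by rwa [uIcc_of_le hlt.le])
  rw [← intervalIntegral.integral_sub ((continuous_bilinDensity _ _ _ _ _ _).intervalIntegrable _ _)
      (cI (by unfold residualDensity; fun_prop)),
    ← intervalIntegral.integral_sub ((continuous_bilinDensity _ _ _ _ _ _).intervalIntegrable _ _)
      (cI (by fun_prop)), ← intervalIntegral.integral_neg]
  refine intervalIntegral.integral_congr fun v _ => ?_
  simp only [bilinDensity, residualDensity, Pi.sub_apply, eval_sub, derivative_sub]
  ring

/-! ### The Shishkin mesh -/

section Nodes

variable {τ : ℝ} {n i : ℕ}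

theorem node_of_le (hn : 0 < n) (hi : i ≤ n) : node τ (4 * n) i = i * (τ / n) := by
  have : (n : ℝ) ≠ 0 := by positivity
  rw [node, if_pos (by omega)]
  push_cast
  field_simp

/-- `node` puts the index `n` into its first branch and `3 * n` into its second. The neighbouring
formulas agree at these indices, so each may be used up to and including the transition points. -/
theorem node_of_mem (hn : 0 < n) (h1 : n ≤ i) (h3 : i ≤ 3 * n) :
    node τ (4 * n) i = τ + (i - n) * ((1 - 2 * τ) / (2 * n)) := by
  have : (n : ℝ) ≠ 0 := by positivity
  rcases h1.eq_or_lt with rfl | h1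
  · rw [node_of_le hn le_rfl]
    field_simp
    ring
  · rw [node, if_neg (by omega), if_pos (by omega)]
    push_cast
    field_simp
    ring

theorem node_of_ge (hn : 0 < n) (h3 : 3 * n ≤ i) :
    node τ (4 * n) i = 1 - (4 * n - i) * (τ / n) := by
  have : (n : ℝ) ≠ 0 := by positivity
  rcases h3.eq_or_lt with rfl | h3
  · rw [node_of_mem hn (by omega) le_rfl]
    push_cast
    field_simp
    ring
  · rw [node, if_neg (by omega), if_neg (by omega)]
    push_cast
    field_simp

theorem node_first (hn : 0 < n) : node τ (4 * n) 0 = 0 := by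
  rw [node_of_le hn (Nat.zero_le n)]; simp

theorem node_last (hn : 0 < n) : node τ (4 * n) (4 * n) = 1 := by
  rw [node_of_ge hn (by omega)]; simp

theorem node_transition (hn : 0 < n) : node τ (4 * n) n = τ := by
  rw [node_of_mem hn le_rfl (by omega)]; simp

theorem node_transition' (hn : 0 < n) : node τ (4 * n) (3 * n) = 1 - τ := by
  have : (n : ℝ) ≠ 0 := by positivity
  rw [node_of_ge hn le_rfl]
  push_cast
  field_simp
  ring

theorem node_sub_of_lt (hn : 0 < n) (hi : i < n) :
    node τ (4 * n) (i + 1) - node τ (4 * n) i = τ / n := by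
  rw [node_of_le hn hi, node_of_le hn hi.le]; push_cast; ring

theorem node_sub_of_mem (hn : 0 < n) (h1 : n ≤ i) (h3 : i < 3 * n) :
    node τ (4 * n) (i + 1) - node τ (4 * n) i = (1 - 2 * τ) / (2 * n) := by
  rw [node_of_mem hn (by omega) h3, node_of_mem hn h1 h3.le]; push_cast; ring

theorem node_sub_of_ge (hn : 0 < n) (h3 : 3 * n ≤ i) :
    node τ (4 * n) (i + 1) - node τ (4 * n) i = τ / n := by
  rw [node_of_ge hn (by omega), node_of_ge hn h3]; push_cast; ring

theorem isMesh_node (hn : 0 < n) (h0 : 0 < τ) (h1 : τ ≤ 1 / 4) :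
    IsMesh (node τ (4 * n)) (4 * n) := by
  refine ⟨node_first hn, node_last hn, fun i _ => sub_pos.1 ?_⟩
  rcases lt_or_ge i n with h | h
  · rw [node_sub_of_lt hn h]; positivity
  · rcases lt_or_ge i (3 * n) with h' | h'
    · rw [node_sub_of_mem hn h h']
      exact div_pos (by linarith) (by positivity)
    · rw [node_sub_of_ge hn h']; positivity

end Nodes

/-! ### The special representatives as splines -/

theorem interp_eq {p N : ℕ} {x : ℕ → ℝ} (hx : IsMesh x N) (w : ℝ → ℝ) {i : ℕ} (hi : i < N) {t : ℝ}
    (h1 : x i ≤ t) (h2 : t < x (i + 1) ∨ i + 1 = N) :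
    interp p x N w t = (localInterp p (x i) (x (i + 1)) w).eval t := by
  classical
  -- The search stops at `N - 1`, so the last cell also owns its right end point.
  have : Nat.findGreatest (fun j => x j ≤ t) (N - 1) = i := by
    refine Nat.findGreatest_eq_iff.2 ⟨by omega, fun _ => h1, fun j hij hj => ?_⟩
    rcases h2 with h2 | h2
    · exact not_le.2 (h2.trans_le (hx.mono hij (by omega)))
    · omega
  simp only [interp, this]

/-- The function that is interpolated on the `i`-th cell. -/
noncomputable def cellTarget (n : ℕ) (w wreg : ℝ → ℝ) (i : ℕ) : ℝ → ℝ :=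
  if n ≤ i ∧ i < 3 * n then wreg else w

/-- The cubic correction on the `i`-th cell. -/
noncomputable def cellCorrection (n : ℕ) (τ : ℝ) (wbl : ℝ → ℝ) (i : ℕ) : ℝ[X] :=
  if i < n then -(C (D 1 wbl τ) * chi₀ τ) - C (wbl τ) * chi₁ τ
  else if i < 3 * n then 0
  else C (D 1 wbl (1 - τ)) * (chi₀ τ).comp (1 - X) - C (wbl (1 - τ)) * (chi₁ τ).comp (1 - X)

/-- The special representative on the `i`-th cell. -/
noncomputable def specialPoly (p n : ℕ) (τ : ℝ) (w wreg wbl : ℝ → ℝ) (i : ℕ) : ℝ[X] :=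
  localInterp p (node τ (4 * n) i) (node τ (4 * n) (i + 1)) (cellTarget n w wreg i)
    + cellCorrection n τ wbl i

section Special

variable {p n : ℕ} {τ : ℝ} {w wreg wbl : ℝ → ℝ}

/-- τ and 1 - τ are the nodes of index `n` and `3 * n`, so the strict comparisons in `special`
respect the half-open cells. -/
theorem special_eq_eval (hn : 0 < n) (h0 : 0 < τ) (h1 : τ ≤ 1 / 4) {i : ℕ} (hi : i < 4 * n) {t : ℝ}
    (ht : node τ (4 * n) i ≤ t) (ht' : t < node τ (4 * n) (i + 1) ∨ i + 1 = 4 * n) :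
    special p (node τ (4 * n)) (4 * n) τ w wreg wbl t =
      (specialPoly p n τ w wreg wbl i).eval t := by
  have hx := isMesh_node hn h0 h1
  rcases lt_or_ge i n with h | h
  · have hlt : t < τ := by
      have := ht'.resolve_right (by omega)
      have := hx.mono (show i + 1 ≤ n by omega) (by omega)
      rw [node_transition hn] at this
      linarith
    rw [special, if_pos hlt, interp_eq hx w hi ht ht', specialPoly, cellTarget, cellCorrection,
      if_neg (by omega), if_pos h]
    simp only [eval_add, eval_sub, eval_mul, eval_C, eval_neg]
    ring
  · have hge : τ ≤ t := by
      have := hx.mono h hi.le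
      rw [node_transition hn] at this
      linarith
    rcases lt_or_ge i (3 * n) with h' | h'
    · have hlt : t < 1 - τ := by
        have := ht'.resolve_right (by omega)
        have := hx.mono (show i + 1 ≤ 3 * n by omega) (by omega)
        rw [node_transition' hn] at this
        linarith
      rw [special, if_neg (not_lt.2 hge), if_pos hlt, interp_eq hx wreg hi ht ht', specialPoly,
        cellTarget, cellCorrection, if_pos ⟨h, h'⟩, if_neg (by omega), if_pos h', add_zero]
    · have hge' : 1 - τ ≤ t := by
        have := hx.mono h' hi.le
        rw [node_transition' hn] at this
        linarith
      rw [special, if_neg (not_lt.2 hge), if_neg (not_lt.2 hge'), interp_eq hx w hi ht ht',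
        specialPoly, cellTarget, cellCorrection, if_neg (by omega), if_neg (by omega),
        if_neg (by omega)]
      simp only [eval_add, eval_sub, eval_mul, eval_C, eval_comp, eval_one, eval_X]
      ring

theorem natDegree_specialPoly_le (hp : 3 ≤ p) (h0 : 0 < τ) {i : ℕ}
    (hI : IsLocalInterp p (node τ (4 * n) i) (node τ (4 * n) (i + 1)) (cellTarget n w wreg i)
      (localInterp p (node τ (4 * n) i) (node τ (4 * n) (i + 1)) (cellTarget n w wreg i))) :
    (specialPoly p n τ w wreg wbl i).natDegree ≤ p := by
  have hlin : (1 - X : ℝ[X]).natDegree ≤ 1 := by compute_degree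
  have hcomp : ∀ q : ℝ[X], q.natDegree ≤ 3 → (q.comp (1 - X)).natDegree ≤ 3 := fun q hq =>
    natDegree_comp_le.trans (by nlinarith)
  have c0 := (chi₀_spec h0.ne').1
  have c1 := (chi₁_spec h0.ne').1
  have hC : ∀ (c : ℝ) (q : ℝ[X]), q.natDegree ≤ 3 → (C c * q).natDegree ≤ 3 := fun c q hq =>
    (natDegree_C_mul_le c q).trans hq
  refine (natDegree_add_le _ _).trans (max_le hI.degree (le_trans ?_ hp))
  unfold cellCorrection
  split_ifs
  · refine (natDegree_sub_le _ _).trans (max_le ?_ (hC _ _ c1))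
    rw [natDegree_neg]; exact hC _ _ c0
  · simp
  · exact (natDegree_sub_le _ _).trans
      (max_le (hC _ _ (hcomp _ c0)) (hC _ _ (hcomp _ c1)))

theorem diffUpTo_cellTarget {K : ℕ} (hw : DiffUpTo K w) (hreg : DiffUpTo K wreg) (i : ℕ) :
    DiffUpTo K (cellTarget n w wreg i) := by
  unfold cellTarget; split_ifs <;> assumption

theorem isLocalInterp_cellTarget (hp : 3 ≤ p) (hn : 0 < n) (h0 : 0 < τ) (h1 : τ ≤ 1 / 4)
    (hw : DiffUpTo 3 w) (hreg : DiffUpTo 3 wreg) {i : ℕ} (hi : i < 4 * n) :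
    IsLocalInterp p (node τ (4 * n) i) (node τ (4 * n) (i + 1)) (cellTarget n w wreg i)
      (localInterp p (node τ (4 * n) i) (node τ (4 * n) (i + 1)) (cellTarget n w wreg i)) :=
  have hx := isMesh_node hn h0 h1
  (diffUpTo_cellTarget hw hreg i).isLocalInterp (by omega) (hx.lt i hi) (hx.cell_subset hi)

theorem eval_specialPoly_left (hp : 3 ≤ p) (hn : 0 < n) (h0 : 0 < τ) (h1 : τ ≤ 1 / 4)
    (hw : DiffUpTo 3 w) (hreg : DiffUpTo 3 wreg) {i : ℕ} (hi : i < 4 * n) :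
    (specialPoly p n τ w wreg wbl i).eval (node τ (4 * n) i) =
        cellTarget n w wreg i (node τ (4 * n) i)
          + (cellCorrection n τ wbl i).eval (node τ (4 * n) i) ∧
      (specialPoly p n τ w wreg wbl i).derivative.eval (node τ (4 * n) i) =
        D 1 (cellTarget n w wreg i) (node τ (4 * n) i)
          + (cellCorrection n τ wbl i).derivative.eval (node τ (4 * n) i) := by
  have h := isLocalInterp_cellTarget hp hn h0 h1 hw hreg hi
  rw [specialPoly, derivative_add, eval_add, eval_add, h.value, h.slope]
  exact ⟨rfl, rfl⟩

theorem eval_specialPoly_right (hp : 3 ≤ p) (hn : 0 < n) (h0 : 0 < τ) (h1 : τ ≤ 1 / 4)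
    (hw : DiffUpTo 3 w) (hreg : DiffUpTo 3 wreg) {i : ℕ} (hi : i < 4 * n) :
    (specialPoly p n τ w wreg wbl i).eval (node τ (4 * n) (i + 1)) =
        cellTarget n w wreg i (node τ (4 * n) (i + 1))
          + (cellCorrection n τ wbl i).eval (node τ (4 * n) (i + 1)) ∧
      (specialPoly p n τ w wreg wbl i).derivative.eval (node τ (4 * n) (i + 1)) =
        D 1 (cellTarget n w wreg i) (node τ (4 * n) (i + 1))
          + (cellCorrection n τ wbl i).derivative.eval (node τ (4 * n) (i + 1)) := by
  have hx := isMesh_node hn h0 h1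
  have h := (isLocalInterp_cellTarget hp hn h0 h1 hw hreg hi).right hp
    (diffUpTo_cellTarget hw hreg i) (hx.lt i hi) (hx.cell_subset hi)
  rw [specialPoly, derivative_add, eval_add, eval_add, h.1, h.2]
  exact ⟨rfl, rfl⟩

/-- Only the two transition points matter, as elsewhere neighbouring cells share target and
correction. There the cubics subtract exactly the value and slope of the layer, leaving those of
`wreg`. Reflection by `1 - X` reverses slopes, whence the opposite sign of the `chi₀` term on the
right. -/
theorem specialPoly_glue (hp : 3 ≤ p) (hn : 0 < n) (h0 : 0 < τ) (h1 : τ ≤ 1 / 4)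
    (hw : DiffUpTo 3 w) (hreg : DiffUpTo 3 wreg)
    (hsum : ∀ t ∈ Icc (0 : ℝ) 1, w t = wreg t + wbl t ∧ D 1 w t = D 1 wreg t + D 1 wbl t)
    {i : ℕ} (hi : i + 1 < 4 * n) :
    (specialPoly p n τ w wreg wbl i).eval (node τ (4 * n) (i + 1)) =
        (specialPoly p n τ w wreg wbl (i + 1)).eval (node τ (4 * n) (i + 1)) ∧
      (specialPoly p n τ w wreg wbl i).derivative.eval (node τ (4 * n) (i + 1)) =
        (specialPoly p n τ w wreg wbl (i + 1)).derivative.eval (node τ (4 * n) (i + 1)) := by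
  obtain ⟨l1, l2⟩ := eval_specialPoly_left (wbl := wbl) hp hn h0 h1 hw hreg hi
  obtain ⟨r1, r2⟩ := eval_specialPoly_right (wbl := wbl) hp hn h0 h1 hw hreg
    (show i < 4 * n by omega)
  obtain ⟨-, -, -, x00, x01⟩ := chi₀_spec h0.ne'
  obtain ⟨-, -, -, x11, x10⟩ := chi₁_spec h0.ne'
  rw [l1, l2, r1, r2]
  by_cases e1 : i + 1 = n
  · rw [e1, node_transition hn]
    unfold cellTarget cellCorrection
    rw [if_neg (by omega), if_pos (by omega), if_pos (by omega), if_neg (by omega),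
      if_pos (by omega)]
    obtain ⟨s1, s2⟩ := hsum τ ⟨h0.le, by linarith⟩
    simp only [eval_sub, eval_neg, eval_mul, eval_C, derivative_sub, derivative_neg,
      derivative_C_mul, x00, x01, x11, x10, derivative_zero, eval_zero]
    rw [s1, s2]
    constructor <;> ring
  by_cases e3 : i + 1 = 3 * n
  · rw [e3, node_transition' hn]
    unfold cellTarget cellCorrection
    rw [if_pos (by omega), if_neg (by omega), if_pos (by omega), if_neg (by omega),
      if_neg (by omega), if_neg (by omega)]
    obtain ⟨s1, s2⟩ := hsum (1 - τ) ⟨by linarith, by linarith⟩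
    simp only [eval_sub, eval_mul, eval_C, derivative_sub, derivative_comp, derivative_one,
      derivative_X, eval_comp, eval_one, eval_X, sub_sub_cancel,
      derivative_C_mul, x00, x01, x11, x10, derivative_zero, eval_zero]
    rw [s1, s2]
    constructor <;> ring
  · have t1 : cellTarget n w wreg i = cellTarget n w wreg (i + 1) := by
      unfold cellTarget
      exact if_congr (by omega) rfl rfl
    have t2 : cellCorrection n τ wbl i = cellCorrection n τ wbl (i + 1) := by
      unfold cellCorrection
      exact if_congr (by omega) rfl (if_congr (by omega) rfl rfl)
    rw [t1, t2]
    exact ⟨rfl, rfl⟩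

theorem isSpline_special (hp : 3 ≤ p) (hn : 0 < n) (h0 : 0 < τ) (h1 : τ ≤ 1 / 4)
    (hw : DiffUpTo 3 w) (hreg : DiffUpTo 3 wreg)
    (hsum : ∀ t ∈ Icc (0 : ℝ) 1, w t = wreg t + wbl t ∧ D 1 w t = D 1 wreg t + D 1 wbl t) :
    IsSpline p 1 (node τ (4 * n)) (4 * n)
        (special p (node τ (4 * n)) (4 * n) τ w wreg wbl) ∧
      IsPiecewise (node τ (4 * n)) (4 * n)
        (special p (node τ (4 * n)) (4 * n) τ w wreg wbl) (specialPoly p n τ w wreg wbl) := by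
  have hx := isMesh_node hn h0 h1
  have hcell : ∀ i < 4 * n, ∀ t ∈ Icc (node τ (4 * n) i) (node τ (4 * n) (i + 1)),
      special p (node τ (4 * n)) (4 * n) τ w wreg wbl t =
        (specialPoly p n τ w wreg wbl i).eval t := by
    intro i hi t ht
    -- Except on the last cell, `special` evaluates the right end point with the next polynomial, so
    -- the gluing identity is needed there.
    rcases ht.2.lt_or_eq with h | h
    · exact special_eq_eval hn h0 h1 hi ht.1 (.inl h)
    · by_cases he : i + 1 = 4 * n
      · exact special_eq_eval hn h0 h1 hi ht.1 (.inr he)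
      · have hi' : i + 1 < 4 * n := by omega
        rw [h, (specialPoly_glue hp hn h0 h1 hw hreg hsum hi').1]
        exact special_eq_eval hn h0 h1 hi' le_rfl (.inl (hx.lt _ hi'))
  have hs := isSpline_of_glue hx
    (fun i hi => natDegree_specialPoly_le hp h0 (wbl := wbl)
      (isLocalInterp_cellTarget hp hn h0 h1 hw hreg hi)) hcell
    (fun i hi => (specialPoly_glue hp hn h0 h1 hw hreg hsum hi).2)
  exact ⟨hs, hs.isPiecewise hx fun i hi t ht => hcell i hi t (Ioo_subset_Icc_self ht)⟩

/-- The special representatives inherit the homogeneous boundary conditions. -/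
theorem clamped_special (hp : 3 ≤ p) (hn : 0 < n) (h0 : 0 < τ) (h1 : τ ≤ 1 / 4)
    (hw : DiffUpTo 3 w) (hreg : DiffUpTo 3 wreg)
    (hsum : ∀ t ∈ Icc (0 : ℝ) 1, w t = wreg t + wbl t ∧ D 1 w t = D 1 wreg t + D 1 wbl t)
    (hcl : Clamped w) :
    Clamped (special p (node τ (4 * n)) (4 * n) τ w wreg wbl) := by
  have hx := isMesh_node hn h0 h1
  obtain ⟨-, hP⟩ := isSpline_special hp hn h0 h1 hw hreg hsum
  obtain ⟨-, x01, x02, -, -⟩ := chi₀_spec h0.ne'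
  obtain ⟨-, x11, x12, -, -⟩ := chi₁_spec h0.ne'
  have hN : 4 * n - 1 + 1 = 4 * n := by omega
  obtain ⟨l1, l2⟩ := eval_specialPoly_left (wbl := wbl) hp hn h0 h1 hw hreg
    (show 0 < 4 * n by omega)
  obtain ⟨r1, r2⟩ := eval_specialPoly_right (wbl := wbl) hp hn h0 h1 hw hreg
    (show 4 * n - 1 < 4 * n by omega)
  have v0 := hP.value 0 (by omega) _ (left_mem_Icc.2 (hx.lt 0 (by omega)).le)
  have s0 := hP.slope 0 (by omega) _ (left_mem_Icc.2 (hx.lt 0 (by omega)).le)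
  have v1 := hP.value (4 * n - 1) (by omega) _ (right_mem_Icc.2 (hx.lt _ (by omega)).le)
  have s1 := hP.slope (4 * n - 1) (by omega) _ (right_mem_Icc.2 (hx.lt _ (by omega)).le)
  rw [l1, hx.first] at v0
  rw [l2, hx.first] at s0
  rw [r1, hN, hx.last] at v1
  rw [r2, hN, hx.last] at s1
  have t0 : cellTarget n w wreg 0 = w := if_neg (by omega)
  have t1 : cellTarget n w wreg (4 * n - 1) = w := if_neg (by omega)
  have c0 : cellCorrection n τ wbl 0 = -(C (D 1 wbl τ) * chi₀ τ) - C (wbl τ) * chi₁ τ :=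
    if_pos hn
  have c1 : cellCorrection n τ wbl (4 * n - 1) =
      C (D 1 wbl (1 - τ)) * (chi₀ τ).comp (1 - X) - C (wbl (1 - τ)) * (chi₁ τ).comp (1 - X) := by
    rw [cellCorrection, if_neg (by omega), if_neg (by omega)]
  rw [t0, c0] at v0 s0
  rw [t1, c1] at v1 s1
  simp only [eval_sub, eval_neg, eval_mul, eval_C, derivative_sub, derivative_neg,
    derivative_C_mul, derivative_comp, derivative_one, derivative_X, eval_comp, eval_one, eval_X,
    sub_self, x01, x02, x11, x12, mul_zero, neg_zero, add_zero] at v0 s0 v1 s1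
  exact ⟨v0.trans hcl.value_zero, s0.trans hcl.slope_zero, v1.trans hcl.value_one,
    s1.trans hcl.slope_one⟩

end Special

/-! ### Boundary layers -/

/-- The common majorant of the two boundary layers. -/
noncomputable def layer (ε t : ℝ) : ℝ := Real.exp (-t / ε) + Real.exp (-(1 - t) / ε)

theorem layer_pos (ε t : ℝ) : 0 < layer ε t := by unfold layer; positivity

theorem layer_symm (ε t : ℝ) : layer ε (1 - t) = layer ε t := by
  rw [layer, layer, sub_sub_cancel, add_comm]

theorem continuous_layer (ε : ℝ) : Continuous (layer ε) := by unfold layer; fun_prop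

/-- Fine cells have length at most 4σε, so the layer varies on them by a bounded factor only. This
turns a supremum over a cell into a pointwise bound that can be integrated. -/
theorem layer_le_of_abs_sub_le {ε κ t t' : ℝ} (hε : 0 < ε) (h : |t - t'| ≤ κ * ε) :
    layer ε t' ≤ Real.exp κ * layer ε t := by
  obtain ⟨h1, h2⟩ := abs_le.1 h
  rw [layer, layer, mul_add, ← Real.exp_add, ← Real.exp_add]
  have e : κ = κ * ε / ε := by field_simp
  refine add_le_add (Real.exp_le_exp.2 ?_) (Real.exp_le_exp.2 ?_)
  · rw [e, ← add_div]
    gcongr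
    linarith
  · rw [e, ← add_div]
    gcongr
    linarith

theorem layer_le_of_le {ε τ : ℝ} (hε : 0 < ε) (h : τ ≤ 1 / 4) :
    layer ε τ ≤ 2 * Real.exp (-τ / ε) := by
  rw [layer, two_mul]
  gcongr
  linarith

/-- By (a + b)² ≤ 2(a² + b²) the two exponentials can be integrated separately. It is used with `c =
0` for interpolation errors and with `c = τ` for the layers on the coarse part. -/
theorem integral_layer_sq_le {ε c : ℝ} (hε : 0 < ε) (hc : c ≤ 1 / 2) :
    ∫ t in c..(1 - c), layer ε t ^ 2 ≤ 2 * ε * Real.exp (-c / ε) ^ 2 := by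
  let g : ℝ → ℝ := fun t => 2 * (Real.exp (-2 * t / ε) + Real.exp (-2 * (1 - t) / ε))
  have hg : Continuous g := by fun_prop
  have h1 : ∫ t in c..(1 - c), layer ε t ^ 2 ≤ ∫ t in c..(1 - c), g t := by
    refine intervalIntegral.integral_mono_on (by linarith)
      (((continuous_layer ε).pow 2).intervalIntegrable _ _) (hg.intervalIntegrable _ _)
      fun t _ => ?_
    have e1 : Real.exp (-2 * t / ε) = Real.exp (-t / ε) ^ 2 := by
      rw [← Real.exp_nat_mul]; congr 1; push_cast; ring
    have e2 : Real.exp (-2 * (1 - t) / ε) = Real.exp (-(1 - t) / ε) ^ 2 := by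
      rw [← Real.exp_nat_mul]; congr 1; push_cast; ring
    simp only [g, e1, e2, layer]
    nlinarith [sq_nonneg (Real.exp (-t / ε) - Real.exp (-(1 - t) / ε))]
  have h2 := intervalIntegral.integral_eq_sub_of_hasDerivAt (a := c) (b := 1 - c)
    (f := fun t => ε * (Real.exp (-2 * (1 - t) / ε) - Real.exp (-2 * t / ε))) (f' := g)
    (fun t _ => by
      have d1 : HasDerivAt (fun t : ℝ => -2 * (1 - t) / ε) (2 / ε) t := by
        have := (((hasDerivAt_id t).const_sub 1).const_mul (-2)).div_const ε
        simpa using this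
      have d2 : HasDerivAt (fun t : ℝ => -2 * t / ε) (-2 / ε) t := by
        have := ((hasDerivAt_id t).const_mul (-2)).div_const ε
        simpa using this
      convert! (d1.exp.sub d2.exp).const_mul ε using 1
      simp only [g]
      field_simp
      ring) (hg.intervalIntegrable _ _)
  refine h1.trans (h2.trans_le ?_)
  have e1 : Real.exp (-2 * c / ε) = Real.exp (-c / ε) ^ 2 := by
    rw [← Real.exp_nat_mul]; congr 1; push_cast; ring
  simp only [sub_sub_cancel, e1]
  have := Real.exp_pos (-2 * (1 - c) / ε)
  nlinarith

/-! ### Components of the solution -/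

/-- A function `w = wreg + wbl` with a regular component and a boundary layer component. -/
structure Component (p : ℕ) (B B' ε : ℝ) (w wreg wbl : ℝ → ℝ) : Prop where
  diff : DiffUpTo (p + 1) w
  diff_reg : DiffUpTo (p + 1) wreg
  sum : ∀ k ≤ p + 1, ∀ t ∈ Icc (0 : ℝ) 1, D k w t = D k wreg t + D k wbl t
  bound_reg : ∀ t ∈ Icc (0 : ℝ) 1, |D (p + 1) wreg t| ≤ B'
  bound_bl : ∀ k ≤ p + 1, ∀ t ∈ Icc (0 : ℝ) 1, |D k wbl t| ≤ B * ((ε ^ k)⁻¹ * layer ε t)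

/-- The parameters of the problem and of the Shishkin mesh. -/
structure MeshParameters (p n : ℕ) (σ ε τ : ℝ) : Prop where
  three_le : 3 ≤ p
  n_pos : 0 < n
  le_sigma : (p : ℝ) + 1 ≤ σ
  eps_pos : 0 < ε
  eps_le_one : ε ≤ 1
  tau_eq : τ = σ * ε * Real.log (4 * n : ℕ)
  tau_le : τ ≤ 1 / 4

namespace MeshParameters

variable {p n : ℕ} {σ ε τ : ℝ} (h : MeshParameters p n σ ε τ)
include h

theorem one_le_log : 1 ≤ Real.log (4 * n : ℕ) := by
  have hn : (1 : ℝ) ≤ n := by exact_mod_cast h.n_pos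
  rw [Real.le_log_iff_exp_le (by push_cast; linarith)]
  push_cast
  linarith [Real.exp_one_lt_three]

theorem one_le_sigma : 1 ≤ σ := by
  have := h.le_sigma
  have : (0 : ℝ) ≤ p := by positivity
  linarith

theorem tau_pos : 0 < τ := by
  rw [h.tau_eq]
  exact mul_pos (mul_pos (by linarith [h.one_le_sigma]) h.eps_pos) (by linarith [h.one_le_log])

theorem eps_le_tau : ε ≤ τ := by
  rw [h.tau_eq]
  have := mul_le_mul h.one_le_sigma h.one_le_log zero_le_one (by linarith [h.one_le_sigma])
  nlinarith [h.eps_pos]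

theorem isMesh : IsMesh (node τ (4 * n)) (4 * n) := isMesh_node h.n_pos h.tau_pos h.tau_le

theorem fine_length : τ / n = ε * (4 * σ * (Real.log (4 * n : ℕ) / (4 * n : ℕ))) := by
  have : (n : ℝ) ≠ 0 := by have := h.n_pos; positivity
  rw [h.tau_eq]
  push_cast
  field_simp

theorem fine_length_le : τ / n ≤ 4 * σ * ε := by
  have hn := h.n_pos
  have h1 : Real.log (4 * n : ℕ) / (4 * n : ℕ) ≤ 1 :=
    div_le_one_of_le₀ (Real.log_le_self (by positivity)) (by positivity)
  rw [h.fine_length]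
  have := mul_le_mul_of_nonneg_left h1
    (mul_nonneg h.eps_pos.le (by linarith [h.one_le_sigma] : 0 ≤ 4 * σ))
  linarith

theorem node_sub_of_fine {i : ℕ} (hi : i < n ∨ 3 * n ≤ i) :
    node τ (4 * n) (i + 1) - node τ (4 * n) i = τ / n :=
  hi.elim (node_sub_of_lt h.n_pos) (node_sub_of_ge h.n_pos)

end MeshParameters

theorem eval_chi_bounds {τ y : ℝ} (hτ : 0 < τ) (hy : y ∈ Icc 0 τ) :
    |(chi₀ τ).eval y| ≤ τ ∧ |(chi₁ τ).eval y| ≤ 3 ∧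
      |(chi₀ τ).derivative.derivative.eval y| ≤ 6 / τ ∧
      |(chi₁ τ).derivative.derivative.eval y| ≤ 6 / τ ^ 2 := by
  obtain ⟨z, rfl⟩ : ∃ z, y = τ * z := ⟨y / τ, by field_simp⟩
  have hz0 : 0 ≤ z := by by_contra hz; nlinarith [hy.1]
  have hz1 : z ≤ 1 := by by_contra hz; nlinarith [hy.2]
  have hz2 : z ^ 2 ≤ 1 := by nlinarith
  have e1 : (chi₀ τ).eval (τ * z) = τ * (z ^ 2 * (z - 1)) := by
    simp [chi₀]; field_simp
  have e2 : (chi₁ τ).eval (τ * z) = z ^ 2 * (3 - 2 * z) := by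
    simp [chi₁]; field_simp
  have e3 : (chi₀ τ).derivative.derivative.eval (τ * z) = (6 * z - 2) / τ := by
    simp [chi₀]; field_simp; ring
  have e4 : (chi₁ τ).derivative.derivative.eval (τ * z) = (6 - 12 * z) / τ ^ 2 := by
    simp [chi₁]; field_simp; ring
  rw [e1, e2, e3, e4, abs_mul, abs_of_pos hτ, abs_div, abs_div, abs_of_pos hτ,
    abs_of_pos (pow_pos hτ 2)]
  refine ⟨?_, ?_, ?_, ?_⟩
  · refine mul_le_of_le_one_right hτ.le (abs_le.2 ⟨?_, ?_⟩) <;> nlinarith [sq_nonneg z]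
  · rw [abs_le]; constructor <;> nlinarith [sq_nonneg z]
  · gcongr; rw [abs_le]; constructor <;> linarith
  · gcongr; rw [abs_le]; constructor <;> linarith

section Bounds

variable {p n : ℕ} {σ ε τ B B' : ℝ} {w wreg wbl : ℝ → ℝ}

/-- The cubic corrections are small on the fine part of the mesh. -/
theorem Component.cellCorrection_le (hw : Component p B B' ε w wreg wbl)
    (h : MeshParameters p n σ ε τ) (hB : 0 ≤ B) {i : ℕ} (hi : i < 4 * n)
    (hif : i < n ∨ 3 * n ≤ i) {t : ℝ}
    (ht : t ∈ Icc (node τ (4 * n) i) (node τ (4 * n) (i + 1))) :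
    |(cellCorrection n τ wbl i).eval t| ≤
        B * ((σ + 12) * Real.log (4 * n : ℕ) * (2 * Real.exp (-τ / ε))) ∧
      |(cellCorrection n τ wbl i).derivative.derivative.eval t| ≤
        B * ((σ + 12) * Real.log (4 * n : ℕ) * (2 * Real.exp (-τ / ε))) * (ε ^ 2)⁻¹ := by
  have hε := h.eps_pos
  have hτ := h.tau_pos
  have hL := h.one_le_log
  have hσ := h.one_le_sigma
  have hx := h.isMesh
  set η := 2 * Real.exp (-τ / ε) with hη
  set L := Real.log (4 * n : ℕ) with hLdef
  have hη0 : 0 < η := by positivity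
  have hτ1 : τ ∈ Icc (0 : ℝ) 1 := ⟨hτ.le, by linarith [h.tau_le]⟩
  have hτ1' : 1 - τ ∈ Icc (0 : ℝ) 1 := ⟨by linarith [h.tau_le], by linarith⟩
  have hlay : layer ε τ ≤ η := layer_le_of_le hε h.tau_le
  -- Stated for abstract coefficients so that the reflection y = 1 - t covers the right end as well.
  -- In `σ + 12`, the σ arises from τ/ε = σ ln N multiplying the slope term, and 12 = 6 + 6 from the
  -- second derivatives of the two cubics.
  have key : ∀ c d : ℝ, |c| ≤ B * (ε⁻¹ * layer ε τ) → |d| ≤ B * layer ε τ → ∀ y ∈ Icc 0 τ,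
      |c * (chi₀ τ).eval y| + |d * (chi₁ τ).eval y| ≤ B * ((σ + 12) * L * η) ∧
      |c * (chi₀ τ).derivative.derivative.eval y| + |d * (chi₁ τ).derivative.derivative.eval y| ≤
        B * ((σ + 12) * L * η) * (ε ^ 2)⁻¹ := by
    intro c d hc hd y hy
    have hc' : |c| ≤ B * (ε⁻¹ * η) := hc.trans (by gcongr)
    have hd' : |d| ≤ B * η := hd.trans (by gcongr)
    obtain ⟨b1, b2, b3, b4⟩ := eval_chi_bounds hτ hy
    simp only [abs_mul]
    constructor
    · calc _ ≤ B * (ε⁻¹ * η) * τ + B * η * 3 := by gcongr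
        _ = B * η * (σ * L + 3) := by rw [h.tau_eq, ← hLdef]; field_simp
        _ ≤ B * η * ((σ + 12) * L) := by gcongr; nlinarith
        _ = _ := by ring
    · have h1 : 6 / τ ≤ 6 * ε⁻¹ := by
        rw [div_eq_mul_inv]; gcongr; exact h.eps_le_tau
      have h2 : 6 / τ ^ 2 ≤ 6 * (ε ^ 2)⁻¹ := by
        rw [div_eq_mul_inv]; gcongr; exact h.eps_le_tau
      calc _ ≤ B * (ε⁻¹ * η) * (6 * ε⁻¹) + B * η * (6 * (ε ^ 2)⁻¹) := by
            gcongr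
            · exact b3.trans h1
            · exact b4.trans h2
        _ = B * η * 12 * (ε ^ 2)⁻¹ := by field_simp; ring
        _ ≤ B * η * ((σ + 12) * L) * (ε ^ 2)⁻¹ := by gcongr; nlinarith
        _ = _ := by ring
  have hb0 := hw.bound_bl 0 (by omega)
  have hb1 := hw.bound_bl 1 (by omega)
  simp only [D_zero, pow_zero, inv_one, one_mul, pow_one] at hb0 hb1
  rcases hif with hif | hif
  · have hy : t ∈ Icc 0 τ := by
      have h1 := hx.nonneg hi.le
      have h2 := hx.mono (show i + 1 ≤ n from hif) (by omega)
      rw [node_transition h.n_pos] at h2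
      exact ⟨h1.trans ht.1, ht.2.trans h2⟩
    obtain ⟨k1, k2⟩ := key _ _ (hb1 τ hτ1) (hb0 τ hτ1) t hy
    rw [cellCorrection, if_pos hif]
    simp only [eval_sub, eval_neg, eval_mul, eval_C, derivative_sub, derivative_neg,
      derivative_C_mul]
    refine ⟨(abs_sub _ _).trans ?_, (abs_sub _ _).trans ?_⟩ <;> rwa [abs_neg]
  · have hy : 1 - t ∈ Icc 0 τ := by
      have h1 := hx.mono hif hi.le
      have h2 := hx.le_one (show i + 1 ≤ 4 * n from hi)
      rw [node_transition' h.n_pos] at h1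
      exact ⟨by linarith [ht.2], by linarith [ht.1]⟩
    have h1 := hb1 _ hτ1'
    have h0 := hb0 _ hτ1'
    rw [layer_symm] at h1 h0
    obtain ⟨k1, k2⟩ := key _ _ h1 h0 (1 - t) hy
    have hn := h.n_pos
    rw [cellCorrection, if_neg (by omega), if_neg (by omega)]
    have hcomp : ∀ q : ℝ[X], (q.comp (1 - X)).derivative.derivative =
        q.derivative.derivative.comp (1 - X) := fun q => by simp [derivative_comp]
    simp only [eval_sub, eval_mul, eval_C, derivative_sub, derivative_C_mul, hcomp, eval_comp,
      eval_one, eval_X]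
    exact ⟨(abs_sub _ _).trans k1, (abs_sub _ _).trans k2⟩

/-- The interpolation error on the fine part of the mesh. -/
theorem Component.interp_le_of_fine (hw : Component p B B' ε w wreg wbl)
    (h : MeshParameters p n σ ε τ) (hB : 0 < B) (hBB : B' ≤ B) {i : ℕ} (hi : i < 4 * n)
    (hif : i < n ∨ 3 * n ≤ i) {P : ℝ[X]}
    (hP : IsLocalInterp p (node τ (4 * n) i) (node τ (4 * n) (i + 1)) w P) {t : ℝ}
    (ht : t ∈ Icc (node τ (4 * n) i) (node τ (4 * n) (i + 1))) :
    |P.eval t - w t| ≤ B * (Real.exp (4 * σ) *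
      (4 * σ * (Real.log (4 * n : ℕ) / (4 * n : ℕ))) ^ (p + 1) *
        (Real.sqrt ε + layer ε t)) := by
  have hx := h.isMesh
  have hε := h.eps_pos
  have hlen := h.node_sub_of_fine hif
  have hl := layer_pos ε t
  have hσ := h.one_le_sigma
  -- The derivative bound over the whole cell is expressed through the layer at the fixed point `t`.
  -- The factor ε in the cell length then cancels the negative powers of `ε` in it.
  have := hP.abs_sub_le h.three_le hw.diff (hx.lt i hi) (hx.cell_subset hi)
    (S := B * (1 + (ε ^ (p + 1))⁻¹ * (Real.exp (4 * σ) * layer ε t))) (by positivity)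
    (fun t' ht' => by
      have hmem := hx.cell_subset hi ht'
      have hlay : layer ε t' ≤ Real.exp (4 * σ) * layer ε t := by
        refine layer_le_of_abs_sub_le hε (le_trans ?_ h.fine_length_le)
        rw [← hlen, abs_le]
        exact ⟨by linarith [ht.1, ht'.2], by linarith [ht.2, ht'.1]⟩
      rw [hw.sum _ le_rfl _ hmem]
      calc _ ≤ B' + B * ((ε ^ (p + 1))⁻¹ * layer ε t') :=
            (abs_add_le _ _).trans (add_le_add (hw.bound_reg _ hmem) (hw.bound_bl _ le_rfl _ hmem))
        _ ≤ B + B * ((ε ^ (p + 1))⁻¹ * (Real.exp (4 * σ) * layer ε t)) := by gcongr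
        _ = _ := by ring) t ht
  rw [hlen, h.fine_length, mul_pow] at this
  refine this.trans ?_
  have hg : 0 ≤ (4 * σ * (Real.log (4 * n : ℕ) / (4 * n : ℕ))) ^ (p + 1) := by
    have := h.one_le_log
    positivity
  generalize (4 * σ * (Real.log (4 * n : ℕ) / (4 * n : ℕ))) ^ (p + 1) = g at *
  -- Of the many powers of `ε` gained by the regular part only √ε is kept: it offsets the weight
  -- ε^{-1/2} applied later.
  have h1 : ε ^ (p + 1) ≤ Real.exp (4 * σ) * Real.sqrt ε := by
    have h2 : ε ^ (p + 1) ≤ ε ^ 1 := pow_le_pow_of_le_one hε.le h.eps_le_one (by omega)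
    have h3 : ε ≤ Real.sqrt ε := Real.le_sqrt_of_sq_le (by nlinarith [h.eps_le_one])
    have h4 : 1 ≤ Real.exp (4 * σ) := Real.one_le_exp (by linarith)
    nlinarith [Real.sqrt_nonneg ε]
  calc _ = B * (g * (ε ^ (p + 1) + Real.exp (4 * σ) * layer ε t)) := by
        field_simp
    _ ≤ B * (g * (Real.exp (4 * σ) * Real.sqrt ε + Real.exp (4 * σ) * layer ε t)) := by
        gcongr
    _ = _ := by ring

/-- The interpolation error on the coarse part of the mesh. -/
theorem Component.interp_le_of_coarse (hw : Component p B B' ε w wreg wbl)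
    (h : MeshParameters p n σ ε τ) (hB' : 0 < B') {i : ℕ} (h1 : n ≤ i) (h3 : i < 3 * n)
    {P : ℝ[X]} (hP : IsLocalInterp p (node τ (4 * n) i) (node τ (4 * n) (i + 1)) wreg P) {t : ℝ}
    (ht : t ∈ Icc (node τ (4 * n) i) (node τ (4 * n) (i + 1))) :
    |P.eval t - wreg t| ≤ B' * (2 / (4 * n : ℕ)) ^ (p + 1) := by
  have hx := h.isMesh
  have hi : i < 4 * n := by omega
  have hn : (0 : ℝ) < n := by exact_mod_cast h.n_pos
  refine (hP.abs_sub_le h.three_le hw.diff_reg (hx.lt i hi) (hx.cell_subset hi) hB'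
    (fun t' ht' => hw.bound_reg t' (hx.cell_subset hi ht')) t ht).trans ?_
  rw [node_sub_of_mem h.n_pos h1 h3]
  have : (2 : ℝ) / (4 * n : ℕ) = 1 / (2 * n) := by push_cast; field_simp; norm_num
  rw [this]
  gcongr
  · exact div_nonneg (by linarith [h.tau_le]) (by positivity)
  · linarith [h.tau_pos]

end Bounds

/-! ### The consistency error -/

/-- The interpolation error on the `i`-th cell. -/
noncomputable def interpErr (p n : ℕ) (τ : ℝ) (w wreg : ℝ → ℝ) (i : ℕ) (t : ℝ) : ℝ :=
  (localInterp p (node τ (4 * n) i) (node τ (4 * n) (i + 1)) (cellTarget n w wreg i)).eval t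
    - cellTarget n w wreg i t

/-- The second derivative of the interpolation error on the `i`-th cell. -/
noncomputable def interpErr₂ (p n : ℕ) (τ : ℝ) (w wreg : ℝ → ℝ) (i : ℕ) (t : ℝ) : ℝ :=
  (localInterp p (node τ (4 * n) i) (node τ (4 * n) (i + 1))
    (cellTarget n w wreg i)).derivative.derivative.eval t - D 2 (cellTarget n w wreg i) t

/-- The remaining part of the error on the `i`-th cell. -/
noncomputable def corrErr (n : ℕ) (τ : ℝ) (w wreg wbl : ℝ → ℝ) (i : ℕ) (t : ℝ) : ℝ :=
  (cellCorrection n τ wbl i).eval t + (cellTarget n w wreg i t - w t)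

/-- The second derivative of the remaining part of the error on the `i`-th cell. -/
noncomputable def corrErr₂ (n : ℕ) (τ : ℝ) (w wreg wbl : ℝ → ℝ) (i : ℕ) (t : ℝ) : ℝ :=
  (cellCorrection n τ wbl i).derivative.derivative.eval t
    + (D 2 (cellTarget n w wreg i) t - D 2 w t)

/-- Balanced scaling: if second derivatives cost ε^{-2} and the second component is larger by
ε^{-1/2}, each of the four correction terms is at most ε⁻¹κ². -/
theorem errorDensity_le {lam ε μ θ θv κ : ℝ} (hε : 0 < ε) {au av cu cu2 cv cv2 : ℝ → ℝ} {t : ℝ}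
    (h1 : |au t| ≤ θ) (h2 : |av t| ≤ θv) (h3 : |cu t| ≤ κ) (h4 : |cu2 t| ≤ κ * (ε ^ 2)⁻¹)
    (h5 : |cv t| ≤ (Real.sqrt ε)⁻¹ * κ) (h6 : |cv2 t| ≤ (Real.sqrt ε)⁻¹ * κ * (ε ^ 2)⁻¹) :
    errorDensity lam ε μ au av cu cu2 cv cv2 t ≤
      θv ^ 2 + (1 + (lam - 4) ^ 2 * μ ^ 2) * θ ^ 2 + 4 * (ε⁻¹ * κ ^ 2) := by
  have sq : ∀ {a b : ℝ}, |a| ≤ b → a ^ 2 ≤ b ^ 2 := fun h => sq_le_sq' (abs_le.1 h).1 (abs_le.1 h).2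
  have hs : Real.sqrt ε ≠ 0 := (Real.sqrt_pos.2 hε).ne'
  have e : ((Real.sqrt ε)⁻¹) ^ 2 = ε⁻¹ := by rw [inv_pow, Real.sq_sqrt hε.le]
  have k1 : (1 + (lam - 4) ^ 2 * μ ^ 2) * au t ^ 2 ≤ (1 + (lam - 4) ^ 2 * μ ^ 2) * θ ^ 2 :=
    mul_le_mul_of_nonneg_left (sq h1) (by positivity)
  have k2 := sq h2
  have k3 : ε⁻¹ * cu t ^ 2 ≤ ε⁻¹ * κ ^ 2 := mul_le_mul_of_nonneg_left (sq h3) (by positivity)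
  have k4 : ε ^ 3 * cu2 t ^ 2 ≤ ε⁻¹ * κ ^ 2 := by
    refine (mul_le_mul_of_nonneg_left (sq h4) (by positivity)).trans_eq ?_
    field_simp
  have k5 : cv t ^ 2 ≤ ε⁻¹ * κ ^ 2 := by
    have := sq h5
    rwa [mul_pow, e] at this
  have k6 : ε ^ 4 * cv2 t ^ 2 ≤ ε⁻¹ * κ ^ 2 := by
    refine (mul_le_mul_of_nonneg_left (sq h6) (by positivity)).trans_eq ?_
    rw [mul_pow, mul_pow, e]
    field_simp
  unfold errorDensity
  linarith

section Consistency

variable {p n : ℕ} {σ ε τ lam B : ℝ} {u ureg ubl v vreg vbl : ℝ → ℝ}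

theorem Component.continuousOn {B B' : ℝ} {w wreg wbl : ℝ → ℝ} (hw : Component p B B' ε w wreg wbl)
    (h : MeshParameters p n σ ε τ) {i : ℕ} (hi : i < 4 * n) :
    ContinuousOn (interpErr p n τ w wreg i) (Icc (node τ (4 * n) i) (node τ (4 * n) (i + 1))) ∧
    ContinuousOn (interpErr₂ p n τ w wreg i) (Icc (node τ (4 * n) i) (node τ (4 * n) (i + 1))) ∧
    ContinuousOn (corrErr n τ w wreg wbl i) (Icc (node τ (4 * n) i) (node τ (4 * n) (i + 1))) ∧
    ContinuousOn (corrErr₂ n τ w wreg wbl i)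
      (Icc (node τ (4 * n) i) (node τ (4 * n) (i + 1))) := by
  have hp := h.three_le
  have hsub := h.isMesh.cell_subset hi
  have ht := diffUpTo_cellTarget (n := n) hw.diff hw.diff_reg i
  have c1 := (ht.continuousOn (k := 0) (by omega)).mono hsub
  have c2 := (ht.continuousOn (k := 2) (by omega)).mono hsub
  have c3 := (hw.diff.continuousOn (k := 0) (by omega)).mono hsub
  have c4 := (hw.diff.continuousOn (k := 2) (by omega)).mono hsub
  rw [D_zero] at c1 c3
  unfold interpErr interpErr₂ corrErr corrErr₂
  refine ⟨?_, ?_, ?_, ?_⟩ <;> fun_prop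

/-- The residual of the special representatives on one cell. -/
theorem residual_cell {B₁ B₂ B₃ B₄ μ K : ℝ} (h : MeshParameters p n σ ε τ)
    (hu : Component p B₁ B₂ ε u ureg ubl) (hv : Component p B₃ B₄ ε v vreg vbl)
    (hvu : ∀ t ∈ Icc (0 : ℝ) 1, v t = ε ^ (3 / 2 : ℝ) * D 2 u t ∧
      D 2 v t = ε ^ (3 / 2 : ℝ) * D 4 u t)
    (hμ : 0 < μ) (hK : 0 < K) {i : ℕ} (hi : i < 4 * n) {E F : ℝ[X]} (hE : E.natDegree ≤ p)
    (hF : F.natDegree ≤ p)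
    (hinv : ε ^ 3 * ∫ t in node τ (4 * n) i..node τ (4 * n) (i + 1),
      F.derivative.derivative.eval t ^ 2 ≤
      K * μ ^ 2 * ∫ t in node τ (4 * n) i..node τ (4 * n) (i + 1), energyDensity ε E F t) :
    ∫ t in node τ (4 * n) i..node τ (4 * n) (i + 1),
        residualDensity lam ε u (specialPoly p n τ u ureg ubl i) (specialPoly p n τ v vreg vbl i)
          E F t ≤
      1 / 2 * (∫ t in node τ (4 * n) i..node τ (4 * n) (i + 1), energyDensity ε E F t) +
        (8 * lam ^ 2 + 1200 + K) * ∫ t in node τ (4 * n) i..node τ (4 * n) (i + 1),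
          errorDensity lam ε μ (interpErr p n τ u ureg i) (interpErr p n τ v vreg i)
            (corrErr n τ u ureg ubl i) (corrErr₂ n τ u ureg ubl i)
            (corrErr n τ v vreg vbl i) (corrErr₂ n τ v vreg vbl i) t := by
  have hx := h.isMesh
  have hp := h.three_le
  have hε := h.eps_pos
  have hlt := hx.lt i hi
  have hsub := hx.cell_subset hi
  obtain ⟨cau, cau2, ccu, ccu2⟩ := hu.continuousOn h hi
  obtain ⟨cav, cav2, ccv, ccv2⟩ := hv.continuousOn h hi
  have hu3 : DiffUpTo 3 u := hu.diff.mono (by omega)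
  have hr3 : DiffUpTo 3 ureg := hu.diff_reg.mono (by omega)
  have hv3 : DiffUpTo 3 v := hv.diff.mono (by omega)
  have hvr3 : DiffUpTo 3 vreg := hv.diff_reg.mono (by omega)
  have Iu := isLocalInterp_cellTarget hp h.n_pos h.tau_pos h.tau_le hu3 hr3 hi
  have Iv := isLocalInterp_cellTarget hp h.n_pos h.tau_pos h.tau_le hv3 hvr3 hi
  have hdeg : ∀ {G : ℝ[X]}, G.natDegree ≤ p → G.derivative.derivative.natDegree + 2 ≤ p := by
    intro G hG
    have h1 := natDegree_derivative_le G
    have h2 := natDegree_derivative_le G.derivative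
    omega
  have key := consistency_cell (lam := lam) hε h.eps_le_one hμ hK hlt.le E F cau cau2 cav cav2 ccu
    ccu2 ccv ccv2 (Iu.orth _ (hdeg hE)) (Iv.orth _ (hdeg hF))
    (Iu.integral_second_mul hp (diffUpTo_cellTarget hu3 hr3 i) hlt hsub F)
    (Iv.integral_second_mul hp (diffUpTo_cellTarget hv3 hvr3 i) hlt hsub E) hinv
  -- The exact pair contributes zero to the first factor because v = ε^{3/2}u'', so subtracting it
  -- exposes the errors a + c.
  refine le_of_eq_of_le (intervalIntegral.integral_congr fun t ht => ?_) key
  rw [uIcc_of_le hlt.le] at ht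
  obtain ⟨e1, e2⟩ := hvu t (hsub ht)
  have e4 : ε ^ 4 = ε ^ (5 / 2 : ℝ) * ε ^ (3 / 2 : ℝ) := by
    rw [← Real.rpow_add hε, ← Real.rpow_natCast]; norm_num
  simp only [residualDensity, interpErr, interpErr₂, corrErr, corrErr₂, specialPoly, eval_add,
    derivative_add]
  rw [e1, e2, e4]
  ring

theorem corrErr_of_fine {w wreg wbl : ℝ → ℝ} {i : ℕ} (hif : i < n ∨ 3 * n ≤ i) (t : ℝ) :
    corrErr n τ w wreg wbl i t = (cellCorrection n τ wbl i).eval t ∧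
      corrErr₂ n τ w wreg wbl i t = (cellCorrection n τ wbl i).derivative.derivative.eval t := by
  rw [corrErr, corrErr₂, cellTarget, if_neg (by omega)]
  simp

/-- There is no cubic here: the remaining error is minus the discarded layer. -/
theorem Component.corrErr_of_coarse {B B' : ℝ} {w wreg wbl : ℝ → ℝ}
    (hw : Component p B B' ε w wreg wbl) {i : ℕ} (h1 : n ≤ i) (h3 : i < 3 * n) (hp : 1 ≤ p) {t : ℝ}
    (ht : t ∈ Icc (0 : ℝ) 1) :
    |corrErr n τ w wreg wbl i t| ≤ B * layer ε t ∧
      |corrErr₂ n τ w wreg wbl i t| ≤ B * layer ε t * (ε ^ 2)⁻¹ := by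
  have s0 := hw.sum 0 (by omega) t ht
  have s2 := hw.sum 2 (by omega) t ht
  have b0 := hw.bound_bl 0 (by omega) t ht
  have b2 := hw.bound_bl 2 (by omega) t ht
  rw [corrErr, corrErr₂, cellTarget, if_pos (⟨h1, h3⟩ : n ≤ i ∧ i < 3 * n), cellCorrection,
    if_neg (by omega), if_pos h3, s2]
  simp only [D_zero, pow_zero, inv_one, one_mul] at s0 b0
  rw [s0]
  simp only [eval_zero, derivative_zero, zero_add, sub_add_cancel_left, abs_neg]
  exact ⟨b0, b2.trans_eq (by ring)⟩

/-- The factor of the interpolation error on the fine part of the mesh. -/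
noncomputable def fineFactor (p n : ℕ) (σ : ℝ) : ℝ :=
  Real.exp (4 * σ) * (4 * σ * (Real.log (4 * n : ℕ) / (4 * n : ℕ))) ^ (p + 1)

/-- The factor of the corrections on the fine part of the mesh. -/
noncomputable def corrFactor (n : ℕ) (σ ε τ : ℝ) : ℝ :=
  (σ + 12) * Real.log (4 * n : ℕ) * (2 * Real.exp (-τ / ε))

/-- Both the weight `μ` and the larger layers of `v` cost ε⁻¹ after squaring. Applied to (√ε +
layer)² this gives 1 + ε⁻¹ layer² up to a constant, whose integral is bounded uniformly in `ε`. -/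
theorem errorDensity_le_of_fine (h : MeshParameters p n σ ε τ) (hB : 0 < B)
    (hu : Component p B B ε u ureg ubl)
    (hv : Component p ((Real.sqrt ε)⁻¹ * B) B ε v vreg vbl) {i : ℕ} (hi : i < 4 * n)
    (hif : i < n ∨ 3 * n ≤ i) {t : ℝ}
    (ht : t ∈ Icc (node τ (4 * n) i) (node τ (4 * n) (i + 1))) :
    errorDensity lam ε (Real.sqrt ε)⁻¹ (interpErr p n τ u ureg i) (interpErr p n τ v vreg i)
        (corrErr n τ u ureg ubl i) (corrErr₂ n τ u ureg ubl i)
        (corrErr n τ v vreg vbl i) (corrErr₂ n τ v vreg vbl i) t ≤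
      2 * (2 + (lam - 4) ^ 2) * (B * fineFactor p n σ) ^ 2 * (1 + ε⁻¹ * layer ε t ^ 2) +
        4 * (ε⁻¹ * (B * corrFactor n σ ε τ) ^ 2) := by
  have hε := h.eps_pos
  have hp := h.three_le
  have hs : 0 < Real.sqrt ε := Real.sqrt_pos.2 hε
  have hs1 : 1 ≤ (Real.sqrt ε)⁻¹ := (one_le_inv₀ hs).2 (Real.sqrt_le_one.2 h.eps_le_one)
  have hBv : 0 < (Real.sqrt ε)⁻¹ * B := by positivity
  have e : ((Real.sqrt ε)⁻¹) ^ 2 = ε⁻¹ := by rw [inv_pow, Real.sq_sqrt hε.le]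
  have htar : ∀ w wreg : ℝ → ℝ, cellTarget n w wreg i = w := fun w wreg => if_neg (by omega)
  have Iu := isLocalInterp_cellTarget hp h.n_pos h.tau_pos h.tau_le
    (hu.diff.mono (by omega)) (hu.diff_reg.mono (by omega)) hi
  have Iv := isLocalInterp_cellTarget hp h.n_pos h.tau_pos h.tau_le
    (hv.diff.mono (by omega)) (hv.diff_reg.mono (by omega)) hi
  have a1 : |interpErr p n τ u ureg i t| ≤ B * (fineFactor p n σ * (Real.sqrt ε + layer ε t)) := by
    rw [interpErr]
    simp only [htar] at Iu ⊢
    exact hu.interp_le_of_fine h hB le_rfl hi hif Iu ht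
  have a2 : |interpErr p n τ v vreg i t| ≤
      (Real.sqrt ε)⁻¹ * B * (fineFactor p n σ * (Real.sqrt ε + layer ε t)) := by
    rw [interpErr]
    simp only [htar] at Iv ⊢
    exact hv.interp_le_of_fine h hBv (le_mul_of_one_le_left hB.le hs1) hi hif Iv ht
  obtain ⟨b1, b2⟩ := hu.cellCorrection_le h hB.le hi hif ht
  obtain ⟨b3, b4⟩ := hv.cellCorrection_le h hBv.le hi hif ht
  obtain ⟨c1, c2⟩ := corrErr_of_fine (τ := τ) (w := u) (wreg := ureg) (wbl := ubl) hif t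
  obtain ⟨c3, c4⟩ := corrErr_of_fine (τ := τ) (w := v) (wreg := vreg) (wbl := vbl) hif t
  rw [← c1] at b1
  rw [← c2] at b2
  rw [← c3] at b3
  rw [← c4] at b4
  refine (errorDensity_le hε a1 a2 b1 b2 (b3.trans_eq (mul_assoc _ _ _))
    (b4.trans_eq (by rw [mul_assoc ((Real.sqrt ε)⁻¹)]))).trans ?_
  refine add_le_add ?_ le_rfl
  have hq : (Real.sqrt ε + layer ε t) ^ 2 ≤ 2 * (ε + layer ε t ^ 2) := by
    nlinarith [sq_nonneg (Real.sqrt ε - layer ε t), Real.sq_sqrt hε.le]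
  have hε1 : 1 ≤ ε⁻¹ := (one_le_inv₀ hε).2 h.eps_le_one
  set g := B * fineFactor p n σ with hg
  set y := Real.sqrt ε + layer ε t with hy
  have e1 : ((Real.sqrt ε)⁻¹ * B * (fineFactor p n σ * y)) ^ 2 = ε⁻¹ * (g ^ 2 * y ^ 2) := by
    rw [hg, ← e]; ring
  have e2 : (B * (fineFactor p n σ * y)) ^ 2 = g ^ 2 * y ^ 2 := by rw [hg]; ring
  rw [e1, e2, e]
  have hgy : 0 ≤ g ^ 2 * y ^ 2 := by positivity
  calc ε⁻¹ * (g ^ 2 * y ^ 2) + (1 + (lam - 4) ^ 2 * ε⁻¹) * (g ^ 2 * y ^ 2)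
      ≤ (2 + (lam - 4) ^ 2) * (ε⁻¹ * g ^ 2) * y ^ 2 := by nlinarith
    _ ≤ (2 + (lam - 4) ^ 2) * (ε⁻¹ * g ^ 2) * (2 * (ε + layer ε t ^ 2)) := by gcongr
    _ = 2 * (2 + (lam - 4) ^ 2) * g ^ 2 * (ε⁻¹ * ε + ε⁻¹ * layer ε t ^ 2) := by ring
    _ = _ := by rw [inv_mul_cancel₀ hε.ne']

theorem errorDensity_le_of_coarse (h : MeshParameters p n σ ε τ) (hB : 0 < B) (μ : ℝ)
    (hu : Component p B B ε u ureg ubl)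
    (hv : Component p ((Real.sqrt ε)⁻¹ * B) B ε v vreg vbl) {i : ℕ} (h1 : n ≤ i) (h3 : i < 3 * n)
    {t : ℝ} (ht : t ∈ Icc (node τ (4 * n) i) (node τ (4 * n) (i + 1))) :
    errorDensity lam ε μ (interpErr p n τ u ureg i) (interpErr p n τ v vreg i)
        (corrErr n τ u ureg ubl i) (corrErr₂ n τ u ureg ubl i)
        (corrErr n τ v vreg vbl i) (corrErr₂ n τ v vreg vbl i) t ≤
      (2 + (lam - 4) ^ 2 * μ ^ 2) * (B * (2 / (4 * n : ℕ)) ^ (p + 1)) ^ 2 +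
        4 * B ^ 2 * (ε⁻¹ * layer ε t ^ 2) := by
  have hε := h.eps_pos
  have hp := h.three_le
  have hi : i < 4 * n := by omega
  have hmem := h.isMesh.cell_subset hi ht
  have htar : ∀ w wreg : ℝ → ℝ, cellTarget n w wreg i = wreg := fun w wreg => if_pos ⟨h1, h3⟩
  have Iu := isLocalInterp_cellTarget hp h.n_pos h.tau_pos h.tau_le
    (hu.diff.mono (by omega)) (hu.diff_reg.mono (by omega)) hi
  have Iv := isLocalInterp_cellTarget hp h.n_pos h.tau_pos h.tau_le
    (hv.diff.mono (by omega)) (hv.diff_reg.mono (by omega)) hi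
  have a1 : |interpErr p n τ u ureg i t| ≤ B * (2 / (4 * n : ℕ)) ^ (p + 1) := by
    rw [interpErr]
    simp only [htar] at Iu ⊢
    exact hu.interp_le_of_coarse h hB h1 h3 Iu ht
  have a2 : |interpErr p n τ v vreg i t| ≤ B * (2 / (4 * n : ℕ)) ^ (p + 1) := by
    rw [interpErr]
    simp only [htar] at Iv ⊢
    exact hv.interp_le_of_coarse h hB h1 h3 Iv ht
  obtain ⟨b1, b2⟩ := hu.corrErr_of_coarse (τ := τ) h1 h3 (by omega) hmem
  obtain ⟨b3, b4⟩ := hv.corrErr_of_coarse (τ := τ) h1 h3 (by omega) hmem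
  refine (errorDensity_le hε a1 a2 b1 b2 (b3.trans_eq (mul_assoc _ _ _))
    (b4.trans_eq (by rw [mul_assoc ((Real.sqrt ε)⁻¹)]))).trans_eq ?_
  ring

/-- The weight of the consistency defect on the coarse part of the mesh. -/
noncomputable def coarseWeight (n : ℕ) (ε : ℝ) : ℝ :=
  min (ε ^ (3 / 2 : ℝ) * ((4 * n : ℕ) : ℝ) ^ 2) (ε ^ (-(1 / 2) : ℝ))

theorem coarseWeight_pos (h : MeshParameters p n σ ε τ) : 0 < coarseWeight n ε := by
  have := h.n_pos
  have := h.eps_pos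
  exact lt_min (by positivity) (by positivity)

/-- The energy contains ε⁴(F'')², so no inverse inequality is needed. The constant `K + 1` serves
this case and the genuine inverse inequality alike. -/
theorem inverse_le_of_sqrt {a b K : ℝ} (hε : 0 < ε) (hab : a ≤ b) (hK : 0 ≤ K) (E F : ℝ[X]) :
    ε ^ 3 * ∫ t in a..b, F.derivative.derivative.eval t ^ 2 ≤
      (K + 1) * (Real.sqrt ε)⁻¹ ^ 2 * ∫ t in a..b, energyDensity ε E F t := by
  rw [inv_pow, Real.sq_sqrt hε.le, ← intervalIntegral.integral_const_mul,
    ← intervalIntegral.integral_const_mul]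
  refine intervalIntegral.integral_mono_on hab (Continuous.intervalIntegrable (by fun_prop) _ _)
    (((continuous_energyDensity ε E F).const_mul _).intervalIntegrable _ _) fun t _ => ?_
  have h1 : ε ^ 3 * F.derivative.derivative.eval t ^ 2 ≤ ε⁻¹ * energyDensity ε E F t := by
    have : ε ^ 3 * F.derivative.derivative.eval t ^ 2 =
        ε⁻¹ * (ε ^ 4 * F.derivative.derivative.eval t ^ 2) := by field_simp
    rw [this, energyDensity]
    gcongr
    have : 0 ≤ E.eval t ^ 2 + ε ^ 3 * E.derivative.derivative.eval t ^ 2 + F.eval t ^ 2 := by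
      positivity
    linarith
  have h2 : 0 ≤ ε⁻¹ * energyDensity ε E F t := le_trans (by positivity) h1
  nlinarith

/-- The two candidates of the minimum correspond to two proofs. The one with N² uses that τ ≤ 1/4
keeps coarse cells at least 1/N long. -/
theorem inverse_le_of_coarse {K : ℝ} (h : MeshParameters p n σ ε τ) (hK : 0 < K)
    (hinv : ∀ F : ℝ[X], F.natDegree ≤ p → ∀ a b : ℝ, a < b →
      (b - a) ^ 4 * ∫ t in a..b, F.derivative.derivative.eval t ^ 2 ≤
        K * ∫ t in a..b, F.eval t ^ 2)
    {i : ℕ} (h1 : n ≤ i) (h3 : i < 3 * n) (E : ℝ[X]) {F : ℝ[X]} (hF : F.natDegree ≤ p) :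
    ε ^ 3 * ∫ t in node τ (4 * n) i..node τ (4 * n) (i + 1),
        F.derivative.derivative.eval t ^ 2 ≤
      (K + 1) * coarseWeight n ε ^ 2 *
        ∫ t in node τ (4 * n) i..node τ (4 * n) (i + 1), energyDensity ε E F t := by
  have hε := h.eps_pos
  have hlt := h.isMesh.lt i (by omega)
  have hn : (0 : ℝ) < n := by exact_mod_cast h.n_pos
  rcases min_choice (ε ^ (3 / 2 : ℝ) * ((4 * n : ℕ) : ℝ) ^ 2) (ε ^ (-(1 / 2) : ℝ)) with hm | hm
  · rw [coarseWeight, hm]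
    have h2 := hinv F hF _ _ hlt
    rw [node_sub_of_mem h.n_pos h1 h3] at h2
    set I := ∫ t in node τ (4 * n) i..node τ (4 * n) (i + 1),
      F.derivative.derivative.eval t ^ 2 with hI
    set J := ∫ t in node τ (4 * n) i..node τ (4 * n) (i + 1), F.eval t ^ 2 with hJ
    have hI0 : 0 ≤ I := intervalIntegral.integral_nonneg hlt.le fun _ _ => sq_nonneg _
    have hJ0 : 0 ≤ J := intervalIntegral.integral_nonneg hlt.le fun _ _ => sq_nonneg _
    have hJE : J ≤ ∫ t in node τ (4 * n) i..node τ (4 * n) (i + 1), energyDensity ε E F t := by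
      refine intervalIntegral.integral_mono_on hlt.le
        (Continuous.intervalIntegrable (by fun_prop) _ _)
        ((continuous_energyDensity ε E F).intervalIntegrable _ _) fun t _ => ?_
      have : 0 ≤ E.eval t ^ 2 + ε ^ 3 * E.derivative.derivative.eval t ^ 2 +
        ε ^ 4 * F.derivative.derivative.eval t ^ 2 := by positivity
      rw [energyDensity]
      linarith
    have hlen : 1 / (4 * n : ℝ) ≤ (1 - 2 * τ) / (2 * n) := by
      rw [div_le_div_iff₀ (by positivity) (by positivity)]
      nlinarith [h.tau_le]
    have h4 : (1 / (4 * n : ℝ)) ^ 4 * I ≤ K * J :=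
      (mul_le_mul_of_nonneg_right (pow_le_pow_left₀ (by positivity) hlen 4) hI0).trans h2
    have h5 : I ≤ K * (4 * n) ^ 4 * J := by
      have := mul_le_mul_of_nonneg_left h4 (show (0 : ℝ) ≤ (4 * n) ^ 4 by positivity)
      have e : (4 * n : ℝ) ^ 4 * ((1 / (4 * n)) ^ 4 * I) = I := by field_simp
      rw [e] at this
      linarith
    have e3 : (ε ^ (3 / 2 : ℝ)) ^ 2 = ε ^ 3 := by
      rw [rpow_three_halves hε.le, ← pow_mul]
      calc Real.sqrt ε ^ (3 * 2) = (Real.sqrt ε ^ 2) ^ 3 := by ring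
        _ = _ := by rw [Real.sq_sqrt hε.le]
    calc ε ^ 3 * I ≤ ε ^ 3 * (K * (4 * n) ^ 4 * J) := by gcongr
      _ ≤ ε ^ 3 * ((K + 1) * (4 * n) ^ 4 * J) := by gcongr; linarith
      _ = (K + 1) * (ε ^ (3 / 2 : ℝ) * ((4 * n : ℕ) : ℝ) ^ 2) ^ 2 * J := by
        rw [mul_pow (ε ^ (3 / 2 : ℝ)), e3]; push_cast; ring
      _ ≤ _ := by gcongr
  · rw [coarseWeight, hm, rpow_neg_half hε.le]
    exact inverse_le_of_sqrt hε hlt.le hK.le E F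

end Consistency

/-! ### The error estimate -/

section Estimate

variable {p n : ℕ} {σ ε τ lam B : ℝ} {u ureg ubl v vreg vbl : ℝ → ℝ}

/-- The weight of the consistency defect on the `i`-th cell. -/
noncomputable def cellWeight (n : ℕ) (ε : ℝ) (i : ℕ) : ℝ :=
  if n ≤ i ∧ i < 3 * n then coarseWeight n ε else (Real.sqrt ε)⁻¹

/-- The error density of the special representatives on the `i`-th cell. -/
noncomputable def cellError (p n : ℕ) (lam ε τ : ℝ) (u ureg ubl v vreg vbl : ℝ → ℝ) (i : ℕ) :
    ℝ → ℝ :=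
  errorDensity lam ε (cellWeight n ε i) (interpErr p n τ u ureg i) (interpErr p n τ v vreg i)
    (corrErr n τ u ureg ubl i) (corrErr₂ n τ u ureg ubl i)
    (corrErr n τ v vreg vbl i) (corrErr₂ n τ v vreg vbl i)

theorem sum_residual_le {K : ℝ} (h : MeshParameters p n σ ε τ) (hK : 0 < K)
    (hinv : ∀ F : ℝ[X], F.natDegree ≤ p → ∀ a b : ℝ, a < b →
      (b - a) ^ 4 * ∫ t in a..b, F.derivative.derivative.eval t ^ 2 ≤
        K * ∫ t in a..b, F.eval t ^ 2)
    (hu : Component p B B ε u ureg ubl) (hv : Component p ((Real.sqrt ε)⁻¹ * B) B ε v vreg vbl)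
    (hvu : ∀ t ∈ Icc (0 : ℝ) 1, v t = ε ^ (3 / 2 : ℝ) * D 2 u t ∧
      D 2 v t = ε ^ (3 / 2 : ℝ) * D 4 u t)
    {E F : ℕ → ℝ[X]} (hE : ∀ i < 4 * n, (E i).natDegree ≤ p)
    (hF : ∀ i < 4 * n, (F i).natDegree ≤ p) :
    ∑ i ∈ Finset.range (4 * n), ∫ t in node τ (4 * n) i..node τ (4 * n) (i + 1),
        residualDensity lam ε u (specialPoly p n τ u ureg ubl i) (specialPoly p n τ v vreg vbl i)
          (E i) (F i) t ≤
      1 / 2 * (∑ i ∈ Finset.range (4 * n), ∫ t in node τ (4 * n) i..node τ (4 * n) (i + 1),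
        energyDensity ε (E i) (F i) t) + (8 * lam ^ 2 + 1200 + (K + 1)) *
        ∑ i ∈ Finset.range (4 * n), ∫ t in node τ (4 * n) i..node τ (4 * n) (i + 1),
          cellError p n lam ε τ u ureg ubl v vreg vbl i t := by
  rw [Finset.mul_sum, Finset.mul_sum, ← Finset.sum_add_distrib]
  refine Finset.sum_le_sum fun i hi => ?_
  have hi := Finset.mem_range.1 hi
  have hμ : 0 < cellWeight n ε i := by
    have := coarseWeight_pos h
    have := Real.sqrt_pos.2 h.eps_pos
    unfold cellWeight
    split_ifs <;> positivity
  refine residual_cell h hu hv hvu hμ (by positivity) hi (hE i hi) (hF i hi) ?_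
  unfold cellWeight
  split_ifs with hc
  · exact inverse_le_of_coarse h hK hinv hc.1 hc.2 (E i) (hF i hi)
  · exact inverse_le_of_sqrt h.eps_pos (h.isMesh.lt i hi).le hK.le (E i) (F i)

theorem intervalIntegrable_cellError {B₁ B₂ B₃ B₄ : ℝ} (h : MeshParameters p n σ ε τ)
    (hu : Component p B₁ B₂ ε u ureg ubl) (hv : Component p B₃ B₄ ε v vreg vbl) {i : ℕ}
    (hi : i < 4 * n) :
    IntervalIntegrable (cellError p n lam ε τ u ureg ubl v vreg vbl i) volume
      (node τ (4 * n) i) (node τ (4 * n) (i + 1)) := by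
  obtain ⟨c1, -, c2, c3⟩ := hu.continuousOn h hi
  obtain ⟨c4, -, c5, c6⟩ := hv.continuousOn h hi
  refine ContinuousOn.intervalIntegrable ?_
  rw [uIcc_of_le (h.isMesh.lt i hi).le]
  exact continuousOn_errorDensity _ _ _ c1 c4 c2 c3 c5 c6

theorem integral_cellError_le_of_coarse (h : MeshParameters p n σ ε τ) (hB : 0 < B)
    (hu : Component p B B ε u ureg ubl)
    (hv : Component p ((Real.sqrt ε)⁻¹ * B) B ε v vreg vbl) {i : ℕ} (h1 : n ≤ i) (h3 : i < 3 * n) :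
    ∫ t in node τ (4 * n) i..node τ (4 * n) (i + 1),
        cellError p n lam ε τ u ureg ubl v vreg vbl i t ≤
      ∫ t in node τ (4 * n) i..node τ (4 * n) (i + 1),
        ((2 + (lam - 4) ^ 2 * coarseWeight n ε ^ 2) * (B * (2 / (4 * n : ℕ)) ^ (p + 1)) ^ 2 +
          4 * B ^ 2 * (ε⁻¹ * layer ε t ^ 2)) := by
  have hi : i < 4 * n := by omega
  have hlay := continuous_layer ε
  refine intervalIntegral.integral_mono_on (h.isMesh.lt i hi).le
    (intervalIntegrable_cellError h hu hv hi)
    (Continuous.intervalIntegrable (by fun_prop) _ _) fun t ht => ?_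
  rw [cellError, cellWeight, if_pos ⟨h1, h3⟩]
  exact errorDensity_le_of_coarse h hB _ hu hv h1 h3 ht

theorem integral_cellError_le_of_fine (h : MeshParameters p n σ ε τ) (hB : 0 < B)
    (hu : Component p B B ε u ureg ubl)
    (hv : Component p ((Real.sqrt ε)⁻¹ * B) B ε v vreg vbl) {i : ℕ} (hi : i < 4 * n)
    (hif : i < n ∨ 3 * n ≤ i) :
    ∫ t in node τ (4 * n) i..node τ (4 * n) (i + 1),
        cellError p n lam ε τ u ureg ubl v vreg vbl i t ≤
      (∫ t in node τ (4 * n) i..node τ (4 * n) (i + 1),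
        2 * (2 + (lam - 4) ^ 2) * (B * fineFactor p n σ) ^ 2 * (1 + ε⁻¹ * layer ε t ^ 2)) +
        τ / n * (4 * (ε⁻¹ * (B * corrFactor n σ ε τ) ^ 2)) := by
  have hlay := continuous_layer ε
  have c1 : Continuous fun t =>
    2 * (2 + (lam - 4) ^ 2) * (B * fineFactor p n σ) ^ 2 * (1 + ε⁻¹ * layer ε t ^ 2) := by fun_prop
  rw [← h.node_sub_of_fine hif, ← smul_eq_mul (node τ (4 * n) (i + 1) - node τ (4 * n) i),
    ← intervalIntegral.integral_const,
    ← intervalIntegral.integral_add (c1.intervalIntegrable _ _) (by simp)]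
  refine intervalIntegral.integral_mono_on (h.isMesh.lt i hi).le
    (intervalIntegrable_cellError h hu hv hi)
    ((c1.add continuous_const).intervalIntegrable _ _) fun t ht => ?_
  rw [cellError, cellWeight, if_neg (by omega)]
  exact errorDensity_le_of_fine h hB hu hv hi hif ht

theorem sum_cellError_le (h : MeshParameters p n σ ε τ) (hB : 0 < B)
    (hu : Component p B B ε u ureg ubl)
    (hv : Component p ((Real.sqrt ε)⁻¹ * B) B ε v vreg vbl) :
    ∑ i ∈ Finset.range (4 * n), ∫ t in node τ (4 * n) i..node τ (4 * n) (i + 1),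
        cellError p n lam ε τ u ureg ubl v vreg vbl i t ≤
      6 * (2 + (lam - 4) ^ 2) * (B * fineFactor p n σ) ^ 2 +
        16 * (τ * ε⁻¹) * (B * corrFactor n σ ε τ) ^ 2 +
        (2 + (lam - 4) ^ 2 * coarseWeight n ε ^ 2) * (B * (2 / (4 * n : ℕ)) ^ (p + 1)) ^ 2 +
        8 * B ^ 2 * Real.exp (-τ / ε) ^ 2 := by
  have hε := h.eps_pos
  have hx := h.isMesh
  have hn := h.n_pos
  have hn' : (0 : ℝ) < n := by exact_mod_cast hn
  set x := node τ (4 * n) with hxdef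
  set A := 2 * (2 + (lam - 4) ^ 2) * (B * fineFactor p n σ) ^ 2 with hA
  set b := 4 * (ε⁻¹ * (B * corrFactor n σ ε τ) ^ 2) with hb
  set d := (2 + (lam - 4) ^ 2 * coarseWeight n ε ^ 2) * (B * (2 / (4 * n : ℕ)) ^ (p + 1)) ^ 2
    with hd
  have hA0 : 0 ≤ A := by positivity
  have hb0 : 0 ≤ b := by positivity
  have hd0 : 0 ≤ d := by positivity
  clear_value A b d
  let g : ℝ → ℝ := fun t => A * (1 + ε⁻¹ * layer ε t ^ 2)
  let k : ℝ → ℝ := fun t => d + 4 * B ^ 2 * (ε⁻¹ * layer ε t ^ 2)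
  have hlay := continuous_layer ε
  have cg : Continuous g := by fun_prop
  have ck : Continuous k := by fun_prop
  have hg0 : ∀ t, 0 ≤ g t := fun t => by positivity
  have hk0 : ∀ t, 0 ≤ k t := fun t => by positivity
  -- The nonnegative fine bound is imposed on all cells and the coarse one added on coarse cells, so
  -- both sums telescope, to integrals over [0,1] and [τ,1-τ].
  have hcell : ∀ i ∈ Finset.range (4 * n),
      ∫ t in x i..x (i + 1), cellError p n lam ε τ u ureg ubl v vreg vbl i t ≤
      ((∫ t in x i..x (i + 1), g t) + τ / n * b) +
        if n ≤ i ∧ i < 3 * n then ∫ t in x i..x (i + 1), k t else 0 := by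
    intro i hi
    have hi := Finset.mem_range.1 hi
    have hlt := hx.lt i hi
    split_ifs with hc
    · have h1 := integral_cellError_le_of_coarse (lam := lam) h hB hu hv hc.1 hc.2
      rw [← hxdef, ← hd] at h1
      have h1' : _ ≤ ∫ t in x i..x (i + 1), k t := h1
      have h2 : 0 ≤ ∫ t in x i..x (i + 1), g t :=
        intervalIntegral.integral_nonneg hlt.le fun t _ => hg0 t
      have h3 : 0 ≤ τ / n * b := mul_nonneg (div_nonneg h.tau_pos.le hn'.le) hb0
      linarith
    · have h1 := integral_cellError_le_of_fine (lam := lam) h hB hu hv hi (by omega)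
      rw [← hxdef, ← hA, ← hb] at h1
      have h1' : _ ≤ (∫ t in x i..x (i + 1), g t) + _ := h1
      linarith
  refine (Finset.sum_le_sum hcell).trans ?_
  rw [Finset.sum_add_distrib, Finset.sum_add_distrib, Finset.sum_const, Finset.card_range,
    ← Finset.sum_filter]
  have hfilter : (Finset.range (4 * n)).filter (fun i => n ≤ i ∧ i < 3 * n) =
      Finset.Ico n (3 * n) := by
    ext i
    simp only [Finset.mem_filter, Finset.mem_range, Finset.mem_Ico]
    omega
  rw [hfilter, intervalIntegral.sum_integral_adjacent_intervals fun i _ =>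
      cg.intervalIntegrable _ _,
    intervalIntegral.sum_integral_adjacent_intervals_Ico (by omega) fun i _ =>
      ck.intervalIntegrable _ _, hxdef, node_first hn, node_last hn, node_transition hn,
    node_transition' hn]
  have i0 : ∀ a b : ℝ, IntervalIntegrable (fun t => layer ε t ^ 2) volume a b := fun a b =>
    (hlay.pow 2).intervalIntegrable a b
  have e1 : ∫ t in (0 : ℝ)..1, g t = A * (1 + ε⁻¹ * ∫ t in (0 : ℝ)..1, layer ε t ^ 2) := by
    simp only [g]
    rw [intervalIntegral.integral_const_mul, intervalIntegral.integral_add (by simp)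
      ((i0 _ _).const_mul _), intervalIntegral.integral_const_mul]
    simp
  have e2 : ∫ t in τ..(1 - τ), k t =
      (1 - 2 * τ) * d + 4 * B ^ 2 * (ε⁻¹ * ∫ t in τ..(1 - τ), layer ε t ^ 2) := by
    simp only [k]
    rw [intervalIntegral.integral_add (by simp) (((i0 _ _).const_mul _).const_mul _),
      intervalIntegral.integral_const_mul, intervalIntegral.integral_const_mul,
      intervalIntegral.integral_const, smul_eq_mul]
    ring
  have l1 := integral_layer_sq_le (c := 0) hε (by norm_num)
  have l2 := integral_layer_sq_le (c := τ) hε (by linarith [h.tau_le])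
  simp only [sub_zero, neg_zero, zero_div, Real.exp_zero, one_pow, mul_one] at l1
  have l1' : ε⁻¹ * ∫ t in (0 : ℝ)..1, layer ε t ^ 2 ≤ 2 :=
    (mul_le_mul_of_nonneg_left l1 (by positivity)).trans_eq (by field_simp)
  have l2' : ε⁻¹ * ∫ t in τ..(1 - τ), layer ε t ^ 2 ≤ 2 * Real.exp (-τ / ε) ^ 2 :=
    (mul_le_mul_of_nonneg_left l2 (by positivity)).trans_eq (by field_simp)
  have m1 := mul_le_mul_of_nonneg_left l1' hA0
  have m2 := mul_le_mul_of_nonneg_left l2' (show 0 ≤ 4 * B ^ 2 by positivity)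
  have m3 : (1 - 2 * τ) * d ≤ d := by nlinarith [h.tau_pos]
  have m4 : (4 * n) • (τ / n * b) = 16 * (τ * ε⁻¹) * (B * corrFactor n σ ε τ) ^ 2 := by
    rw [nsmul_eq_mul, hb]
    push_cast
    field_simp
    ring
  rw [e1, e2, m4]
  linarith

/-- The constant of the consistency estimate. -/
noncomputable def consistencyConst (p : ℕ) (σ lam B : ℝ) : ℝ :=
  6 * (2 + (lam - 4) ^ 2) * (B * (Real.exp (4 * σ) * (4 * σ) ^ (p + 1))) ^ 2 +
    64 * σ * (σ + 12) ^ 2 * B ^ 2 + 2 * (B * 2 ^ (p + 1)) ^ 2 + 8 * B ^ 2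

theorem sum_cellError_le_const (h : MeshParameters p n σ ε τ) (hB : 0 < B)
    (hu : Component p B B ε u ureg ubl)
    (hv : Component p ((Real.sqrt ε)⁻¹ * B) B ε v vreg vbl) :
    ∑ i ∈ Finset.range (4 * n), ∫ t in node τ (4 * n) i..node τ (4 * n) (i + 1),
        cellError p n lam ε τ u ureg ubl v vreg vbl i t ≤
      consistencyConst p σ lam B * ((Real.log (4 * n : ℕ) ^ (p + 1) +
        |lam - 4| * coarseWeight n ε) * (((4 * n : ℕ) : ℝ) ^ (p + 1))⁻¹) ^ 2 := by
  refine (sum_cellError_le h hB hu hv).trans ?_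
  have hε := h.eps_pos
  have hL := h.one_le_log
  have hσ := h.one_le_sigma
  have hm := coarseWeight_pos h
  have hτε : τ * ε⁻¹ = σ * Real.log (4 * n : ℕ) := by rw [h.tau_eq]; field_simp
  have hN : (0 : ℝ) < (4 * n : ℕ) := by have := h.n_pos; positivity
  -- The choice of τ gives e^{-τ/ε} = N^{-σ}, and σ ≥ p + 1.
  have hexp : Real.exp (-τ / ε) ≤ (((4 * n : ℕ) : ℝ) ^ (p + 1))⁻¹ := by
    rw [← Real.rpow_natCast, ← Real.rpow_neg hN.le, Real.rpow_def_of_pos hN]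
    refine Real.exp_le_exp.2 ?_
    have e : -τ / ε = -(σ * Real.log (4 * n : ℕ)) := by rw [← hτε]; field_simp
    rw [e]
    push_cast
    have := mul_le_mul_of_nonneg_right h.le_sigma (zero_le_one.trans hL)
    push_cast at this
    linarith
  have hff : fineFactor p n σ = Real.exp (4 * σ) * (4 * σ) ^ (p + 1) *
      (Real.log (4 * n : ℕ) ^ (p + 1) * (((4 * n : ℕ) : ℝ) ^ (p + 1))⁻¹) := by
    rw [fineFactor, mul_pow, div_pow]; ring
  rw [hτε, hff, corrFactor, div_pow]
  set L := Real.log (4 * n : ℕ) with hLdef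
  set q := (((4 * n : ℕ) : ℝ) ^ (p + 1))⁻¹ with hq
  set m := coarseWeight n ε with hmdef
  set y := Real.exp (-τ / ε) with hy
  have hq0 : 0 < q := by positivity
  have hy0 : 0 < y := by positivity
  have hy2 : y ^ 2 ≤ q ^ 2 := pow_le_pow_left₀ hy0.le hexp 2
  have ha : 1 ≤ L ^ (p + 1) := one_le_pow₀ hL
  -- Two logarithms come from the squared corrections and one from τ/ε, the total length of the fine
  -- cells relative to ε.
  have hL3 : L ^ 3 ≤ (L ^ (p + 1)) ^ 2 := by
    rw [← pow_mul]; exact pow_le_pow_right₀ hL (by have := h.three_le; omega)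
  set a := L ^ (p + 1) with hadef
  set T := (a + |lam - 4| * m) * q with hT
  have ht : 0 ≤ |lam - 4| * m := by positivity
  have hT1 : (a * q) ^ 2 ≤ T ^ 2 := by
    refine pow_le_pow_left₀ (by positivity) ?_ 2
    rw [hT]; gcongr; linarith
  have hT2 : a ^ 2 * q ^ 2 + (lam - 4) ^ 2 * m ^ 2 * q ^ 2 ≤ T ^ 2 := by
    have : T ^ 2 = a ^ 2 * q ^ 2 + (|lam - 4| ^ 2) * m ^ 2 * q ^ 2 +
        2 * a * (|lam - 4| * m) * q ^ 2 := by rw [hT]; ring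
    rw [this, sq_abs]
    have : 0 ≤ 2 * a * (|lam - 4| * m) * q ^ 2 := by positivity
    linarith
  have ha2 : q ^ 2 ≤ (a * q) ^ 2 := by
    rw [mul_pow]; exact le_mul_of_one_le_left (sq_nonneg _) (one_le_pow₀ ha)
  have t1 : 6 * (2 + (lam - 4) ^ 2) * (B * (Real.exp (4 * σ) * (4 * σ) ^ (p + 1) * (a * q))) ^ 2 ≤
      6 * (2 + (lam - 4) ^ 2) * (B * (Real.exp (4 * σ) * (4 * σ) ^ (p + 1))) ^ 2 * T ^ 2 := by
    calc _ = 6 * (2 + (lam - 4) ^ 2) * (B * (Real.exp (4 * σ) * (4 * σ) ^ (p + 1))) ^ 2 *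
          (a * q) ^ 2 := by ring
      _ ≤ _ := by gcongr
  have t2 : 16 * (σ * L) * (B * ((σ + 12) * L * (2 * y))) ^ 2 ≤
      64 * σ * (σ + 12) ^ 2 * B ^ 2 * T ^ 2 := by
    calc _ = 64 * σ * (σ + 12) ^ 2 * B ^ 2 * (L ^ 3 * y ^ 2) := by ring
      _ ≤ 64 * σ * (σ + 12) ^ 2 * B ^ 2 * (a ^ 2 * q ^ 2) := by gcongr
      _ ≤ _ := by rw [← mul_pow]; gcongr
  have t3 : (2 + (lam - 4) ^ 2 * m ^ 2) * (B * (2 ^ (p + 1) / ((4 * n : ℕ) : ℝ) ^ (p + 1))) ^ 2 ≤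
      2 * (B * 2 ^ (p + 1)) ^ 2 * T ^ 2 := by
    have e : (2 : ℝ) ^ (p + 1) / ((4 * n : ℕ) : ℝ) ^ (p + 1) = 2 ^ (p + 1) * q := div_eq_mul_inv _ _
    have hle : (2 + (lam - 4) ^ 2 * m ^ 2) * q ^ 2 ≤ 2 * T ^ 2 := by
      have h0 : 0 ≤ (lam - 4) ^ 2 * m ^ 2 * q ^ 2 := by positivity
      rw [mul_pow] at ha2
      linarith
    rw [e]
    calc _ = (B * 2 ^ (p + 1)) ^ 2 * ((2 + (lam - 4) ^ 2 * m ^ 2) * q ^ 2) := by ring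
      _ ≤ (B * 2 ^ (p + 1)) ^ 2 * (2 * T ^ 2) := by gcongr
      _ = _ := by ring
  have t4 : 8 * B ^ 2 * y ^ 2 ≤ 8 * B ^ 2 * T ^ 2 := by
    gcongr 8 * B ^ 2 * ?_
    exact hy2.trans (ha2.trans hT1)
  rw [consistencyConst]
  linarith

end Estimate

/-! ### From the solution decomposition to the final estimate -/

section Setting

variable {p n : ℕ} {σ ε τ M : ℝ} {f u ureg ubl₀ ubl₁ : ℝ → ℝ}

namespace IsDecomp

theorem diffUpTo_bl {K : ℕ} (hd : IsDecomp K M ε f u ureg ubl₀ ubl₁) :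
    DiffUpTo K (ubl₀ + ubl₁) := hd.diff_bl₀.add hd.diff_bl₁

theorem eq_add {K : ℕ} (hd : IsDecomp K M ε f u ureg ubl₀ ubl₁) :
    ∀ t ∈ Icc (0 : ℝ) 1, u t = (ureg + (ubl₀ + ubl₁)) t := fun t ht => by
  rw [hd.sum t ht]
  simp only [Pi.add_apply]
  ring

theorem diffUpTo {K : ℕ} (hd : IsDecomp K M ε f u ureg ubl₀ ubl₁) : DiffUpTo K u :=
  (hd.diff_reg.add hd.diffUpTo_bl).congr hd.eq_add

theorem D_eq {K : ℕ} (hd : IsDecomp K M ε f u ureg ubl₀ ubl₁) {k : ℕ} (hk : k ≤ K) {t : ℝ}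
    (ht : t ∈ Icc (0 : ℝ) 1) : D k u t = D k ureg t + D k (ubl₀ + ubl₁) t := by
  rw [D_congr hd.eq_add k ht, D_add hd.diff_reg hd.diffUpTo_bl hk ht]

theorem bound_bl {K : ℕ} (hd : IsDecomp K M ε f u ureg ubl₀ ubl₁) {k : ℕ} (hk : k ≤ K) {t : ℝ}
    (ht : t ∈ Icc (0 : ℝ) 1) : |D k (ubl₀ + ubl₁) t| ≤ M * ((ε ^ k)⁻¹ * layer ε t) := by
  rw [D_add hd.diff_bl₀ hd.diff_bl₁ hk ht]
  refine (abs_add_le _ _).trans ((add_le_add (hd.bound_bl₀ k hk t ht)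
    (hd.bound_bl₁ k hk t ht)).trans_eq ?_)
  rw [layer]; ring

theorem mono {K : ℕ} {M' : ℝ} (hd : IsDecomp K M ε f u ureg ubl₀ ubl₁) (hM : M ≤ M')
    (hε : 0 < ε) : IsDecomp K M' ε f u ureg ubl₀ ubl₁ :=
  { hd with
    bound_reg := fun k hk t ht => (hd.bound_reg k hk t ht).trans hM
    bound_bl₀ := fun k hk t ht => (hd.bound_bl₀ k hk t ht).trans (by gcongr)
    bound_bl₁ := fun k hk t ht => (hd.bound_bl₁ k hk t ht).trans (by gcongr) }

theorem component (hd : IsDecomp (p + 3) M ε f u ureg ubl₀ ubl₁) :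
    Component p M M ε u ureg (ubl₀ + ubl₁) where
  diff := hd.diffUpTo.mono (by omega)
  diff_reg := hd.diff_reg.mono (by omega)
  sum _ hk _ ht := hd.D_eq (by omega) ht
  bound_reg t ht := hd.bound_reg (p + 1) (by omega) t ht
  bound_bl _ hk _ ht := hd.bound_bl (by omega) ht

/-- The layer of `v` grows by ε^{3/2}ε^{-2} = ε^{-1/2}, while its regular part is multiplied by
ε^{3/2} ≤ 1; this is why `Component` carries two constants. Two derivatives are spent, which
accounts for the order `p + 3`. -/
theorem component_scaledSecond (hd : IsDecomp (p + 3) M ε f u ureg ubl₀ ubl₁)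
    (hε : 0 < ε) (hε1 : ε ≤ 1) :
    Component p ((Real.sqrt ε)⁻¹ * M) M ε (scaledSecond ε u) (scaledSecond ε ureg)
      (scaledSecond ε (ubl₀ + ubl₁)) where
  diff := hd.diffUpTo.scaledSecond ε
  diff_reg := hd.diff_reg.scaledSecond ε
  sum k hk t ht := by
    rw [D_scaledSecond hd.diffUpTo ε hk ht, D_scaledSecond hd.diff_reg ε hk ht,
      D_scaledSecond hd.diffUpTo_bl ε hk ht, hd.D_eq (by omega) ht, mul_add]
  bound_reg t ht := by
    rw [D_scaledSecond hd.diff_reg ε le_rfl ht, abs_mul, abs_of_nonneg (by positivity)]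
    calc _ ≤ 1 * M := mul_le_mul (Real.rpow_le_one hε.le hε1 (by norm_num))
          (hd.bound_reg _ (by omega) t ht) (abs_nonneg _) zero_le_one
      _ = M := one_mul M
  bound_bl k hk t ht := by
    rw [D_scaledSecond hd.diffUpTo_bl ε hk ht, abs_mul, abs_of_nonneg (by positivity),
      rpow_three_halves hε.le]
    refine (mul_le_mul_of_nonneg_left (hd.bound_bl (by omega) ht) (by positivity)).trans_eq ?_
    have hs := Real.sqrt_pos.2 hε
    have e : Real.sqrt ε ^ 3 * (ε ^ (k + 2))⁻¹ = (Real.sqrt ε)⁻¹ * (ε ^ k)⁻¹ := by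
      have : ε ^ (k + 2) = ε ^ k * Real.sqrt ε ^ 4 := by
        rw [pow_add, show Real.sqrt ε ^ 4 = (Real.sqrt ε ^ 2) ^ 2 by ring, Real.sq_sqrt hε.le]
      rw [this]
      field_simp
    linear_combination (M * layer ε t) * e

end IsDecomp

theorem Component.sum_slope {B B' : ℝ} {w wreg wbl : ℝ → ℝ}
    (hw : Component p B B' ε w wreg wbl) :
    ∀ t ∈ Icc (0 : ℝ) 1, w t = wreg t + wbl t ∧ D 1 w t = D 1 wreg t + D 1 wbl t := fun t ht =>
  ⟨by simpa only [D_zero] using hw.sum 0 (by omega) t ht, hw.sum 1 (by omega) t ht⟩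

theorem Clamped.sub {s t : ℝ → ℝ} (hs : Clamped s) (ht : Clamped t)
    (ds : DifferentiableOn ℝ s (Icc 0 1)) (dt : DifferentiableOn ℝ t (Icc 0 1)) :
    Clamped (s - t) := by
  have h : ∀ v ∈ Icc (0 : ℝ) 1, D 1 (s - t) v = D 1 s v - D 1 t v := fun v hv => by
    simp only [iteratedDerivWithin_one]
    exact derivWithin_sub (ds v hv) (dt v hv)
  have h0 := left_mem_Icc.2 (zero_le_one (α := ℝ))
  have h1 := right_mem_Icc.2 (zero_le_one (α := ℝ))
  exact ⟨by simp [hs.value_zero, ht.value_zero], by rw [h 0 h0, hs.slope_zero, ht.slope_zero, sub_zero],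
    by simp [hs.value_one, ht.value_one], by rw [h 1 h1, hs.slope_one, ht.slope_one, sub_zero]⟩

/-- The supercloseness estimate for a fixed decomposition. -/
theorem balancedNorm_special_sub_le {lam K : ℝ} {uh vh : ℝ → ℝ} (h : MeshParameters p n σ ε τ)
    (hlam : 3 ≤ lam) (hM : 0 < M) (hK : 0 < K)
    (hinv : ∀ F : ℝ[X], F.natDegree ≤ p → ∀ a b : ℝ, a < b →
      (b - a) ^ 4 * ∫ t in a..b, F.derivative.derivative.eval t ^ 2 ≤
        K * ∫ t in a..b, F.eval t ^ 2)
    (hsol : IsSolution ε f u) (hd : IsDecomp (p + 3) M ε f u ureg ubl₀ ubl₁)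
    (hfem : IsFEMSolution p (node τ (4 * n)) (4 * n) lam ε f (uh, vh)) :
    balancedNorm ε
        (uTilde p (node τ (4 * n)) (4 * n) τ u ureg ubl₀ ubl₁ - uh,
          vTilde p (node τ (4 * n)) (4 * n) τ ε u ureg ubl₀ ubl₁ - vh) ≤
      Real.sqrt (2 * (8 * lam ^ 2 + 1200 + (K + 1)) * consistencyConst p σ lam M) *
        ((Real.log (4 * n : ℕ) ^ (p + 1) + |lam - 4| * coarseWeight n ε) *
          (((4 * n : ℕ) : ℝ) ^ (p + 1))⁻¹) := by
  have hp := h.three_le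
  have hx := h.isMesh
  have hε := h.eps_pos
  have hu := hd.component
  have hv := hd.component_scaledSecond hε h.eps_le_one
  have hu3 : DiffUpTo 3 u := hu.diff.mono (by omega)
  have hr3 : DiffUpTo 3 ureg := hu.diff_reg.mono (by omega)
  have hv3 : DiffUpTo 3 (scaledSecond ε u) := hv.diff.mono (by omega)
  have hvr3 : DiffUpTo 3 (scaledSecond ε ureg) := hv.diff_reg.mono (by omega)
  obtain ⟨su, pu⟩ := isSpline_special hp h.n_pos h.tau_pos h.tau_le hu3 hr3 hu.sum_slope
  obtain ⟨sv, pv⟩ := isSpline_special hp h.n_pos h.tau_pos h.tau_le hv3 hvr3 hv.sum_slope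
  have cu := clamped_special hp h.n_pos h.tau_pos h.tau_le hu3 hr3 hu.sum_slope hsol.clamped
  obtain ⟨hsu, hsv, hmu, hmv⟩ := hfem.1
  dsimp only at hsu hsv hmu hmv
  obtain ⟨Uh, dU, hU⟩ := hsu.exists_isPiecewise hx
  obtain ⟨Vh, dV, hV⟩ := hsv.exists_isPiecewise hx
  change balancedNorm ε (special p (node τ (4 * n)) (4 * n) τ u ureg (ubl₀ + ubl₁) - uh,
    special p (node τ (4 * n)) (4 * n) τ (scaledSecond ε u) (scaledSecond ε ureg)
      (scaledSecond ε (ubl₀ + ubl₁)) - vh) ≤ _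
  set ut := special p (node τ (4 * n)) (4 * n) τ u ureg (ubl₀ + ubl₁)
  set vt := special p (node τ (4 * n)) (4 * n) τ (scaledSecond ε u) (scaledSecond ε ureg)
      (scaledSecond ε (ubl₀ + ubl₁))
  set P := specialPoly p n τ u ureg (ubl₀ + ubl₁) with hP
  set Q := specialPoly p n τ (scaledSecond ε u) (scaledSecond ε ureg)
      (scaledSecond ε (ubl₀ + ubl₁)) with hQ
  have hE : IsPiecewise (node τ (4 * n)) (4 * n) (ut - uh) (P - Uh) :=
    (su.sub hsu).isPiecewise hx fun i hi t ht => by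
      have ht := Ioo_subset_Icc_self ht
      simp [pu.value i hi t ht, hU.value i hi t ht]
  have hF : IsPiecewise (node τ (4 * n)) (4 * n) (vt - vh) (Q - Vh) :=
    (sv.sub hsv).isPiecewise hx fun i hi t ht => by
      have ht := Ioo_subset_Icc_self ht
      simp [pv.value i hi t ht, hV.value i hi t ht]
  have hcl : Clamped (ut - uh) :=
    cu.sub hmu.toClamped (su.memH2 hx).diff hmu.toMemH2.diff
  have hmem : (ut - uh, vt - vh) ∈ feSpace p (node τ (4 * n)) (4 * n) :=
    ⟨su.sub hsu, sv.sub hsv, ⟨(su.sub hsu).memH2 hx, hcl⟩, (sv.sub hsv).memH2 hx⟩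
  have hdegP : ∀ i < 4 * n, ((P - Uh) i).natDegree ≤ p := fun i hi =>
    (natDegree_sub_le _ _).trans (max_le (natDegree_specialPoly_le hp h.tau_pos
      (isLocalInterp_cellTarget hp h.n_pos h.tau_pos h.tau_le hu3 hr3 hi)) (dU i))
  have hdegQ : ∀ i < 4 * n, ((Q - Vh) i).natDegree ≤ p := fun i hi =>
    (natDegree_sub_le _ _).trans (max_le (natDegree_specialPoly_le hp h.tau_pos
      (isLocalInterp_cellTarget hp h.n_pos h.tau_pos h.tau_le hv3 hvr3 hi)) (dV i))
  have hvu : ∀ t ∈ Icc (0 : ℝ) 1, scaledSecond ε u t = ε ^ (3 / 2 : ℝ) * D 2 u t ∧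
      D 2 (scaledSecond ε u) t = ε ^ (3 / 2 : ℝ) * D 4 u t := fun t ht =>
    ⟨rfl, D_scaledSecond hd.diffUpTo ε (by omega) ht⟩
  -- Energy ≤ form = residual ≤ half the energy plus the error terms; absorbing the half produces
  -- the factor 2 under the root.
  have h1 := sum_energyDensity_le hx hlam hε h.eps_le_one hE hF hcl
  have h2 := galerkin_orthogonality hx hsol (hd.diffUpTo.mono (by omega)) hfem hmem hU hV hE hF
  have h3 := sum_residual_le (lam := lam) h hK hinv hu hv hvu hdegP hdegQ
  have h4 := sum_cellError_le_const (lam := lam) h hM hu hv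
  have hT : 0 ≤ (Real.log (4 * n : ℕ) ^ (p + 1) + |lam - 4| * coarseWeight n ε) *
      (((4 * n : ℕ) : ℝ) ^ (p + 1))⁻¹ := by
    have := coarseWeight_pos h
    have := h.one_le_log
    positivity
  rw [balancedNorm_eq hx ε hE hF]
  refine Real.sqrt_le_iff.2 ⟨mul_nonneg (Real.sqrt_nonneg _) hT, ?_⟩
  have hC : 0 ≤ consistencyConst p σ lam M := by
    have := h.one_le_sigma
    unfold consistencyConst
    positivity
  rw [mul_pow, Real.sq_sqrt (by positivity)]
  have h5 := mul_le_mul_of_nonneg_left h4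
    (show 0 ≤ 8 * lam ^ 2 + 1200 + (K + 1) by positivity)
  simp only [Pi.sub_apply] at h1 h3 ⊢
  linarith

end Setting

end ThinShell

theorem mainTheorem3 (p : ℕ) (hp : 3 ≤ p) (σ : ℝ) (hσ : (p : ℝ) + 1 ≤ σ)
    (lam : ℝ) (hlam : 3 ≤ lam) (M : ℝ) :
    ∃ C : ℝ, 0 < C ∧
      ∀ (ε : ℝ) (N : ℕ) (f u ureg ubl₀ ubl₁ uh vh : ℝ → ℝ) (τ : ℝ) (x : ℕ → ℝ),
        0 < ε → ε ≤ 1 → 0 < N → 4 ∣ N →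
        σ * ε * Real.log N ≤ 1 / 4 →
        τ = transition σ ε N → x = node τ N →
        MemL2 f → IsSolution ε f u →
        IsDecomp (p + 3) M ε f u ureg ubl₀ ubl₁ →
        IsFEMSolution p x N lam ε f (uh, vh) →
        balancedNorm ε
            (uTilde p x N τ u ureg ubl₀ ubl₁ - uh, vTilde p x N τ ε u ureg ubl₀ ubl₁ - vh) ≤
          C * ((Real.log N ^ (p + 1) +
              |lam - 4| * min (ε ^ (3 / 2 : ℝ) * (N : ℝ) ^ 2) (ε ^ (-(1 / 2) : ℝ))) *
            ((N : ℝ) ^ (p + 1))⁻¹) := by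
  obtain ⟨K, hK, hinv⟩ := exists_inverse_inequality p
  -- The interpolation estimates divide by the derivative bound, so `M` is enlarged to the positive
  -- `|M| + 1`; the final `+ 1` makes the constant positive.
  refine ⟨Real.sqrt (2 * (8 * lam ^ 2 + 1200 + (K + 1)) * consistencyConst p σ lam (|M| + 1)) + 1,
    by positivity, ?_⟩
  rintro ε N f u ureg ubl₀ ubl₁ uh vh τ x hε hε1 hN ⟨n, rfl⟩ hτ rfl rfl - hsol hd hfem
  have h : MeshParameters p n σ ε (transition σ ε (4 * n)) :=
    ⟨hp, by omega, hσ, hε, hε1, min_eq_right hτ, min_le_left _ _⟩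
  have key := balancedNorm_special_sub_le h hlam (by positivity : 0 < |M| + 1) hK hinv hsol
    (hd.mono (by linarith [le_abs_self M]) hε) hfem
  refine key.trans ?_
  rw [coarseWeight]
  have hT : 0 ≤ (Real.log (4 * n : ℕ) ^ (p + 1) + |lam - 4| *
      min (ε ^ (3 / 2 : ℝ) * ((4 * n : ℕ) : ℝ) ^ 2) (ε ^ (-(1 / 2) : ℝ))) *
      (((4 * n : ℕ) : ℝ) ^ (p + 1))⁻¹ := by
    have := h.one_le_log
    positivity
  gcongr
  linarith
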